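/- Let $\Sigma$ be a connected Riemann surface with a finite set ${\bf z}$ of marked points and a base point $z_0\in\Sigma\setminus{\bf z}$, let $X$ be a reduced orbifold (for example a reduced almost complex orbifold), let $p\in X$ (in particular $p$ may be a singular point), and let $(V_p,G_p,\pi_p)$ be a chart of $X$ centred at $p$, so that $G_p$ is the local group at $p$. Consider the constant map $f:\Sigma\to X$, $f\equiv p$. An orbicurve structure on $(\Sigma,{\bf z})$ is an orbifold structure (a germ of orbifold charts) such that for some multiplicities $m_i\ge 1$ a disc neighbourhood of each $z_i\in{\bf z}$ is uniformized by $w\mapsto w^{m_i}$, and such that all points outside ${\bf z}$ are smooth. A $C^\infty$ map between orbifolds is a germ of local $C^\infty$ liftings of a continuous map. A compatible system $\xi$ of a $C^\infty$ map $\tilde f$ consists of a compatible cover $\mathcal U$ of the source by uniformized open sets $U$, an assignment $U\mapsto U'$, preserving inclusions, of uniformized open sets of the target with $f(U)\subset U'$, liftings $\tilde f_{UU'}$ of $f$ in the germ of $\tilde f$, and an assignment to each injection $i:(V_2,G_2,\pi_2)\to(V_1,G_1,\pi_1)$ of uniformizing systems of the cover of an injection $\lambda(i)$ between the corresponding uniformizing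 systems of the target, with $\tilde f_{U_1U_1'}\circ i=\lambda(i)\circ\tilde f_{U_2U_2'}$ and $\lambda(j\circ i)=\lambda(j)\circ\lambda(i)$; $\tilde f$ is good if it admits a compatible system. Two compatible systems are isomorphic if, for every orbifold bundle $E$ over the target, the two pull-backs of $E$ are isomorphic compatibly with their maps to $E$. The characteristic of (the isomorphism class of) a compatible system of $f$ is the conjugacy class of the homomorphism $\pi_1(\Sigma\setminus{\bf z},z_0)\to G_p$ that sends a loop to the product of the elements of $G_p$ which represent the transition injections $\lambda(i)$ along the loop, computed for an isomorphic system all of whose sets $U'$ inject into $(V_p,G_p,\pi_p)$. Let $\Theta$ be a conjugacy class of homomorphisms $\theta:\pi_1(\Sigma\setminus{\bf z},z_0)\to G_p$. Then there is a unique orbicurve structure on $(\Sigma,{\bf z})$ over which $f$ has a compatible system with characteristic $\Theta$ whose group homomorphism at each point of $\Sigma$ (from the local group of that point to $G_p$) is injective. Over this orbifold structure there is a unique $C^\infty$ map $\tilde f$ with underlying map $f$; it is good, and there is an isomorphism class of compatible systems of $\tilde f$ with injective group homomorphisms whose characteristic is exactly $\Theta$; a compatible system of $\tilde f$ has characteristic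 $\Theta$ if and only if it belongs to this isomorphism class. -/

import Mathlib

open Set Topology
open scoped Manifold ContDiff

/-! ## Uniformizing systems, injections and orbifold structures -/

/-- The derivative of a self-map of a manifold at a point `x`, as an endomorphism of the model space
(it is used where `x` is a fixed point, so that it is an endomorphism of the tangent space). -/
noncomputable def selfDeriv {n : ℕ} {V : Type*} [TopologicalSpace V]
    [ChartedSpace (EuclideanSpace ℝ (Fin n)) V] (f : V → V) (x : V) :
    EuclideanSpace ℝ (Fin n) →L[ℝ] EuclideanSpace ℝ (Fin n) :=
  mfderiv (𝓡 n) (𝓡 n) f x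

/-- An `n`-dimensional uniformizing system `(V, G, π)` of an open subset of `X`: a connected smooth
manifold `V`, a finite group `G` acting smoothly on `V`, every element of which acts trivially or
has a fixed-point set of codimension at least two, and a map `π` inducing a homeomorphism of `V / G`
onto an open subset of `X` (the range of `π`): `π` is continuous and open, and its fibres are the
orbits. -/
structure UnifSys (n : ℕ) (X : Type*) [TopologicalSpace X] where
  /-- the manifold -/
  V : Type
  /-- the finite group -/
  G : Type
  [topV : TopologicalSpace V]
  [chartedV : ChartedSpace (EuclideanSpace ℝ (Fin n)) V]
  [manifoldV : IsManifold (𝓡 n) ∞ V]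
  [t2V : T2Space V]
  [secondCountableV : SecondCountableTopology V]
  [connectedV : ConnectedSpace V]
  [groupG : Group G]
  [finiteG : Finite G]
  [actG : MulAction G V]
  smooth_smul : ∀ g : G, ContMDiff (𝓡 n) (𝓡 n) ∞ (fun x : V => g • x)
  /-- At a fixed point `x` of `g` the codimension of the fixed-point set of `g` is the rank of
  `d g - 1`. -/
  codim_two : ∀ g : G, (∀ x : V, g • x = x) ∨ ∀ x : V, g • x = x →
    2 ≤ Module.finrank ℝ (LinearMap.range
      (selfDeriv (n := n) (fun y : V => g • y) x -
        ContinuousLinearMap.id ℝ (EuclideanSpace ℝ (Fin n))).toLinearMap)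
  /-- the projection -/
  π : V → X
  continuous_π : Continuous π
  isOpenMap_π : IsOpenMap π
  π_eq_iff : ∀ x y : V, π x = π y ↔ ∃ g : G, g • x = y

attribute [instance] UnifSys.topV UnifSys.chartedV UnifSys.manifoldV UnifSys.t2V
  UnifSys.secondCountableV UnifSys.connectedV UnifSys.groupG UnifSys.finiteG UnifSys.actG

namespace UnifSys

variable {n : ℕ} {X : Type*} [TopologicalSpace X]

/-- The uniformized open set `U = π(V)`. -/
def U (S : UnifSys n X) : Set X := range S.π

/-- An injection `(φ, λ) : (V', G', π') → (V, G, π)`: a monomorphism `λ` restricting to an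
isomorphism of the kernels of the actions, and a `λ`-equivariant open embedding `φ` (a
diffeomorphism onto an open subset) over the inclusion of the uniformized open sets. -/
structure Inj (S T : UnifSys n X) where
  /-- the open embedding -/
  toFun : S.V → T.V
  /-- the monomorphism -/
  hom : S.G →* T.G
  injective : Function.Injective toFun
  localDiffeo : IsLocalDiffeomorph (𝓡 n) (𝓡 n) ∞ toFun
  hom_injective : Function.Injective hom
  equivariant : ∀ (g : S.G) (x : S.V), toFun (g • x) = hom g • toFun x
  map_ker : ∀ g : S.G, (∀ x : S.V, g • x = x) → ∀ y : T.V, hom g • y = y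
  ker_surj : ∀ h : T.G, (∀ y : T.V, h • y = y) → ∃ g : S.G, (∀ x : S.V, g • x = x) ∧ hom g = h
  π_toFun : ∀ x : S.V, T.π (toFun x) = S.π x

instance (S T : UnifSys n X) : CoeFun (Inj S T) (fun _ => S.V → T.V) := ⟨Inj.toFun⟩

/-- Composition of injections. -/
def Inj.comp {R S T : UnifSys n X} (j : Inj S T) (i : Inj R S) : Inj R T where
  toFun := fun x => j (i x)
  hom := j.hom.comp i.hom
  injective := j.injective.comp i.injective
  localDiffeo := fun x => (i.localDiffeo x).comp (𝓡 n) T.V (j.localDiffeo (i x))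
  hom_injective := j.hom_injective.comp i.hom_injective
  equivariant := fun g x => by
    rw [i.equivariant, j.equivariant]; rfl
  map_ker := fun g hg => j.map_ker _ (i.map_ker g hg)
  ker_surj := fun h hh => by
    obtain ⟨g, hg, rfl⟩ := j.ker_surj h hh
    obtain ⟨g', hg', rfl⟩ := i.ker_surj g hg
    exact ⟨g', hg', rfl⟩
  π_toFun := fun x => by rw [j.π_toFun, i.π_toFun]

/-- The automorphism `x ↦ g • x`, `a ↦ g a g⁻¹` of a uniformizing system given by `g ∈ G`. -/
def aut (S : UnifSys n X) (g : S.G) : Inj S S where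
  toFun := fun x => g • x
  hom := (MulAut.conj g).toMonoidHom
  injective := MulAction.injective g
  localDiffeo :=
    Diffeomorph.isLocalDiffeomorph
      { toEquiv := MulAction.toPerm g
        contMDiff_toFun := S.smooth_smul g
        contMDiff_invFun := S.smooth_smul g⁻¹ }
  hom_injective := (MulAut.conj g).injective
  equivariant := fun a x => by
    simp [MulAut.conj_apply, mul_smul]
  map_ker := fun a ha y => by
    simp [MulAut.conj_apply, mul_smul, ha]
  ker_surj := fun h hh => ⟨g⁻¹ * h * g, fun x => by simp [mul_smul, hh], by
    simp [MulAut.conj_apply, mul_assoc]⟩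
  π_toFun := fun x => (S.π_eq_iff _ _).2 ⟨g⁻¹, by simp⟩

/-- Two uniformizing systems are equivalent at `q` if they induce isomorphic uniformizing systems
of a neighbourhood of `q`, i.e. if some uniformizing system of a neighbourhood of `q` injects into
both. -/
def EquivAt (q : X) (S T : UnifSys n X) : Prop :=
  ∃ R : UnifSys n X, q ∈ R.U ∧ Nonempty (Inj R S) ∧ Nonempty (Inj R T)

end UnifSys

open UnifSys (Inj)

/-- An `n`-dimensional orbifold structure on `X`. -/
structure OrbStruct (n : ℕ) (X : Type*) [TopologicalSpace X] where
  /-- the chart at a point -/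
  chart : X → UnifSys n X
  mem_chart : ∀ p, p ∈ (chart p).U
  compat : ∀ p, ∀ q ∈ (chart p).U, UnifSys.EquivAt q (chart p) (chart q)

namespace OrbStruct

variable {n : ℕ} {X : Type*} [TopologicalSpace X]

/-- Two orbifold structures are equivalent if they have the same germ at each point. -/
def Equiv (O₁ O₂ : OrbStruct n X) : Prop :=
  ∀ p, UnifSys.EquivAt p (O₁.chart p) (O₂.chart p)

/-- The uniformizing system `S` belongs to the orbifold, i.e. `S` defines the germ of the orbifold
structure at each point of the set which it uniformizes. -/
def Belongs (O : OrbStruct n X) (S : UnifSys n X) : Prop :=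
  ∀ q ∈ S.U, UnifSys.EquivAt q S (O.chart q)

/-- The orbifold is reduced: all the groups of its charts act effectively. -/
def Reduced (O : OrbStruct n X) : Prop :=
  ∀ p, ∀ g : (O.chart p).G, (∀ x : (O.chart p).V, g • x = x) → g = 1

end OrbStruct

/-! ## Smooth maps between orbifolds -/

section Maps

variable {n n' : ℕ} {X X' : Type*} [TopologicalSpace X] [TopologicalSpace X']

/-- A `C^∞` lifting of (the restriction of) `f` to uniformizing systems. -/
structure LocalLift (S : UnifSys n X) (T : UnifSys n' X') (f : X → X') where
  /-- the lifting -/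
  toFun : S.V → T.V
  smooth : ContMDiff (𝓡 n) (𝓡 n') ∞ toFun
  π_toFun : ∀ x, T.π (toFun x) = f (S.π x)
  equivariant : ∀ g : S.G, ∃ g' : T.G, ∀ x, g' • toFun x = toFun (g • x)

instance (S : UnifSys n X) (T : UnifSys n' X') (f : X → X') :
    CoeFun (LocalLift S T f) (fun _ => S.V → T.V) := ⟨LocalLift.toFun⟩

/-- Two local liftings are equivalent at `q` if they induce isomorphic liftings on a smaller
neighbourhood of `q`, i.e. if they both restrict, along suitable injections, to the same lifting. -/
def LocalLift.EquivAt {S₁ S₂ : UnifSys n X} {T₁ T₂ : UnifSys n' X'} {f : X → X'} (q : X)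
    (F₁ : LocalLift S₁ T₁ f) (F₂ : LocalLift S₂ T₂ f) : Prop :=
  ∃ (R : UnifSys n X) (R' : UnifSys n' X') (a₁ : Inj R S₁) (a₂ : Inj R S₂)
    (b₁ : Inj R' T₁) (b₂ : Inj R' T₂) (h : LocalLift R R' f), q ∈ R.U ∧
      ∀ x, F₁ (a₁ x) = b₁ (h x) ∧ F₂ (a₂ x) = b₂ (h x)

/-- A `C^∞` lifting of the map `f` between the orbifolds `(X, O)` and `(X', O')`. -/
structure SmoothLift (O : OrbStruct n X) (O' : OrbStruct n' X') (f : X → X') where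
  /-- the chart at a point -/
  src : X → UnifSys n X
  /-- the chart at the image of a point -/
  tgt : X → UnifSys n' X'
  src_belongs : ∀ p, O.Belongs (src p)
  tgt_belongs : ∀ p, O'.Belongs (tgt p)
  mem_src : ∀ p, p ∈ (src p).U
  /-- the local lifting near a point -/
  lift : ∀ p, LocalLift (src p) (tgt p) f
  compat : ∀ p, ∀ q ∈ (src p).U, LocalLift.EquivAt q (lift p) (lift q)

/-- Two liftings of `f` are equivalent if they have the same germ at each point; a `C^∞` map with
underlying map `f` is an equivalence class of liftings of `f`. -/
def SmoothLift.Equiv {O : OrbStruct n X} {O' : OrbStruct n' X'} {f : X → X'}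
    (L₁ L₂ : SmoothLift O O' f) : Prop :=
  ∀ p, LocalLift.EquivAt p (L₁.lift p) (L₂.lift p)

/-! ## Compatible systems and good maps -/

/-- A compatible system over `f : (X, O) → (X', O')`: a compatible cover `𝒰` of `X`, an open subset
`U'` of `X'` for each `U ∈ 𝒰`, with uniformizing systems, local liftings `f_{UU'}`, and an
assignment `λ` of an injection on the side of `X'` to each injection on the side of `X`. -/
structure CompatSys (O : OrbStruct n X) (O' : OrbStruct n' X') (f : X → X') where
  /-- the compatible cover -/
  cover : Set (Set X)
  /-- the uniformizing system `(V, G, π)` of an element `U` of the cover -/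
  dom : cover → UnifSys n X
  dom_U : ∀ U : cover, (dom U).U = U
  dom_belongs : ∀ U, O.Belongs (dom U)
  sUnion_cover : ⋃₀ cover = univ
  dom_inj : ∀ U₂ U₁ : cover, (U₂ : Set X) ⊆ U₁ → Nonempty (Inj (dom U₂) (dom U₁))
  dom_inter : ∀ U₁ U₂ : cover, ∀ x ∈ (U₁ : Set X) ∩ U₂,
    ∃ U₃ : cover, x ∈ (U₃ : Set X) ∧ (U₃ : Set X) ⊆ (U₁ : Set X) ∩ U₂
  /-- the uniformizing system `(V', G', π')` of the open set `U'` corresponding to `U` -/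
  cod : cover → UnifSys n' X'
  cod_belongs : ∀ U, O'.Belongs (cod U)
  cod_inj : ∀ U₂ U₁ : cover, (cod U₂).U ⊆ (cod U₁).U → Nonempty (Inj (cod U₂) (cod U₁))
  cod_inter : ∀ U₁ U₂ : cover, ∀ x ∈ (cod U₁).U ∩ (cod U₂).U,
    ∃ U₃ : cover, x ∈ (cod U₃).U ∧ (cod U₃).U ⊆ (cod U₁).U ∩ (cod U₂).U
  cod_mono : ∀ U₂ U₁ : cover, (U₂ : Set X) ⊆ U₁ → (cod U₂).U ⊆ (cod U₁).U
  /-- the local lifting `f_{UU'}` -/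
  lift : ∀ U, LocalLift (dom U) (cod U) f
  /-- the assignment of injections -/
  lam : ∀ {U₂ U₁ : cover}, Inj (dom U₂) (dom U₁) → Inj (cod U₂) (cod U₁)
  lam_lift : ∀ {U₂ U₁ : cover} (i : Inj (dom U₂) (dom U₁)) (x : (dom U₂).V),
    lam i (lift U₂ x) = lift U₁ (i x)
  lam_comp : ∀ {U₃ U₂ U₁ : cover} (j : Inj (dom U₂) (dom U₁)) (i : Inj (dom U₃) (dom U₂)),
    lam (j.comp i) = (lam j).comp (lam i)

/-- The compatible system `ξ` is a compatible system of the `C^∞` map which `L` represents: its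
local liftings are in the germ of `L`. -/
def CompatSys.IsSystemOf {O : OrbStruct n X} {O' : OrbStruct n' X'} {f : X → X'}
    (ξ : CompatSys O O' f) (L : SmoothLift O O' f) : Prop :=
  ∀ U : ξ.cover, ∀ x ∈ (U : Set X), LocalLift.EquivAt x (ξ.lift U) (L.lift x)

/-- A `C^∞` map is good if it admits a compatible system. -/
def SmoothLift.IsGood {O : OrbStruct n X} {O' : OrbStruct n' X'} {f : X → X'}
    (L : SmoothLift O O' f) : Prop :=
  ∃ ξ : CompatSys O O' f, ξ.IsSystemOf L

/-- The group homomorphism of `ξ` at each point is a monomorphism. The local group at `π v` is the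
stabilizer of `v`, and an element `g` of it is mapped to the element of the group of `V'` by which
the automorphism assigned to `g` acts. (The groups on the side of `X'` act effectively in a reduced
orbifold.) -/
def CompatSys.Monomorphic {O : OrbStruct n X} {O' : OrbStruct n' X'} {f : X → X'}
    (ξ : CompatSys O O' f) : Prop :=
  ∀ (U : ξ.cover) (v : (ξ.dom U).V) (g : (ξ.dom U).G), g • v = v →
    (∀ y, ξ.lam ((ξ.dom U).aut g) y = y) → g = 1

end Maps

/-! ## Orbifold bundles, pull-backs, and isomorphism of compatible systems -/

/-- A smooth real vector bundle of rank `k` over a manifold `M`. -/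
structure SmoothVB (n k : ℕ) (M : Type) [TopologicalSpace M]
    [ChartedSpace (EuclideanSpace ℝ (Fin n)) M] where
  /-- the fibres -/
  Fib : M → Type
  [addFib : ∀ x, AddCommGroup (Fib x)]
  [moduleFib : ∀ x, Module ℝ (Fib x)]
  [topFib : ∀ x, TopologicalSpace (Fib x)]
  [topTotal : TopologicalSpace (Bundle.TotalSpace (EuclideanSpace ℝ (Fin k)) Fib)]
  [fiberBundle : FiberBundle (EuclideanSpace ℝ (Fin k)) Fib]
  [vectorBundle : VectorBundle ℝ (EuclideanSpace ℝ (Fin k)) Fib]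
  [smoothBundle : ContMDiffVectorBundle ∞ (EuclideanSpace ℝ (Fin k)) Fib (𝓡 n)]

attribute [instance] SmoothVB.addFib SmoothVB.moduleFib SmoothVB.topFib SmoothVB.topTotal
  SmoothVB.fiberBundle SmoothVB.vectorBundle SmoothVB.smoothBundle

/-- A rank `k` orbifold bundle over a (reduced) orbifold `(X, O)`, presented by transition maps: a
smooth vector bundle over `V` for each uniformizing system `(V, G, π)` of the orbifold, and for each
injection `i` an isomorphism `g_i(x)` of the fibre over `x` onto the fibre over `i x`, depending
smoothly on `x`, with `g_{j ∘ i}(x) = g_j(i x) ∘ g_i(x)`. In particular `G` acts on the bundle over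
`V`. -/
structure OrbBundle {n : ℕ} {X : Type*} [TopologicalSpace X] (O : OrbStruct n X) (k : ℕ) where
  /-- the bundle over a uniformizing system -/
  bun : ∀ S : UnifSys n X, O.Belongs S → SmoothVB n k S.V
  /-- the transition maps -/
  map : ∀ {S T : UnifSys n X} (hS : O.Belongs S) (hT : O.Belongs T) (i : Inj S T) (x : S.V),
    (bun S hS).Fib x ≃ₗ[ℝ] (bun T hT).Fib (i x)
  map_smooth : ∀ {S T : UnifSys n X} (hS : O.Belongs S) (hT : O.Belongs T) (i : Inj S T),
    ContMDiff ((𝓡 n).prod 𝓘(ℝ, EuclideanSpace ℝ (Fin k)))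
      ((𝓡 n).prod 𝓘(ℝ, EuclideanSpace ℝ (Fin k))) ∞
      (fun e : Bundle.TotalSpace (EuclideanSpace ℝ (Fin k)) (bun S hS).Fib =>
        (⟨i e.proj, map hS hT i e.proj e.snd⟩ :
          Bundle.TotalSpace (EuclideanSpace ℝ (Fin k)) (bun T hT).Fib))
  map_comp : ∀ {R S T : UnifSys n X} (hR : O.Belongs R) (hS : O.Belongs S) (hT : O.Belongs T)
    (j : Inj S T) (i : Inj R S) (x : R.V) (e : (bun R hR).Fib x),
    map hR hT (j.comp i) x e = map hS hT j (i x) (map hR hS i x e)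

section Isomorphism

variable {n n' : ℕ} {X X' : Type*} [TopologicalSpace X] [TopologicalSpace X']
  {O : OrbStruct n X} {O' : OrbStruct n' X'} {f : X → X'}

/-- Identification of the fibres over equal points. -/
def OrbBundle.castFib {k : ℕ} (E : OrbBundle O k) {S : UnifSys n X} (hS : O.Belongs S)
    {x y : S.V} (h : x = y) : (E.bun S hS).Fib x ≃ₗ[ℝ] (E.bun S hS).Fib y :=
  h ▸ LinearEquiv.refl ℝ ((E.bun S hS).Fib x)

/-- The fibre over `x ∈ V` of the pull-back bundle `E*_ξ`: on the uniformizing system of `U`, the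
pull-back bundle is the pull-back by `f_{UU'}` of the bundle over `V'`. -/
abbrev CompatSys.PullFib {k : ℕ} (ξ : CompatSys O O' f) (E : OrbBundle O' k) (U : ξ.cover)
    (x : (ξ.dom U).V) : Type :=
  (E.bun (ξ.cod U) (ξ.cod_belongs U)).Fib (ξ.lift U x)

/-- The transition maps `g_{λ(i)} ∘ f_{UU'}` of the pull-back bundle `E*_ξ`. -/
def CompatSys.pullMap {k : ℕ} (ξ : CompatSys O O' f) (E : OrbBundle O' k) {U₂ U₁ : ξ.cover}
    (i : Inj (ξ.dom U₂) (ξ.dom U₁)) (x : (ξ.dom U₂).V) :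
    ξ.PullFib E U₂ x ≃ₗ[ℝ] ξ.PullFib E U₁ (i x) :=
  (E.map (ξ.cod_belongs U₂) (ξ.cod_belongs U₁) (ξ.lam i) (ξ.lift U₂ x)).trans
    (E.castFib (ξ.cod_belongs U₁) (ξ.lam_lift i x))

/-- An isomorphism `ψ : E*₁ → E*₂` over `X` between the pull-back bundles of `E` by two compatible
systems of the same map such that `f̄₂ ∘ ψ = f̄₁` for the canonical maps `f̄ᵢ : E*ᵢ → E`.

The two bundles are given by transition maps over two different covers of `X`, so `ψ` is given on
their common refinements: the uniformizing systems `W` with injections `a₁`, `a₂` into elements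
`U₁`, `U₂` of the two covers. It has to commute with the restrictions along injections between such
`W` and with the transition maps of `E*₁` and of `E*₂`. The equation `f̄₂ ∘ ψ = f̄₁` is one between
`C^∞` maps of orbifolds, that is between germs of liftings up to isomorphism: near each point of
`W`, the liftings of `f̄₁` and of `f̄₂ ∘ ψ` become equal after restricting to some uniformizing
system `R` of `X'` that injects into the two targets. (So `ψ` is smooth, as the maps `g_b` of `E`
are.) -/
structure PullbackIso {k : ℕ} (E : OrbBundle O' k) (ξ₁ ξ₂ : CompatSys O O' f) where
  /-- the isomorphism on a common refinement -/
  ψ : ∀ (W : UnifSys n X) (U₁ : ξ₁.cover) (U₂ : ξ₂.cover) (a₁ : Inj W (ξ₁.dom U₁))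
    (a₂ : Inj W (ξ₂.dom U₂)) (y : W.V), ξ₁.PullFib E U₁ (a₁ y) ≃ₗ[ℝ] ξ₂.PullFib E U₂ (a₂ y)
  natural_restrict : ∀ (W' W : UnifSys n X) (b : Inj W' W) (U₁ : ξ₁.cover) (U₂ : ξ₂.cover)
    (a₁ : Inj W (ξ₁.dom U₁)) (a₂ : Inj W (ξ₂.dom U₂)) (y : W'.V)
    (e : ξ₁.PullFib E U₁ (a₁ (b y))),
    ψ W' U₁ U₂ (a₁.comp b) (a₂.comp b) y e = ψ W U₁ U₂ a₁ a₂ (b y) e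
  natural_left : ∀ (W : UnifSys n X) (U₁ T₁ : ξ₁.cover) (U₂ : ξ₂.cover) (a₁ : Inj W (ξ₁.dom U₁))
    (j : Inj (ξ₁.dom U₁) (ξ₁.dom T₁)) (a₂ : Inj W (ξ₂.dom U₂)) (y : W.V)
    (e : ξ₁.PullFib E U₁ (a₁ y)),
    ψ W T₁ U₂ (j.comp a₁) a₂ y (ξ₁.pullMap E j (a₁ y) e) = ψ W U₁ U₂ a₁ a₂ y e
  natural_right : ∀ (W : UnifSys n X) (U₁ : ξ₁.cover) (U₂ T₂ : ξ₂.cover) (a₁ : Inj W (ξ₁.dom U₁))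
    (a₂ : Inj W (ξ₂.dom U₂)) (j : Inj (ξ₂.dom U₂) (ξ₂.dom T₂)) (y : W.V)
    (e : ξ₁.PullFib E U₁ (a₁ y)),
    ψ W U₁ T₂ a₁ (j.comp a₂) y e = ξ₂.pullMap E j (a₂ y) (ψ W U₁ U₂ a₁ a₂ y e)
  over_base : ∀ (W : UnifSys n X) (U₁ : ξ₁.cover) (U₂ : ξ₂.cover) (a₁ : Inj W (ξ₁.dom U₁))
    (a₂ : Inj W (ξ₂.dom U₂)) (y₀ : W.V),
    ∃ (R : UnifSys n' X') (hR : O'.Belongs R) (b₁ : Inj R (ξ₁.cod U₁)) (b₂ : Inj R (ξ₂.cod U₂)),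
      ∀ᶠ y in 𝓝 y₀, ∃ (r : R.V) (h₁ : b₁ r = ξ₁.lift U₁ (a₁ y)) (h₂ : b₂ r = ξ₂.lift U₂ (a₂ y)),
        ∀ e : (E.bun R hR).Fib r,
          ψ W U₁ U₂ a₁ a₂ y
              (E.castFib (ξ₁.cod_belongs U₁) h₁ (E.map hR (ξ₁.cod_belongs U₁) b₁ r e)) =
            E.castFib (ξ₂.cod_belongs U₂) h₂ (E.map hR (ξ₂.cod_belongs U₂) b₂ r e)

/-- Two compatible systems are isomorphic if for every orbifold bundle `E` over `X'` there is an
isomorphism between the two pull-backs of `E` that commutes with their maps to `E`. -/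
def CompatSys.Iso (ξ₁ ξ₂ : CompatSys O O' f) : Prop :=
  ∀ (k : ℕ) (E : OrbBundle O' k), Nonempty (PullbackIso E ξ₁ ξ₂)

/-! ## The characteristic of a compatible system -/

/-- A point `v` of the uniformizing system of an element `U` of the cover, lying over the
complement of `z`. -/
structure CompatSys.RegPt (ξ : CompatSys O O' f) (z : Set X) where
  /-- the element of the cover -/
  U : ξ.cover
  /-- the point -/
  v : (ξ.dom U).V
  notMem : (ξ.dom U).π v ∉ z

/-- The image of a regular point in the complement of `z`. -/
def CompatSys.RegPt.pt {ξ : CompatSys O O' f} {z : Set X} (a : ξ.RegPt z) : {x : X // x ∉ z} :=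
  ⟨(ξ.dom a.U).π a.v, a.notMem⟩

/-- The image in the complement of `z` of a path in the manifold of a uniformizing system. -/
def UnifSys.projPath (S : UnifSys n X) {z : Set X} {v w : S.V} (σ : Path v w)
    (h : ∀ t, S.π (σ t) ∉ z) (hv : S.π v ∉ z) (hw : S.π w ∉ z) :
    Path (⟨S.π v, hv⟩ : {x : X // x ∉ z}) ⟨S.π w, hw⟩ where
  toFun t := ⟨S.π (σ t), h t⟩
  continuous_toFun := (S.continuous_π.comp σ.continuous).subtype_mk _
  source' := by simp
  target' := by simp

/-- Let every `U'` be included in an open set uniformized by `S = (V, G, π)`, through injections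
`c U`, so that an injection `i : U₂ → U₁` of the compatible system is assigned with the element
`τ(i)` of `G` with `c U₁ ∘ λ(i) = τ(i) ∘ c U₂`. Then `Transport a b γ g` says that `g` is the
product of the elements of `G` along the homotopy class `γ` of paths from `a` to `b` in the
complement of `z`: cover the path by elements `W₁, …, W_k` of the cover, move in `W_j` (`path`), and
pass from `W_j` to `W_{j+1}` by injections `a_j : D_j → W_j` (`symm` of `hop`) and
`b_j : D_j → W_{j+1}` (`hop`) from an element of the cover included in both, picking up the factor
`τ(b_j) τ(a_j)⁻¹`. -/
inductive CompatSys.Transport (ξ : CompatSys O O' f) (S : UnifSys n' X')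
    (c : ∀ U, Inj (ξ.cod U) S) (z : Set X) :
    (a b : ξ.RegPt z) → Path.Homotopic.Quotient a.pt b.pt → S.G → Prop
  | path (U : ξ.cover) {v w : (ξ.dom U).V} (σ : Path v w) (h : ∀ t, (ξ.dom U).π (σ t) ∉ z)
      (hv : (ξ.dom U).π v ∉ z) (hw : (ξ.dom U).π w ∉ z) :
      Transport ξ S c z ⟨U, v, hv⟩ ⟨U, w, hw⟩
        (Path.Homotopic.Quotient.mk ((ξ.dom U).projPath σ h hv hw)) 1
  | hop {U₂ U₁ : ξ.cover} (i : Inj (ξ.dom U₂) (ξ.dom U₁)) (v : (ξ.dom U₂).V)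
      (hv : (ξ.dom U₂).π v ∉ z) (hiv : (ξ.dom U₁).π (i v) ∉ z) (g : S.G)
      (hg : ∀ y, c U₁ (ξ.lam i y) = g • c U₂ y) :
      Transport ξ S c z ⟨U₂, v, hv⟩ ⟨U₁, i v, hiv⟩
        (Path.Homotopic.Quotient.mk
          ((Path.refl (⟨(ξ.dom U₂).π v, hv⟩ : {x : X // x ∉ z})).cast rfl
            (Subtype.ext (i.π_toFun v)))) g
  | symm {a b : ξ.RegPt z} {γ : Path.Homotopic.Quotient a.pt b.pt} {g : S.G} :
      Transport ξ S c z a b γ g → Transport ξ S c z b a γ.symm g⁻¹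
  | trans {a b d : ξ.RegPt z} {γ : Path.Homotopic.Quotient a.pt b.pt}
      {δ : Path.Homotopic.Quotient b.pt d.pt} {g h : S.G} :
      Transport ξ S c z a b γ g → Transport ξ S c z b d δ h →
        Transport ξ S c z a d (γ.trans δ) (h * g)

/-- Conjugacy of group homomorphisms. -/
def conjHomSetoid (P G : Type*) [Group P] [Group G] : Setoid (P →* G) where
  r θ θ' := ∃ g : G, ∀ γ, θ' γ = g * θ γ * g⁻¹
  iseqv :=
    { refl := fun θ => ⟨1, fun γ => by simp⟩
      symm := by
        rintro θ θ' ⟨g, hg⟩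
        exact ⟨g⁻¹, fun γ => by rw [hg]; group⟩
      trans := by
        rintro θ θ' θ'' ⟨g, hg⟩ ⟨h, hh⟩
        exact ⟨h * g, fun γ => by rw [hh, hg]; group⟩ }

/-- Conjugacy classes of group homomorphisms. -/
abbrev ConjHom (P G : Type*) [Group P] [Group G] := Quotient (conjHomSetoid P G)

/-- The conjugacy class `Θ` of homomorphisms from the fundamental group of the complement of `z` to
the group `G` of `S = (V, G, π)` is the characteristic of (the isomorphism class of) `ξ`: some
compatible system isomorphic to `ξ`, all of whose sets `U'` are included in the open set uniformized
by `S`, has a representative of `Θ` as its products of elements of `G` along loops. (The product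
`γ * γ'` of `FundamentalGroup` is the loop `γ'` followed by the loop `γ`.) -/
def CompatSys.HasCharacteristic (ξ : CompatSys O O' f) (S : UnifSys n' X') (z : Set X)
    (z₀ : {x : X // x ∉ z}) (Θ : ConjHom (FundamentalGroup {x : X // x ∉ z} z₀) S.G) : Prop :=
  ∃ ξ' : CompatSys O O' f, ξ.Iso ξ' ∧ ∃ (c : ∀ U, Inj (ξ'.cod U) S) (b : ξ'.RegPt z)
    (hb : b.pt = z₀) (θ : FundamentalGroup {x : X // x ∉ z} z₀ →* S.G),
    Quotient.mk _ θ = Θ ∧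
      ∀ γ : Path.Homotopic.Quotient z₀ z₀,
        ξ'.Transport S c z b b (γ.cast hb hb) (θ (FundamentalGroup.fromPath γ))

end Isomorphism

/-! ## Orbicurves -/

section Orbicurves

variable {C : Type*} [TopologicalSpace C] [ChartedSpace ℂ C]

/-- `S = (V, G, π)` uniformizes a disc neighbourhood of `x` in the Riemann surface `C` by the
branched covering map `w ↦ w ^ m`: `V` is a disc of radius `r` with coordinate `e`, the group `G` is
the group of `m`-th roots of unity acting by multiplication, and `π` is `w ↦ w ^ m` in a holomorphic
coordinate `c` of `C` centred at `x`. -/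
def IsBranchedChart (S : UnifSys 2 C) (x : C) (m : ℕ) : Prop :=
  ∃ c ∈ IsManifold.maximalAtlas 𝓘(ℂ) ω C, x ∈ c.source ∧ c x = 0 ∧ S.U ⊆ c.source ∧
    ∃ (r : ℝ) (e : S.V → ℂ) (χ : S.G →* ℂˣ), 0 < r ∧
      Function.Injective e ∧ IsLocalDiffeomorph (𝓡 2) 𝓘(ℝ, ℂ) ∞ e ∧ range e = Metric.ball 0 r ∧
      Function.Injective χ ∧ Nat.card S.G = m ∧
      (∀ (g : S.G) (v : S.V), e (g • v) = (χ g : ℂ) * e v) ∧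
      ∀ v : S.V, c (S.π v) = e v ^ m

/-- `O` is the orbifold structure of an orbicurve `(C, z, m)`, in which the multiplicity `m_i` of a
point `z_i` of `z` may be `1`: each point `x` of `C` has a disc neighbourhood uniformized by
`w ↦ w ^ m(x)`, where `m(x) ≥ 1`, and `m(x) = 1` for `x` outside of `z`. -/
def IsOrbicurve (z : Set C) (O : OrbStruct 2 C) : Prop :=
  ∃ m : C → ℕ, (∀ x, 1 ≤ m x) ∧ (∀ x ∉ z, m x = 1) ∧
    ∀ x, ∃ S : UnifSys 2 C, IsBranchedChart S x (m x) ∧ UnifSys.EquivAt x S (O.chart x)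

end Orbicurves

/-!
# Good structures on a constant map from an orbicurve

A compatible system of the constant map `p` is a flat `S.G`-bundle in disguise. Since the lifting of
the map takes the value `x₀`, which `S.G` fixes, the liftings carry no information, and the
assignment of injections is a cocycle with values in the local group `S.G` of `p`. Its transport
along paths outside the marked points is a flat connection whose holonomy is the characteristic.

*The invariant is well defined and complete.* The transport depends only on the homotopy class
(`CompatSys.Transport.unique`), since it is the monodromy of a covering space of the complement of
the marked points, glued by local transports (`CompatSys.transportCore`). An isomorphism of
compatible systems is recovered from its effect on one orbifold bundle, the tangent bundle of the
target (`OrbBundle.tangent`): as the groups act effectively, an isomorphism of the pull-backs over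
the identity of the target comes from locally constant elements of `S.G` which intertwine the two
cocycles (`CompatSys.Iso.comparison`), and conversely such elements act on the pull-backs of every
bundle (`CompatSys.Comparison.iso`). So isomorphic systems have conjugate holonomies
(`CompatSys.Comparison.exists_conj`). A *framing* of a system by a holonomy `H` is a section in
which the transport becomes `H`; two systems framed by the same `H` are isomorphic
(`CompatSys.IsFraming.iso`), because the surface of any uniformizing system remains connected
without the finitely many points over `z`.

*Existence.* A uniformizing system is *adapted* to `H` if, over the complement of `z`, it is the
covering belonging to the kernel of `H`. Around a marked point this is the disc with
`w ↦ w ^ m`, where `m` is the order of the holonomy around the point (`exists_isAdapted_disc`,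
through the half plane that covers the punctured disc by the exponential). These discs, with small
unbranched discs elsewhere, form an adapted cover (`AdaptedCover.exists_isOrbicurve`). On an adapted
cover the holonomy is trivial upstairs, and the differences of the trivializations along injections
define a framed monomorphic system (`AdaptedCover.compatSys`).

*Uniqueness of the orbicurve.* For a framed monomorphic system over any orbicurve, the local group
at each point is adapted to `H` (`IsOrbicurve.exists_adapted_center`), hence its order is determined
by `H` (`UnifSys.IsAdapted.card_le`); and branched charts of equal order are equivalent
(`IsBranchedChart.equivAt`). Smoothness of the constant map needs no further data: all its local
liftings are constant, so any two are equivalent (`SmoothLift.equiv_of_const`).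
-/

/-! ### Derivatives and local diffeomorphisms of manifolds modelled on `ℝⁿ` -/

section Manifolds

variable {n : ℕ} {M N P : Type*} [TopologicalSpace M] [ChartedSpace (EuclideanSpace ℝ (Fin n)) M]
  [TopologicalSpace N] [ChartedSpace (EuclideanSpace ℝ (Fin n)) N]
  [TopologicalSpace P] [ChartedSpace (EuclideanSpace ℝ (Fin n)) P]

/-- The derivative of a map of manifolds, read in the model space: unlike `mfderiv`, its type does
not depend on the base point, so that the derivatives of different maps can be compared. -/
noncomputable def modelDeriv (n : ℕ) {M N : Type*} [TopologicalSpace M]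
    [ChartedSpace (EuclideanSpace ℝ (Fin n)) M] [TopologicalSpace N]
    [ChartedSpace (EuclideanSpace ℝ (Fin n)) N] (f : M → N) (x : M) :
    EuclideanSpace ℝ (Fin n) →L[ℝ] EuclideanSpace ℝ (Fin n) :=
  mfderiv (𝓡 n) (𝓡 n) f x

theorem modelDeriv_comp {g : N → P} {f : M → N} {x : M}
    (hg : MDifferentiableAt (𝓡 n) (𝓡 n) g (f x)) (hf : MDifferentiableAt (𝓡 n) (𝓡 n) f x) :
    modelDeriv n (g ∘ f) x = (modelDeriv n g (f x)).comp (modelDeriv n f x) :=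
  mfderiv_comp x hg hf

theorem modelDeriv_id (x : M) : modelDeriv n (id : M → M) x = ContinuousLinearMap.id ℝ _ :=
  mfderiv_id

theorem modelDeriv_congr {f g : M → N} {x : M} (h : f =ᶠ[𝓝 x] g) :
    modelDeriv n f x = modelDeriv n g x := by
  have := h.mfderiv_eq (I := 𝓡 n) (I' := 𝓡 n)
  exact this

theorem modelDeriv_bijective {f : M → N} {x : M} (hf : IsLocalDiffeomorphAt (𝓡 n) (𝓡 n) ∞ f x) :
    Function.Bijective (modelDeriv n f x) :=
  (hf.mfderivToContinuousLinearEquiv (by simp)).bijective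

/-- Two smooth maps which agree at `x` and on an open set adherent to `x` have the same
derivative at `x`. -/
theorem modelDeriv_eq_of_mem_closure [IsManifold (𝓡 n) ∞ M] [IsManifold (𝓡 n) ∞ N]
    {f g : M → N} (hf : ContMDiff (𝓡 n) (𝓡 n) ∞ f)
    (hg : ContMDiff (𝓡 n) (𝓡 n) ∞ g) {x : M} (hx : f x = g x)
    (hcl : x ∈ closure (interior {y | f y = g y})) : modelDeriv n f x = modelDeriv n g x := by
  have key : ∀ {k : M → N}, ContMDiff (𝓡 n) (𝓡 n) ∞ k → k x = f x →
      modelDeriv n k x = fderiv ℝ (extChartAt (𝓡 n) (f x) ∘ k ∘ (extChartAt (𝓡 n) x).symm)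
        (extChartAt (𝓡 n) x x) ∧
      ContinuousAt (fderiv ℝ (extChartAt (𝓡 n) (f x) ∘ k ∘ (extChartAt (𝓡 n) x).symm))
        (extChartAt (𝓡 n) x x) := by
    intro k hk hkx
    constructor
    · have h0 : modelDeriv n k x = fderivWithin ℝ (writtenInExtChartAt (𝓡 n) (𝓡 n) x k)
          (range (𝓡 n)) (extChartAt (𝓡 n) x x) := (hk.mdifferentiable (by simp) x).mfderiv
      rw [h0, writtenInExtChartAt, hkx, modelWithCornersSelf_coe, range_id, fderivWithin_univ]
    · have := (contMDiffAt_iff.1 (hk x)).2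
      rw [hkx] at this
      simp only [modelWithCornersSelf_coe, range_id, contDiffWithinAt_univ] at this
      exact this.continuousAt_fderiv (by simp)
  obtain ⟨h1, c1⟩ := key hf rfl
  obtain ⟨h2, c2⟩ := key hg hx.symm
  rw [h1, h2]
  refine tendsto_nhds_unique_of_frequently_eq c1 c2 ?_
  have hfr : ∃ᶠ y in 𝓝 x, y ∈ interior {y | f y = g y} := mem_closure_iff_frequently.1 hcl
  have hev : ∀ᶠ y in 𝓝 x, y ∈ (extChartAt (𝓡 n) x).source := extChartAt_source_mem_nhds x
  have hfr2 : ∃ᶠ y in 𝓝 x, fderiv ℝ (extChartAt (𝓡 n) (f x) ∘ f ∘ (extChartAt (𝓡 n) x).symm)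
        (extChartAt (𝓡 n) x y) =
      fderiv ℝ (extChartAt (𝓡 n) (f x) ∘ g ∘ (extChartAt (𝓡 n) x).symm)
        (extChartAt (𝓡 n) x y) := by
    refine (hfr.and_eventually hev).mono ?_
    rintro y ⟨hy, hys⟩
    apply Filter.EventuallyEq.fderiv_eq
    have hcont : ContinuousAt (extChartAt (𝓡 n) x).symm (extChartAt (𝓡 n) x y) :=
      continuousAt_extChartAt_symm' hys
    have : ∀ᶠ u in 𝓝 (extChartAt (𝓡 n) x y),
        (extChartAt (𝓡 n) x).symm u ∈ interior {y | f y = g y} := by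
      apply hcont.eventually_mem
      rw [(extChartAt (𝓡 n) x).left_inv hys]
      exact isOpen_interior.mem_nhds hy
    filter_upwards [this] with u hu
    have hu' : (extChartAt (𝓡 n) x).symm u ∈ {y | f y = g y} := interior_subset hu
    exact congrArg (extChartAt (𝓡 n) (f x)) hu'
  have hcont : Filter.Tendsto (extChartAt (𝓡 n) x) (𝓝 x) (𝓝 (extChartAt (𝓡 n) x x)) :=
    continuousAt_extChartAt x
  exact hcont.frequently hfr2

end Manifolds

section LocalDiffeo

variable {E F G : Type*} [NormedAddCommGroup E] [NormedSpace ℝ E]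
  [NormedAddCommGroup F] [NormedSpace ℝ F] [NormedAddCommGroup G] [NormedSpace ℝ G]
  {M N P : Type*} [TopologicalSpace M] [ChartedSpace E M]
  [TopologicalSpace N] [ChartedSpace F N]
  [TopologicalSpace P] [ChartedSpace G P]

theorem IsLocalDiffeomorphAt.congr_eventuallyEq {f g : M → N} {x : M}
    (hf : IsLocalDiffeomorphAt 𝓘(ℝ, E) 𝓘(ℝ, F) ∞ f x) (h : f =ᶠ[𝓝 x] g) :
    IsLocalDiffeomorphAt 𝓘(ℝ, E) 𝓘(ℝ, F) ∞ g x := by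
  obtain ⟨Φ, hx, hΦ⟩ := hf
  obtain ⟨s, hs, hso, hxs⟩ := eventually_nhds_iff.1 h
  refine ⟨{ toPartialEquiv := (Φ.toOpenPartialHomeomorph.restrOpen s hso).toPartialEquiv
            open_source := (Φ.toOpenPartialHomeomorph.restrOpen s hso).open_source
            open_target := (Φ.toOpenPartialHomeomorph.restrOpen s hso).open_target
            contMDiffOn_toFun := Φ.contMDiffOn_toFun.mono fun y hy => hy.1
            contMDiffOn_invFun := Φ.contMDiffOn_invFun.mono fun y hy => hy.1 }, ⟨hx, hxs⟩, ?_⟩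
  rintro y ⟨hy, hys⟩
  rw [← hs y hys]
  exact hΦ hy

theorem isLocalDiffeomorphAt_of_comp {f : M → N} {g : N → P} {x : M}
    (hg : IsLocalDiffeomorphAt 𝓘(ℝ, F) 𝓘(ℝ, G) ∞ g (f x)) (hf : ContinuousAt f x)
    (h : IsLocalDiffeomorphAt 𝓘(ℝ, E) 𝓘(ℝ, G) ∞ (g ∘ f) x) :
    IsLocalDiffeomorphAt 𝓘(ℝ, E) 𝓘(ℝ, F) ∞ f x := by
  have h1 : IsLocalDiffeomorphAt 𝓘(ℝ, E) 𝓘(ℝ, F) ∞ (hg.localInverse ∘ (g ∘ f)) x :=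
    h.comp (K := 𝓘(ℝ, F)) (P := N) hg.localInverse_isLocalDiffeomorphAt
  refine h1.congr_eventuallyEq ?_
  filter_upwards [hf.eventually hg.localInverse_eventuallyEq_left] with y hy
  exact hy

theorem isLocalDiffeomorph_subtype_val (W : TopologicalSpace.Opens M) :
    IsLocalDiffeomorph 𝓘(ℝ, E) 𝓘(ℝ, E) ∞ (Subtype.val : W → M) := by
  intro x
  have : Nonempty W := ⟨x⟩
  refine ⟨{ toPartialEquiv := (W.openPartialHomeomorphSubtypeCoe ⟨x⟩).toPartialEquiv
            open_source := (W.openPartialHomeomorphSubtypeCoe ⟨x⟩).open_source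
            open_target := (W.openPartialHomeomorphSubtypeCoe ⟨x⟩).open_target
            contMDiffOn_toFun := contMDiff_subtype_val.contMDiffOn
            contMDiffOn_invFun := ?_ }, by simp, fun y _ => rfl⟩
  intro y hy
  have hy' : y ∈ W := by simpa using hy
  refine ContMDiffAt.contMDiffWithinAt ?_
  refine (contMDiffAt_subtype_iff (x := (⟨y, hy'⟩ : W))).1 ?_
  refine (contMDiffAt_id (x := (⟨y, hy'⟩ : W))).congr_of_eventuallyEq ?_
  refine Filter.Eventually.of_forall fun u => ?_
  exact (W.openPartialHomeomorphSubtypeCoe ⟨x⟩).left_inv (by simp)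

theorem Function.Injective.continuous_of_comp_isOpenMap {A B D : Type*} [TopologicalSpace A]
    [TopologicalSpace B] [TopologicalSpace D] {f : A → B} {g : B → D} (hg : Function.Injective g)
    (hgo : IsOpenMap g) (h : Continuous (g ∘ f)) : Continuous f := by
  refine ⟨fun s hs => ?_⟩
  have := (hgo s hs).preimage h
  rwa [preimage_comp, preimage_image_eq _ hg] at this

end LocalDiffeo

/-! ### Effective uniformizing systems -/

namespace UnifSys

variable {n : ℕ} {X : Type*} [TopologicalSpace X] {R S T : UnifSys n X}

/-- The group of the uniformizing system acts effectively. -/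
def Effective (S : UnifSys n X) : Prop := ∀ g : S.G, (∀ x : S.V, g • x = x) → g = 1

theorem continuous_smul (S : UnifSys n X) (g : S.G) : Continuous (fun x : S.V => g • x) :=
  (S.smooth_smul g).continuous

theorem isLocalDiffeomorph_smul (S : UnifSys n X) (g : S.G) :
    IsLocalDiffeomorph (𝓡 n) (𝓡 n) ∞ (fun x : S.V => g • x) := (S.aut g).localDiffeo

theorem π_smul (S : UnifSys n X) (g : S.G) (x : S.V) : S.π (g • x) = S.π x :=
  (S.aut g).π_toFun x

theorem isOpen_U (S : UnifSys n X) : IsOpen S.U := S.isOpenMap_π.isOpen_range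

theorem π_mem (S : UnifSys n X) (x : S.V) : S.π x ∈ S.U := mem_range_self x

theorem mdifferentiableAt_smul (S : UnifSys n X) (g : S.G) (x : S.V) :
    MDifferentiableAt (𝓡 n) (𝓡 n) (fun x : S.V => g • x) x :=
  (S.smooth_smul g).mdifferentiable (by simp) x

/-- An element of the group with a fixed point at which its derivative is the identity is trivial:
otherwise the rank of `d g - 1` would be at least two. -/
theorem Effective.eq_one_of_modelDeriv (hS : S.Effective) {g : S.G} {x : S.V} (hx : g • x = x)
    (hd : modelDeriv n (fun y : S.V => g • y) x = ContinuousLinearMap.id ℝ _) : g = 1 := by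
  rcases S.codim_two g with h | h
  · exact hS g h
  · have h2 := h x hx
    have : selfDeriv (n := n) (fun y : S.V => g • y) x = ContinuousLinearMap.id ℝ _ := hd
    rw [this, sub_self] at h2
    have h0 : (0 : EuclideanSpace ℝ (Fin n) →L[ℝ] EuclideanSpace ℝ (Fin n)).toLinearMap = 0 := rfl
    rw [h0, LinearMap.range_zero, finrank_bot] at h2
    omega

theorem Effective.eq_of_modelDeriv (hS : S.Effective) {g h : S.G} {x : S.V} (hx : g • x = h • x)
    (hd : modelDeriv n (fun y : S.V => g • y) x = modelDeriv n (fun y : S.V => h • y) x) :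
    g = h := by
  have h1 : g⁻¹ * h = 1 := by
    apply hS.eq_one_of_modelDeriv (x := x)
    · rw [mul_smul, ← hx, inv_smul_smul]
    · have e1 : (fun y : S.V => (g⁻¹ * h) • y) = (fun y : S.V => g⁻¹ • y) ∘ fun y => h • y := by
        funext y; simp [mul_smul]
      have e2 : (id : S.V → S.V) = (fun y : S.V => g⁻¹ • y) ∘ fun y => g • y := by
        funext y; simp
      rw [e1, modelDeriv_comp (S.mdifferentiableAt_smul _ _) (S.mdifferentiableAt_smul _ _), ← hd,
        ← hx, ← modelDeriv_comp (S.mdifferentiableAt_smul _ _) (S.mdifferentiableAt_smul _ _), ← e2,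
        modelDeriv_id]
  exact (inv_mul_eq_one.1 h1)

theorem Effective.eq_of_eventuallyEq (hS : S.Effective) {g h : S.G} {x : S.V}
    (hx : ∀ᶠ y in 𝓝 x, g • y = h • y) : g = h :=
  hS.eq_of_modelDeriv hx.self_of_nhds (modelDeriv_congr hx)

theorem Effective.eq_of_isOpen (hS : S.Effective) {g h : S.G} {s : Set S.V} (hs : IsOpen s)
    (hne : s.Nonempty) (hx : ∀ y ∈ s, g • y = h • y) : g = h := by
  obtain ⟨x, hxs⟩ := hne
  exact hS.eq_of_eventuallyEq (Filter.eventually_of_mem (hs.mem_nhds hxs) hx)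

/-- Two local diffeomorphisms between the same uniformizing systems over the same base differ by an
element of the group. The sets on which they differ by a given element are closed and cover the
source; rigidity shows that their interiors are closed as well. -/
theorem Effective.exists_smul_eq (hT : T.Effective) {f₁ f₂ : S.V → T.V}
    (h₁ : IsLocalDiffeomorph (𝓡 n) (𝓡 n) ∞ f₁) (h₂ : IsLocalDiffeomorph (𝓡 n) (𝓡 n) ∞ f₂)
    (hπ : ∀ x, T.π (f₁ x) = T.π (f₂ x)) : ∃ g : T.G, ∀ x, f₂ x = g • f₁ x := by
  have hsm : ∀ g : T.G, ContMDiff (𝓡 n) (𝓡 n) ∞ (fun x => g • f₁ x) := fun g =>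
    (T.smooth_smul g).comp h₁.contMDiff
  let A : T.G → Set S.V := fun g => {x | f₂ x = g • f₁ x}
  have hA : ∀ g, IsClosed (A g) := fun g =>
    isClosed_eq h₂.contMDiff.continuous (hsm g).continuous
  have hcov : ⋃ g, A g = univ := by
    refine eq_univ_of_forall fun x => ?_
    obtain ⟨g, hg⟩ := (T.π_eq_iff _ _).1 (hπ x)
    exact mem_iUnion.2 ⟨g, hg.symm⟩
  have : LocallyCompactSpace S.V :=
    ChartedSpace.locallyCompactSpace (EuclideanSpace ℝ (Fin n)) S.V
  have hdense : Dense (⋃ g, interior (A g)) := dense_iUnion_interior_of_closed hA hcov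
  have hcl : ∀ g h : T.G, ∀ x ∈ closure (interior (A g)), x ∈ closure (interior (A h)) →
      g = h := by
    intro g h x hg hh
    have hgx : f₂ x = g • f₁ x := closure_minimal interior_subset (hA g) hg
    have hhx : f₂ x = h • f₁ x := closure_minimal interior_subset (hA h) hh
    have d1 := modelDeriv_eq_of_mem_closure h₂.contMDiff (hsm g) hgx hg
    have d2 := modelDeriv_eq_of_mem_closure h₂.contMDiff (hsm h) hhx hh
    have hc : ∀ k : T.G, modelDeriv n (fun x => k • f₁ x) x =
        (modelDeriv n (fun y : T.V => k • y) (f₁ x)).comp (modelDeriv n f₁ x) := fun k =>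
      modelDeriv_comp (g := fun y : T.V => k • y) (T.mdifferentiableAt_smul k _)
        (h₁.mdifferentiable (by simp) x)
    refine hT.eq_of_modelDeriv (hgx.symm.trans hhx) ?_
    have h3 := d1.symm.trans d2
    rw [hc, hc] at h3
    refine ContinuousLinearMap.ext fun v => ?_
    obtain ⟨w, rfl⟩ := (modelDeriv_bijective (h₁ x)).2 v
    exact DFunLike.congr_fun h3 w
  have hopen : ∀ g, closure (interior (A g)) ⊆ interior (A g) := by
    intro g x hx
    have hN : (⋃ h ∈ {h : T.G | h ≠ g}, closure (interior (A h)))ᶜ ∈ 𝓝 x := by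
      apply IsOpen.mem_nhds
      · exact ((toFinite _).isClosed_biUnion fun h _ => isClosed_closure).isOpen_compl
      · simp only [mem_compl_iff, mem_iUnion, not_exists]
        intro h hne hxh
        exact hne (hcl h g x hxh hx)
    rw [mem_interior_iff_mem_nhds]
    filter_upwards [hN] with y hy
    have hy2 : y ∈ closure (⋃ h, interior (A h)) := hdense y
    rw [closure_iUnion_of_finite] at hy2
    obtain ⟨h, hh⟩ := mem_iUnion.1 hy2
    have : h = g := by
      by_contra hne
      exact hy (mem_iUnion₂.2 ⟨h, hne, hh⟩)
    subst this
    exact closure_minimal interior_subset (hA h) hh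
  obtain ⟨x⟩ : Nonempty S.V := inferInstance
  obtain ⟨y, -, hy⟩ := hdense.inter_open_nonempty univ isOpen_univ ⟨x, trivial⟩
  obtain ⟨g, hg⟩ := mem_iUnion.1 hy
  have hclopen : IsClopen (interior (A g)) :=
    ⟨isClosed_of_closure_subset (hopen g), isOpen_interior⟩
  have huniv := hclopen.eq_univ ⟨y, hg⟩
  refine ⟨g, fun x => ?_⟩
  have hx : x ∈ A g := interior_subset (huniv ▸ mem_univ x)
  exact hx

theorem Effective.smul_comp_injective (hT : T.Effective) {f : S.V → T.V}
    (hf : IsLocalDiffeomorph (𝓡 n) (𝓡 n) ∞ f) {g h : T.G} (hgh : ∀ x, g • f x = h • f x) :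
    g = h := by
  obtain ⟨x⟩ : Nonempty S.V := inferInstance
  refine hT.eq_of_isOpen hf.isOpen_range ⟨f x, mem_range_self x⟩ ?_
  rintro _ ⟨y, rfl⟩
  exact hgh y

/-- An injective local diffeomorphism over the base, between effective uniformizing systems, is an
injection: the group homomorphism is determined by the map. -/
noncomputable def Inj.ofMap (hS : S.Effective) (hT : T.Effective) (f : S.V → T.V)
    (hinj : Function.Injective f) (hf : IsLocalDiffeomorph (𝓡 n) (𝓡 n) ∞ f)
    (hπ : ∀ x, T.π (f x) = S.π x) : Inj S T := by
  have hex : ∀ g : S.G, ∃ h : T.G, ∀ x, f (g • x) = h • f x := fun g =>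
    hT.exists_smul_eq hf
      (fun x => (S.isLocalDiffeomorph_smul g x).comp (𝓡 n) T.V (hf (g • x)))
      (fun x => by simp only [hπ, S.π_smul])
  choose φ hφ using hex
  exact
  { toFun := f
    hom :=
      { toFun := φ
        map_one' := hT.smul_comp_injective hf fun x => by rw [← hφ, one_smul, one_smul]
        map_mul' := fun g h => hT.smul_comp_injective hf fun x => by
          rw [← hφ, mul_smul, mul_smul, hφ, hφ] }
    injective := hinj
    localDiffeo := hf
    hom_injective := by
      refine (injective_iff_map_eq_one _).2 fun g (hg : φ g = 1) => hS g fun x => hinj ?_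
      rw [hφ, hg, one_smul]
    equivariant := hφ
    map_ker := fun g hg y => by
      rw [hS g hg, map_one, one_smul]
    ker_surj := fun h hh => ⟨1, fun x => one_smul _ x, by rw [map_one, hT h hh]⟩
    π_toFun := hπ }

theorem Inj.effective_source (i : Inj S T) (hT : T.Effective) : S.Effective := fun g hg =>
  i.hom_injective ((hT _ (i.map_ker g hg)).trans (map_one i.hom).symm)

theorem Inj.effective_target (i : Inj S T) (hS : S.Effective) : T.Effective := fun h hh => by
  obtain ⟨g, hg, rfl⟩ := i.ker_surj h hh
  rw [hS g hg, map_one]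

theorem Inj.ext_of_effective (hT : T.Effective) {i j : Inj S T} (h : ∀ x, i x = j x) : i = j := by
  have h1 : i.toFun = j.toFun := funext h
  have h2 : i.hom = j.hom := by
    ext g
    refine hT.smul_comp_injective i.localDiffeo fun x => ?_
    rw [← i.equivariant, h, h x, j.equivariant]
  cases i; cases j
  cases h1; cases h2
  rfl

/-- The identity injection. -/
def Inj.refl (S : UnifSys n X) : Inj S S where
  toFun := id
  hom := MonoidHom.id _
  injective := Function.injective_id
  localDiffeo := (Diffeomorph.refl (𝓡 n) S.V ∞).isLocalDiffeomorph
  hom_injective := Function.injective_id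
  equivariant := fun _ _ => rfl
  map_ker := fun _ hg => hg
  ker_surj := fun h hh => ⟨h, hh, rfl⟩
  π_toFun := fun _ => rfl

theorem Inj.exists_aut_comp (hT : T.Effective) (i j : Inj S T) :
    ∃ g : T.G, j = (T.aut g).comp i := by
  obtain ⟨g, hg⟩ := hT.exists_smul_eq i.localDiffeo j.localDiffeo
    fun x => (i.π_toFun x).trans (j.π_toFun x).symm
  exact ⟨g, Inj.ext_of_effective hT hg⟩

theorem Inj.comp_apply (j : Inj S T) (i : Inj R S) (x : R.V) : (j.comp i) x = j (i x) := rfl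

theorem Inj.continuous (i : Inj S T) : Continuous i.toFun := i.localDiffeo.contMDiff.continuous

theorem Inj.isOpenMap (i : Inj S T) : IsOpenMap i.toFun := i.localDiffeo.isOpenMap

theorem Inj.U_subset (i : Inj S T) : S.U ⊆ T.U := by
  rintro _ ⟨x, rfl⟩
  exact ⟨i x, i.π_toFun x⟩

theorem aut_apply (S : UnifSys n X) (g : S.G) (x : S.V) : (S.aut g) x = g • x := rfl

theorem Inj.comp_aut (j : Inj S T) (g : S.G) (hT : T.Effective) :
    j.comp (S.aut g) = (T.aut (j.hom g)).comp j :=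
  Inj.ext_of_effective hT fun x => j.equivariant g x

/-! ### Restriction of uniformizing systems -/

section Restrict

variable (S) (W : TopologicalSpace.Opens S.V) (H : Subgroup S.G)
  (hW : ∀ g ∈ H, ∀ x ∈ W, g • x ∈ W)

/-- The action of a subgroup on an invariant open set. -/
@[reducible]
def restrictAction : MulAction H W where
  smul g x := ⟨(g : S.G) • (x : S.V), hW g g.2 x x.2⟩
  one_smul x := Subtype.ext (one_smul S.G (x : S.V))
  mul_smul g h x := Subtype.ext (mul_smul (g : S.G) (h : S.G) (x : S.V))

/-- The uniformizing system induced on a connected open subset `W` of `V` by a subgroup `H` of `G`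
which preserves `W` and whose orbits in `W` are the traces of those of `G`. -/
noncomputable def restrict (hconn : IsConnected (W : Set S.V))
    (horb : ∀ x ∈ W, ∀ g : S.G, g • x ∈ W → ∃ h ∈ H, h • x = g • x) : UnifSys n X :=
  letI := S.restrictAction W H hW
  have hsm : ∀ g : H, ContMDiff (𝓡 n) (𝓡 n) ∞ (fun x : W => g • x) := fun g x =>
    (ContMDiffAt.subtypeVal_comp_iff W (fun x : W => g • x) x).1
      (((S.smooth_smul (g : S.G)).comp contMDiff_subtype_val) x)
  { V := W
    G := H
    connectedV := isConnected_iff_connectedSpace.1 hconn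
    smooth_smul := hsm
    codim_two := fun g => by
      rcases S.codim_two (g : S.G) with h | h
      · exact Or.inl fun x => Subtype.ext (h x)
      · refine Or.inr fun x hx => ?_
        have hx' : (g : S.G) • (x : S.V) = x := congrArg Subtype.val hx
        have h2 := h x hx'
        have hval := isLocalDiffeomorph_subtype_val (E := EuclideanSpace ℝ (Fin n)) W
        set L := modelDeriv n (Subtype.val : W → S.V) x with hL
        have hbij : Function.Bijective L := modelDeriv_bijective (hval x)
        have e1 : L.comp (modelDeriv n (fun y : W => g • y) x) =
            (modelDeriv n (fun y : S.V => (g : S.G) • y) x).comp L := by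
          have a1 := modelDeriv_comp (n := n) (g := (Subtype.val : W → S.V))
            (f := fun y : W => g • y) (x := x) (hval.mdifferentiable (by simp) _)
            ((hsm g).mdifferentiable (by simp) x)
          have a2 := modelDeriv_comp (n := n) (g := fun y : S.V => (g : S.G) • y)
            (f := (Subtype.val : W → S.V)) (x := x)
            (S.mdifferentiableAt_smul _ _) (hval.mdifferentiable (by simp) x)
          have a3 : (Subtype.val : W → S.V) ∘ (fun y : W => g • y) =
            (fun y : S.V => (g : S.G) • y) ∘ (Subtype.val : W → S.V) := rfl
          rw [hx] at a1
          rw [hL, ← a1, a3, a2]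
        have e2 : ∀ v, L ((modelDeriv n (fun y : W => g • y) x -
            ContinuousLinearMap.id ℝ (EuclideanSpace ℝ (Fin n))) v) =
            (modelDeriv n (fun y : S.V => (g : S.G) • y) x -
              ContinuousLinearMap.id ℝ (EuclideanSpace ℝ (Fin n))) (L v) := by
          intro v
          have := DFunLike.congr_fun e1 v
          simp only [ContinuousLinearMap.comp_apply] at this
          simp [map_sub, this]
        refine h2.trans (le_of_eq ?_)
        let Le := LinearEquiv.ofBijective L.toLinearMap hbij
        have e3 : LinearMap.range (modelDeriv n (fun y : S.V => (g : S.G) • y) (x : S.V) -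
            ContinuousLinearMap.id ℝ (EuclideanSpace ℝ (Fin n))).toLinearMap =
            Submodule.map Le.toLinearMap (LinearMap.range (modelDeriv n (fun y : W => g • y) x -
            ContinuousLinearMap.id ℝ (EuclideanSpace ℝ (Fin n))).toLinearMap) := by
          ext v
          constructor
          · rintro ⟨w, rfl⟩
            obtain ⟨u, rfl⟩ := hbij.2 w
            exact ⟨_, ⟨u, rfl⟩, e2 u⟩
          · rintro ⟨_, ⟨u, rfl⟩, rfl⟩
            exact ⟨L u, (e2 u).symm⟩
        have e4 := LinearEquiv.finrank_map_eq Le (LinearMap.range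
          (modelDeriv n (fun y : W => g • y) x -
            ContinuousLinearMap.id ℝ (EuclideanSpace ℝ (Fin n))).toLinearMap)
        exact (congrArg (fun p : Submodule ℝ (EuclideanSpace ℝ (Fin n)) => Module.finrank ℝ p)
          e3).trans e4
    π := fun x => S.π x
    continuous_π := S.continuous_π.comp continuous_subtype_val
    isOpenMap_π := S.isOpenMap_π.comp W.isOpen.isOpenMap_subtype_val
    π_eq_iff := fun x y => by
      rw [S.π_eq_iff]
      constructor
      · rintro ⟨g, hg⟩
        obtain ⟨h, hh, hhg⟩ := horb x x.2 g (hg ▸ y.2)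
        exact ⟨⟨h, hh⟩, Subtype.ext (hhg.trans hg)⟩
      · rintro ⟨g, hg⟩
        exact ⟨g, congrArg Subtype.val hg⟩ }

variable {S W H}

theorem Effective.restrict (hS : S.Effective) (hconn : IsConnected (W : Set S.V))
    (horb : ∀ x ∈ W, ∀ g : S.G, g • x ∈ W → ∃ h ∈ H, h • x = g • x) :
    (S.restrict W H hW hconn horb).Effective := fun g hg => by
  refine Subtype.ext (hS.eq_of_isOpen W.isOpen hconn.nonempty fun y hy => ?_)
  exact (congrArg Subtype.val (hg ⟨y, hy⟩)).trans (one_smul S.G y).symm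

end Restrict

/-- Every neighbourhood of a point contains a connected open neighbourhood which is preserved by
the stabilizer of the point and disjoint from its other translates. -/
theorem exists_slice (S : UnifSys n X) (v : S.V) {N : Set S.V} (hN : N ∈ 𝓝 v) :
    ∃ W : TopologicalSpace.Opens S.V, v ∈ W ∧ (W : Set S.V) ⊆ N ∧ IsConnected (W : Set S.V) ∧
      (∀ g ∈ MulAction.stabilizer S.G v, ∀ x ∈ W, g • x ∈ W) ∧
      ∀ x ∈ W, ∀ g : S.G, g • x ∈ W → g ∈ MulAction.stabilizer S.G v := by
  have : LocallyConnectedSpace S.V :=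
    ChartedSpace.locallyConnectedSpace (EuclideanSpace ℝ (Fin n)) S.V
  have hsep : ∀ g : S.G, ∃ A : Set S.V, IsOpen A ∧ v ∈ A ∧
      (g • v ≠ v → ∀ x ∈ A, g • x ∉ A) := by
    intro g
    by_cases hg : g • v = v
    · exact ⟨univ, isOpen_univ, trivial, fun h => absurd hg h⟩
    · obtain ⟨A, B, hA, hB, hvA, hvB, hAB⟩ := t2_separation hg
      refine ⟨B ∩ (fun x => g • x) ⁻¹' A, hB.inter (hA.preimage (S.continuous_smul g)),
        ⟨hvB, hvA⟩, fun _ x hx hgx => ?_⟩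
      exact (Set.disjoint_left.1 hAB) hx.2 hgx.1
  choose A hAo hvA hA using hsep
  let O₁ : Set S.V := interior N ∩ ⋂ g, A g
  have hO₁ : IsOpen O₁ := isOpen_interior.inter (isOpen_iInter_of_finite hAo)
  let K := MulAction.stabilizer S.G v
  let O₂ : Set S.V := ⋂ k : K, (fun x => (k : S.G) • x) ⁻¹' O₁
  have hO₂ : IsOpen O₂ := isOpen_iInter_of_finite fun k => hO₁.preimage (S.continuous_smul _)
  have hv₁ : v ∈ O₁ := ⟨mem_interior_iff_mem_nhds.2 hN, mem_iInter.2 hvA⟩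
  have hv₂ : v ∈ O₂ := mem_iInter.2 fun k => by
    have : (k : S.G) • v = v := k.2
    simpa [this] using hv₁
  have h21 : O₂ ⊆ O₁ := fun x hx => by simpa using mem_iInter.1 hx 1
  have hKO : ∀ g ∈ K, ∀ x ∈ O₂, g • x ∈ O₂ := fun g hg x hx => mem_iInter.2 fun k => by
    have := mem_iInter.1 hx (k * ⟨g, hg⟩)
    simpa [mul_smul] using this
  refine ⟨⟨connectedComponentIn O₂ v, hO₂.connectedComponentIn⟩, mem_connectedComponentIn hv₂,
    (connectedComponentIn_subset _ _).trans (h21.trans (inter_subset_left.trans interior_subset)),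
    isConnected_connectedComponentIn_iff.2 hv₂, ?_, ?_⟩
  · intro g hg x hx
    have himg : (fun x => g • x) '' connectedComponentIn O₂ v ⊆ connectedComponentIn O₂ v := by
      refine IsPreconnected.subset_connectedComponentIn
        (isPreconnected_connectedComponentIn.image _ (S.continuous_smul g).continuousOn) ?_ ?_
      · exact ⟨v, mem_connectedComponentIn hv₂, hg⟩
      · rintro _ ⟨y, hy, rfl⟩
        exact hKO g hg y (connectedComponentIn_subset _ _ hy)
    exact himg ⟨x, hx, rfl⟩
  · intro x hx g hgx
    by_contra hg
    have hx1 := h21 (connectedComponentIn_subset _ _ hx)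
    have hx2 := h21 (connectedComponentIn_subset _ _ hgx)
    exact hA g hg x (mem_iInter.1 hx1.2 g) (mem_iInter.1 hx2.2 g)

/-- The restriction of an effective uniformizing system to a small neighbourhood of a point `v`,
with the stabilizer of `v` as its group. -/
theorem Effective.exists_restrict (hS : S.Effective) (v : S.V) {N : Set S.V} (hN : N ∈ 𝓝 v) :
    ∃ (R : UnifSys n X) (i : Inj R S) (r : R.V), R.Effective ∧ i r = v ∧ (∀ x, i x ∈ N) ∧
      ∀ g : R.G, g • r = r := by
  obtain ⟨W, hvW, hWN, hconn, hst, htr⟩ := S.exists_slice v hN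
  have horb : ∀ x ∈ W, ∀ g : S.G, g • x ∈ W → ∃ h ∈ MulAction.stabilizer S.G v, h • x = g • x :=
    fun x hx g hg => ⟨g, htr x hx g hg, rfl⟩
  have hR := hS.restrict hst hconn horb
  refine ⟨S.restrict W (MulAction.stabilizer S.G v) hst hconn horb,
    Inj.ofMap hR hS (Subtype.val : W → S.V) Subtype.val_injective
      (isLocalDiffeomorph_subtype_val (E := EuclideanSpace ℝ (Fin n)) W) (fun _ => rfl),
    ⟨v, hvW⟩, hR, rfl, fun x => hWN x.2, fun g => Subtype.ext g.2⟩

/-! ### Common refinements -/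

/-- An injection factors through another one if its range is contained in that of the other. -/
theorem Inj.exists_comp_eq (hS : S.Effective) (i : Inj R S) (j : Inj T S)
    (h : ∀ x, i x ∈ range j.toFun) : ∃ k : Inj R T, ∀ x, j (k x) = i x := by
  choose f hf using h
  have hcont : Continuous f := j.injective.continuous_of_comp_isOpenMap j.isOpenMap (by
    have : j.toFun ∘ f = i.toFun := funext hf
    rw [this]; exact i.continuous)
  have hld : IsLocalDiffeomorph (𝓡 n) (𝓡 n) ∞ f := fun x =>
    isLocalDiffeomorphAt_of_comp (j.localDiffeo (f x)) hcont.continuousAt (by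
      have : j.toFun ∘ f = i.toFun := funext hf
      rw [this]; exact i.localDiffeo x)
  refine ⟨Inj.ofMap (i.effective_source hS) (j.effective_source hS) f ?_ hld ?_, hf⟩
  · intro x y hxy
    exact i.injective (by rw [← hf, hxy, hf])
  · intro x
    rw [← j.π_toFun, hf, i.π_toFun]

/-- Two injections into an effective uniformizing system which meet at a point have a common
refinement there. -/
theorem Inj.exists_refine (hS : S.Effective) {T₁ T₂ : UnifSys n X} (c₁ : Inj T₁ S) (c₂ : Inj T₂ S)
    {y₁ : T₁.V} {y₂ : T₂.V} (h : c₁ y₁ = c₂ y₂) :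
    ∃ (R : UnifSys n X) (r : R.V) (b₁ : Inj R T₁) (b₂ : Inj R T₂),
      R.Effective ∧ b₁ r = y₁ ∧ b₂ r = y₂ ∧ c₁.comp b₁ = c₂.comp b₂ := by
  have hN : range c₁.toFun ∩ range c₂.toFun ∈ 𝓝 (c₁ y₁) :=
    (c₁.isOpenMap.isOpen_range.inter c₂.isOpenMap.isOpen_range).mem_nhds
      ⟨mem_range_self _, h ▸ mem_range_self _⟩
  obtain ⟨R, i, r, hR, hir, hiN, -⟩ := hS.exists_restrict (c₁ y₁) hN
  obtain ⟨b₁, hb₁⟩ := i.exists_comp_eq hS c₁ fun x => (hiN x).1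
  obtain ⟨b₂, hb₂⟩ := i.exists_comp_eq hS c₂ fun x => (hiN x).2
  refine ⟨R, r, b₁, b₂, hR, c₁.injective ((hb₁ r).trans hir),
    c₂.injective (((hb₂ r).trans hir).trans h), Inj.ext_of_effective hS fun x => ?_⟩
  rw [Inj.comp_apply, Inj.comp_apply, hb₁, hb₂]

theorem Inj.exists_refine_of_π_eq (hS : S.Effective) {T₁ T₂ : UnifSys n X} (c₁ : Inj T₁ S)
    (c₂ : Inj T₂ S) {y₁ : T₁.V} {y₂ : T₂.V} (h : T₁.π y₁ = T₂.π y₂) :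
    ∃ (R : UnifSys n X) (r : R.V) (b₁ : Inj R T₁) (b₂ : Inj R T₂) (g : S.G),
      R.Effective ∧ b₁ r = y₁ ∧ b₂ r = y₂ ∧ c₁.comp b₁ = (S.aut g).comp (c₂.comp b₂) := by
  obtain ⟨g, hg⟩ : ∃ g : S.G, g • c₂ y₂ = c₁ y₁ :=
    (S.π_eq_iff _ _).1 (by rw [c₁.π_toFun, c₂.π_toFun, h])
  obtain ⟨R, r, b₁, b₂, hR, h1, h2, h3⟩ :=
    Inj.exists_refine hS c₁ ((S.aut g).comp c₂) (y₁ := y₁) (y₂ := y₂) hg.symm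
  exact ⟨R, r, b₁, b₂, g, hR, h1, h2, h3⟩

/-- An element which fixes a point in the range of an injection comes from the stabilizer. -/
theorem Inj.exists_hom_eq (hT : T.Effective) (i : Inj S T) {x : S.V} {h : T.G}
    (hx : h • i x = i x) : ∃ g : S.G, g • x = x ∧ i.hom g = h := by
  obtain ⟨R, r, b₁, b₂, hR, h1, h2, h3⟩ :=
    Inj.exists_refine hT i ((T.aut h).comp i) (y₁ := x) (y₂ := x) hx.symm
  obtain ⟨g, hg⟩ := Inj.exists_aut_comp (i.effective_source hT) b₂ b₁
  have hh : i.hom g = h := by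
    refine hT.smul_comp_injective ((i.comp b₂).localDiffeo) fun y => ?_
    have e1 : (i.comp b₁) y = ((T.aut h).comp i).comp b₂ y := by rw [h3]
    rw [hg] at e1
    simp only [Inj.comp_apply, aut_apply] at e1
    rw [i.equivariant] at e1
    exact e1
  refine ⟨g, i.injective ?_, hh⟩
  rw [i.equivariant, hh, hx]

theorem EquivAt.symm' {q : X} (h : EquivAt q S T) : EquivAt q T S := by
  obtain ⟨R, hq, h1, h2⟩ := h
  exact ⟨R, hq, h2, h1⟩

theorem EquivAt.trans' {q : X} (hS : S.Effective) (h : EquivAt q R S)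
    (h' : EquivAt q S T) : EquivAt q R T := by
  obtain ⟨A, ⟨a, ha⟩, ⟨i⟩, ⟨j⟩⟩ := h
  obtain ⟨B, ⟨b, hb⟩, ⟨k⟩, ⟨l⟩⟩ := h'
  obtain ⟨D, d, b₁, b₂, g, -, h1, h2, -⟩ := Inj.exists_refine_of_π_eq hS j k (ha.trans hb.symm)
  refine ⟨D, ⟨d, ?_⟩, ⟨i.comp b₁⟩, ⟨l.comp b₂⟩⟩
  rw [← b₁.π_toFun, h1, ha]

theorem EquivAt.effective {q : X} (h : EquivAt q S T) (hS : S.Effective) : T.Effective := by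
  obtain ⟨A, -, ⟨i⟩, ⟨j⟩⟩ := h
  exact j.effective_target (i.effective_source hS)

/-- Uniformizing systems which are equivalent at `q` have a common refinement through any two given
points over `q`. -/
theorem EquivAt.exists_inj {q : X} (h : EquivAt q S T) (hS : S.Effective) {x : S.V} {y : T.V}
    (hx : S.π x = q) (hy : T.π y = q) :
    ∃ (R : UnifSys n X) (r : R.V) (i : Inj R S) (j : Inj R T), R.Effective ∧ i r = x ∧ j r = y := by
  obtain ⟨A, ⟨a, ha⟩, ⟨i⟩, ⟨j⟩⟩ := h
  obtain ⟨g, hg⟩ := (S.π_eq_iff (i a) x).1 (by rw [i.π_toFun, ha, hx])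
  obtain ⟨g', hg'⟩ := (T.π_eq_iff (j a) y).1 (by rw [j.π_toFun, ha, hy])
  exact ⟨A, a, (S.aut g).comp i, (T.aut g').comp j, i.effective_source hS, hg, hg'⟩

end UnifSys

open UnifSys

namespace OrbStruct

variable {n : ℕ} {X : Type*} [TopologicalSpace X] {O : OrbStruct n X} {S T : UnifSys n X}

theorem Belongs.effective (hO : O.Reduced) (hS : O.Belongs S) : S.Effective := by
  obtain ⟨x⟩ : Nonempty S.V := inferInstance
  exact (hS _ (S.π_mem x)).symm'.effective (hO _)

theorem Belongs.equivAt (hO : O.Reduced) (hS : O.Belongs S) (hT : O.Belongs T) {q : X}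
    (hqS : q ∈ S.U) (hqT : q ∈ T.U) : EquivAt q S T :=
  (hS q hqS).trans' (hO q) (hT q hqT).symm'

theorem Belongs.of_inj (hO : O.Reduced) (hT : O.Belongs T) (i : Inj S T) : O.Belongs S :=
  fun _ hq => EquivAt.trans' (hT.effective hO)
    ⟨S, hq, ⟨Inj.refl S⟩, ⟨i⟩⟩ (hT _ (i.U_subset hq))

end OrbStruct

/-! ### Orbifold bundles -/

namespace OrbBundle

variable {n : ℕ} {X : Type*} [TopologicalSpace X] {O : OrbStruct n X} {k : ℕ}
  {R S T : UnifSys n X}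

/-- The transition map of an orbifold bundle along an injection `i`, as a map between the fibres
over `x` and over a point `y` which is equal to `i x`. -/
def mapTo (E : OrbBundle O k) (hS : O.Belongs S) (hT : O.Belongs T) (i : Inj S T) {x : S.V}
    {y : T.V} (h : i x = y) : (E.bun S hS).Fib x ≃ₗ[ℝ] (E.bun T hT).Fib y :=
  (E.map hS hT i x).trans (E.castFib hT h)

theorem mapTo_comp (E : OrbBundle O k) (hR : O.Belongs R) (hS : O.Belongs S) (hT : O.Belongs T)
    {i : Inj R S} {j : Inj S T} {x : R.V} {y : S.V} {w : T.V} (hi : i x = y) (hj : j y = w)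
    (e : (E.bun R hR).Fib x) :
    E.mapTo hS hT j hj (E.mapTo hR hS i hi e) =
      E.mapTo hR hT (j.comp i) ((congrArg j hi).trans hj) e := by
  subst hi; subst hj
  exact (E.map_comp hR hS hT j i x e).symm

theorem mapTo_congr (E : OrbBundle O k) (hS : O.Belongs S) (hT : O.Belongs T)
    {i j : Inj S T} (hij : i = j) {x : S.V} {y : T.V} (hi : i x = y) (hj : j x = y)
    (e : (E.bun S hS).Fib x) : E.mapTo hS hT i hi e = E.mapTo hS hT j hj e := by
  subst hij; rfl

end OrbBundle

namespace UnifSys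

variable {n : ℕ} {X : Type*} [TopologicalSpace X] {S T : UnifSys n X}

theorem aut_comp_aut (S : UnifSys n X) (g h : S.G) : (S.aut g).comp (S.aut h) = S.aut (g * h) := by
  have h1 : ((S.aut g).comp (S.aut h)).toFun = (S.aut (g * h)).toFun :=
    funext fun x => (mul_smul g h x).symm
  have h2 : ((S.aut g).comp (S.aut h)).hom = (S.aut (g * h)).hom :=
    MonoidHom.ext fun x => by simp [Inj.comp, aut]
  cases h3 : (S.aut g).comp (S.aut h); cases h4 : S.aut (g * h)
  rw [h3, h4] at h1 h2
  cases h1; cases h2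
  rfl

end UnifSys

/-! ### Liftings of constant maps and refinements of covers -/

section Compat

variable {n n' : ℕ} {X X' : Type*} [TopologicalSpace X] [TopologicalSpace X']
  {O : OrbStruct n X} {O' : OrbStruct n' X'} {f : X → X'} {k : ℕ}

/-- A lifting of a constant map is constant, since the fibres of a uniformizing system are
finite. -/
theorem LocalLift.apply_eq {S : UnifSys n X} {T : UnifSys n' X'} {p : X'}
    (F : LocalLift S T (fun _ => p)) (x y : S.V) : F x = F y := by
  have hfin : (range F.toFun).Finite := by
    refine (finite_range fun g : T.G => g • F x).subset ?_
    rintro _ ⟨u, rfl⟩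
    obtain ⟨g, hg⟩ := (T.π_eq_iff (F x) (F u)).1 (by rw [F.π_toFun, F.π_toFun])
    exact ⟨g, hg⟩
  exact (isPreconnected_range F.smooth.continuous).isDiscrete_iff_subsingleton.1 hfin.isDiscrete
    (mem_range_self x) (mem_range_self y)

namespace CompatSys

theorem exists_mem_cover (ξ : CompatSys O O' f) (x : X) : ∃ U : ξ.cover, x ∈ (ξ.dom U).U := by
  have : x ∈ ⋃₀ ξ.cover := by rw [ξ.sUnion_cover]; trivial
  obtain ⟨U, hU, hx⟩ := this
  exact ⟨⟨U, hU⟩, by rw [ξ.dom_U]; exact hx⟩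

/-- Two injections of `A` into elements of the cover factor, near any point, through an element of
the cover which is included in both. -/
theorem exists_common (hO : O.Reduced) (ξ : CompatSys O O' f) {A : UnifSys n X} {U U' : ξ.cover}
    (a : Inj A (ξ.dom U)) (a' : Inj A (ξ.dom U')) (r : A.V) :
    ∃ (B : UnifSys n X) (s : B.V) (m : Inj B A) (U'' : ξ.cover) (l : Inj B (ξ.dom U''))
      (j : Inj (ξ.dom U'') (ξ.dom U)) (j' : Inj (ξ.dom U'') (ξ.dom U')),
      m s = r ∧ a.comp m = j.comp l ∧ a'.comp m = j'.comp l := by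
  have heff : ∀ V, (ξ.dom V).Effective := fun V => (ξ.dom_belongs V).effective hO
  obtain ⟨U'', hx, hsub⟩ := ξ.dom_inter U U' (A.π r)
    ⟨by rw [← ξ.dom_U]; exact a.U_subset (A.π_mem r),
      by rw [← ξ.dom_U]; exact a'.U_subset (A.π_mem r)⟩
  obtain ⟨j₀⟩ := ξ.dom_inj U'' U (hsub.trans inter_subset_left)
  obtain ⟨j₀'⟩ := ξ.dom_inj U'' U' (hsub.trans inter_subset_right)
  rw [← ξ.dom_U] at hx
  obtain ⟨v, hv⟩ := hx
  obtain ⟨B, s, m, l, g, -, h1, -, h3⟩ :=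
    Inj.exists_refine_of_π_eq (heff U) a j₀ (y₁ := r) (y₂ := v) hv.symm
  obtain ⟨g', hg'⟩ := Inj.exists_aut_comp (heff U') (j₀'.comp l) (a'.comp m)
  exact ⟨B, s, m, U'', l, ((ξ.dom U).aut g).comp j₀, ((ξ.dom U').aut g').comp j₀', h1, h3, hg'⟩

end CompatSys

/-! ### Isomorphism of compatible systems is an equivalence relation -/

namespace PullbackIso

variable {ξ₁ ξ₂ ξ₃ : CompatSys O O' f} {E : OrbBundle O' k}

/-- The inverse of an isomorphism of pull-back bundles. -/
def symm (Ψ : PullbackIso E ξ₁ ξ₂) : PullbackIso E ξ₂ ξ₁ where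
  ψ W U₂ U₁ a₂ a₁ y := (Ψ.ψ W U₁ U₂ a₁ a₂ y).symm
  natural_restrict W' W b U₂ U₁ a₂ a₁ y e := by
    obtain ⟨e', rfl⟩ := (Ψ.ψ W U₁ U₂ a₁ a₂ (b y)).surjective e
    exact ((LinearEquiv.symm_apply_eq _).2
      (Ψ.natural_restrict W' W b U₁ U₂ a₁ a₂ y e').symm).trans
        (LinearEquiv.symm_apply_apply _ _).symm
  natural_left W U₂ T₂ U₁ a₂ j a₁ y e := by
    obtain ⟨e', rfl⟩ := (Ψ.ψ W U₁ U₂ a₁ a₂ y).surjective e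
    exact ((LinearEquiv.symm_apply_eq _).2 (Ψ.natural_right W U₁ U₂ T₂ a₁ a₂ j y e').symm).trans
      (LinearEquiv.symm_apply_apply _ _).symm
  natural_right W U₂ U₁ T₁ a₂ a₁ j y e := by
    obtain ⟨e', rfl⟩ := (Ψ.ψ W U₁ U₂ a₁ a₂ y).surjective e
    exact ((LinearEquiv.symm_apply_eq _).2 (Ψ.natural_left W U₁ T₁ U₂ a₁ j a₂ y e').symm).trans
      (congrArg _ (LinearEquiv.symm_apply_apply _ _).symm)
  over_base W U₂ U₁ a₂ a₁ y₀ := by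
    obtain ⟨R, hR, b₁, b₂, h⟩ := Ψ.over_base W U₁ U₂ a₁ a₂ y₀
    refine ⟨R, hR, b₂, b₁, h.mono ?_⟩
    rintro y ⟨r, h₁, h₂, hr⟩
    refine ⟨r, h₂, h₁, fun e => ?_⟩
    rw [LinearEquiv.symm_apply_eq, hr]

/-- A choice of an element of the cover of `ξ` near a point `y` of `W`, with a common refinement
of it and `W`. -/
structure Mid (ξ : CompatSys O O' f) (W : UnifSys n X) (y : W.V) where
  /-- the common refinement -/
  A : UnifSys n X
  /-- its injection into `W` -/
  b : Inj A W
  /-- the point corresponding to `y` -/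
  s : A.V
  hs : b s = y
  /-- the element of the cover -/
  U : ξ.cover
  /-- the injection of the refinement into it -/
  a : Inj A (ξ.dom U)

theorem exists_mid (hO : O.Reduced) (ξ : CompatSys O O' f) {W : UnifSys n X}
    (hW : O.Belongs W) (y : W.V) : Nonempty (Mid ξ W y) := by
  obtain ⟨U, v, hv⟩ := ξ.exists_mem_cover (W.π y)
  obtain ⟨A, s, b, a, -, hs, -⟩ := (hW.equivAt hO (ξ.dom_belongs U) (W.π_mem y)
    ⟨v, hv⟩).exists_inj (hW.effective hO) (x := y) (y := v) rfl hv
  exact ⟨⟨A, b, s, hs, U, a⟩⟩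

/-- The composition of two isomorphisms of pull-back bundles, computed on a common refinement with
an element of the cover of the system in the middle. -/
def through (Ψ : PullbackIso E ξ₁ ξ₂) (Φ : PullbackIso E ξ₂ ξ₃) {W : UnifSys n X}
    {U₁ : ξ₁.cover} {U₃ : ξ₃.cover} (a₁ : Inj W (ξ₁.dom U₁)) (a₃ : Inj W (ξ₃.dom U₃)) :
    {y : W.V} → Mid ξ₂ W y → (ξ₁.PullFib E U₁ (a₁ y) ≃ₗ[ℝ] ξ₃.PullFib E U₃ (a₃ y))
  | _, ⟨A, b, s, rfl, U₂, a₂⟩ =>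
    (Ψ.ψ A U₁ U₂ (a₁.comp b) a₂ s).trans (Φ.ψ A U₂ U₃ a₂ (a₃.comp b) s)

/-- The restriction of a choice to a smaller refinement. -/
def Mid.restrict {ξ : CompatSys O O' f} {W : UnifSys n X} {y : W.V} (c : Mid ξ W y)
    {B : UnifSys n X} (m : Inj B c.A) {t : B.V} (ht : m t = c.s) : Mid ξ W y :=
  ⟨B, c.b.comp m, t, (congrArg c.b ht).trans c.hs, c.U, c.a.comp m⟩

theorem through_restrict (Ψ : PullbackIso E ξ₁ ξ₂) (Φ : PullbackIso E ξ₂ ξ₃) {W : UnifSys n X}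
    {U₁ : ξ₁.cover} {U₃ : ξ₃.cover} (a₁ : Inj W (ξ₁.dom U₁)) (a₃ : Inj W (ξ₃.dom U₃)) {y : W.V}
    (c : Mid ξ₂ W y) {B : UnifSys n X} (m : Inj B c.A) {t : B.V} (ht : m t = c.s)
    (e : ξ₁.PullFib E U₁ (a₁ y)) :
    through Ψ Φ a₁ a₃ (c.restrict m ht) e = through Ψ Φ a₁ a₃ c e := by
  obtain ⟨A, b, s, rfl, U₂, a₂⟩ := c
  dsimp only at m ht
  subst ht
  refine Eq.trans ?_ (Φ.natural_restrict B A m U₂ U₃ a₂ (a₃.comp b) t _)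
  exact congrArg _ (Ψ.natural_restrict B A m U₁ U₂ (a₁.comp b) a₂ t e)

theorem through_comp (Ψ : PullbackIso E ξ₁ ξ₂) (Φ : PullbackIso E ξ₂ ξ₃) {W : UnifSys n X}
    {U₁ : ξ₁.cover} {U₃ : ξ₃.cover} (a₁ : Inj W (ξ₁.dom U₁)) (a₃ : Inj W (ξ₃.dom U₃)) {y : W.V}
    {A : UnifSys n X} (b : Inj A W) {s : A.V} (hs : b s = y) {U T : ξ₂.cover}
    (l : Inj A (ξ₂.dom U)) (j : Inj (ξ₂.dom U) (ξ₂.dom T)) (e : ξ₁.PullFib E U₁ (a₁ y)) :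
    through Ψ Φ a₁ a₃ ⟨A, b, s, hs, T, j.comp l⟩ e = through Ψ Φ a₁ a₃ ⟨A, b, s, hs, U, l⟩ e := by
  subst hs
  exact (congrArg (Φ.ψ A T U₃ (j.comp l) (a₃.comp b) s)
    (Ψ.natural_right A U₁ U T (a₁.comp b) l j s e)).trans
      (Φ.natural_left A U T U₃ l j (a₃.comp b) s _)

theorem through_eq (hO : O.Reduced) (Ψ : PullbackIso E ξ₁ ξ₂) (Φ : PullbackIso E ξ₂ ξ₃)
    {W : UnifSys n X} {U₁ : ξ₁.cover} {U₃ : ξ₃.cover} (a₁ : Inj W (ξ₁.dom U₁))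
    (a₃ : Inj W (ξ₃.dom U₃)) {y : W.V} (c c' : Mid ξ₂ W y) (e : ξ₁.PullFib E U₁ (a₁ y)) :
    through Ψ Φ a₁ a₃ c e = through Ψ Φ a₁ a₃ c' e := by
  have hW : W.Effective := a₁.effective_source ((ξ₁.dom_belongs U₁).effective hO)
  obtain ⟨B, t, m, m', -, ht, ht', hmm⟩ :=
    Inj.exists_refine hW c.b c'.b (c.hs.trans c'.hs.symm)
  obtain ⟨D, d, q, U'', l, j, j', hd, hj, hj'⟩ :=
    ξ₂.exists_common hO (c.a.comp m) (c'.a.comp m') t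
  subst hd
  rw [← through_restrict Ψ Φ a₁ a₃ c (m.comp q) ht e,
    ← through_restrict Ψ Φ a₁ a₃ c' (m'.comp q) ht' e]
  have e1 : c.restrict (m.comp q) ht = ⟨D, (c.b.comp m).comp q, d, (congrArg c.b ht).trans c.hs,
      c.U, j.comp l⟩ := by
    rw [← hj]; rfl
  have e2 : c'.restrict (m'.comp q) ht' = ⟨D, (c.b.comp m).comp q, d,
      (congrArg c.b ht).trans c.hs, c'.U, j'.comp l⟩ := by
    simp only [← hj', hmm]; rfl
  rw [e1, e2]
  exact (through_comp Ψ Φ a₁ a₃ _ _ l j e).trans (through_comp Ψ Φ a₁ a₃ _ _ l j' e).symm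

end PullbackIso

end Compat

section Compat

variable {n n' : ℕ} {X X' : Type*} [TopologicalSpace X] [TopologicalSpace X']
  {O : OrbStruct n X} {O' : OrbStruct n' X'}

namespace CompatSys

theorem Iso.symm {f : X → X'} {ξ₁ ξ₂ : CompatSys O O' f} (h : ξ₁.Iso ξ₂) : ξ₂.Iso ξ₁ :=
  fun k E => (h k E).map PullbackIso.symm

/-- Isomorphism is transitive: the composition is computed locally, on common refinements with the
cover of the system in the middle. -/
theorem Iso.trans (hO : O.Reduced) (hO' : O'.Reduced) {p : X'}
    {ξ₁ ξ₂ ξ₃ : CompatSys O O' (fun _ => p)} (h : ξ₁.Iso ξ₂) (h' : ξ₂.Iso ξ₃) : ξ₁.Iso ξ₃ := by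
  intro k E
  obtain ⟨Ψ⟩ := h k E
  obtain ⟨Φ⟩ := h' k E
  have hmid : ∀ (W : UnifSys n X) (U₁ : ξ₁.cover) (_ : Inj W (ξ₁.dom U₁)) (y : W.V),
      Nonempty (PullbackIso.Mid ξ₂ W y) := fun W U₁ a₁ y =>
    PullbackIso.exists_mid hO ξ₂ ((ξ₁.dom_belongs U₁).of_inj hO a₁) y
  refine ⟨
    { ψ := fun W U₁ U₃ a₁ a₃ y => PullbackIso.through Ψ Φ a₁ a₃ (hmid W U₁ a₁ y).some
      natural_restrict := ?_
      natural_left := ?_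
      natural_right := ?_
      over_base := ?_ }⟩
  · intro W' W b U₁ U₃ a₁ a₃ y e
    obtain ⟨c⟩ := hmid W' U₁ (a₁.comp b) y
    refine (PullbackIso.through_eq hO Ψ Φ (a₁.comp b) (a₃.comp b) _ c e).trans ?_
    refine Eq.trans ?_ (PullbackIso.through_eq hO Ψ Φ a₁ a₃
      ⟨c.A, b.comp c.b, c.s, congrArg b c.hs, c.U, c.a⟩ _ e)
    obtain ⟨A, b', s, rfl, U₂, a₂⟩ := c
    rfl
  · intro W U₁ T₁ U₃ a₁ j a₃ y e
    obtain ⟨c⟩ := hmid W U₁ a₁ y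
    refine (PullbackIso.through_eq hO Ψ Φ (j.comp a₁) a₃ _ c _).trans ?_
    refine Eq.trans ?_ (PullbackIso.through_eq hO Ψ Φ a₁ a₃ c _ e)
    obtain ⟨A, b', s, rfl, U₂, a₂⟩ := c
    exact congrArg (Φ.ψ A U₂ U₃ a₂ (a₃.comp b') s)
      (Ψ.natural_left A U₁ T₁ U₂ (a₁.comp b') j a₂ s e)
  · intro W U₁ U₃ T₃ a₁ a₃ j y e
    obtain ⟨c⟩ := hmid W U₁ a₁ y
    refine (PullbackIso.through_eq hO Ψ Φ a₁ (j.comp a₃) _ c _).trans ?_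
    refine Eq.trans ?_ (congrArg (ξ₃.pullMap E j (a₃ y))
      (PullbackIso.through_eq hO Ψ Φ a₁ a₃ c _ e))
    obtain ⟨A, b', s, rfl, U₂, a₂⟩ := c
    exact Φ.natural_right A U₂ U₃ T₃ a₂ (a₃.comp b') j s _
  · intro W U₁ U₃ a₁ a₃ y₀
    obtain ⟨⟨A, b, s, rfl, U₂, a₂⟩⟩ := hmid W U₁ a₁ y₀
    obtain ⟨R, hR, b₁, b₂, hΨ⟩ := Ψ.over_base A U₁ U₂ (a₁.comp b) a₂ s
    obtain ⟨R', hR', b₁', b₂', hΦ⟩ := Φ.over_base A U₂ U₃ a₂ (a₃.comp b) s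
    obtain ⟨r, h₁, h₂, -⟩ := hΨ.self_of_nhds
    obtain ⟨r', h₁', h₂', -⟩ := hΦ.self_of_nhds
    obtain ⟨D, d, q, q', -, hq, hq', hqq⟩ := Inj.exists_refine
      ((ξ₂.cod_belongs U₂).effective hO') b₂ b₁' (h₂.trans h₁'.symm)
    have hD : O'.Belongs D := hR.of_inj hO' q
    refine ⟨D, hD, b₁.comp q, b₂'.comp q', ?_⟩
    have himg : ∀ᶠ y in 𝓝 (b s), ∃ t, b t = y ∧
        (∃ (r : R.V) (h₁ : b₁ r = ξ₁.lift U₁ ((a₁.comp b) t)) (h₂ : b₂ r = ξ₂.lift U₂ (a₂ t)),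
          ∀ e : (E.bun R hR).Fib r,
            Ψ.ψ A U₁ U₂ (a₁.comp b) a₂ t (E.mapTo hR (ξ₁.cod_belongs U₁) b₁ h₁ e) =
              E.mapTo hR (ξ₂.cod_belongs U₂) b₂ h₂ e) ∧
        (∃ (r : R'.V) (h₁ : b₁' r = ξ₂.lift U₂ (a₂ t))
          (h₂ : b₂' r = ξ₃.lift U₃ ((a₃.comp b) t)),
          ∀ e : (E.bun R' hR').Fib r,
            Φ.ψ A U₂ U₃ a₂ (a₃.comp b) t (E.mapTo hR' (ξ₂.cod_belongs U₂) b₁' h₁ e) =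
              E.mapTo hR' (ξ₃.cod_belongs U₃) b₂' h₂ e) := by
      have := b.isOpenMap.image_mem_nhds (hΨ.and hΦ)
      filter_upwards [this] with y hy
      obtain ⟨t, ht, rfl⟩ := hy
      exact ⟨t, rfl, ht⟩
    filter_upwards [himg] with y hy
    obtain ⟨t, rfl, ⟨ρ, g₁, g₂, hρ⟩, ⟨ρ', g₁', g₂', hρ'⟩⟩ := hy
    -- the liftings are constant, so that the points of `R` and `R'` do not depend on `t`
    have e1 : ρ = r := b₁.injective (g₁.trans (((ξ₁.lift U₁).apply_eq _ _).trans h₁.symm))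
    have e2 : ρ' = r' := b₁'.injective (g₁'.trans (((ξ₂.lift U₂).apply_eq _ _).trans h₁'.symm))
    subst e1; subst e2; subst hq
    refine ⟨d, g₁, (congrArg b₂' hq').trans g₂', fun e => ?_⟩
    refine (PullbackIso.through_eq hO Ψ Φ a₁ a₃ _ ⟨A, b, t, rfl, U₂, a₂⟩ _).trans ?_
    refine (congrArg (fun u => Φ.ψ A U₂ U₃ a₂ (a₃.comp b) t (Ψ.ψ A U₁ U₂ (a₁.comp b) a₂ t u))
      (E.mapTo_comp hD hR (ξ₁.cod_belongs U₁) (i := q) (j := b₁) rfl g₁ e).symm).trans ?_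
    refine (congrArg (Φ.ψ A U₂ U₃ a₂ (a₃.comp b) t) (hρ _)).trans ?_
    refine (congrArg (Φ.ψ A U₂ U₃ a₂ (a₃.comp b) t)
      ((E.mapTo_comp hD hR (ξ₂.cod_belongs U₂) (i := q) (j := b₂) rfl g₂ e).trans
        ((E.mapTo_congr hD (ξ₂.cod_belongs U₂) hqq g₂ ((congrArg b₁' hq').trans g₁') e).trans
          (E.mapTo_comp hD hR' (ξ₂.cod_belongs U₂) (i := q') (j := b₁') hq' g₁' e).symm))).trans ?_
    refine (hρ' _).trans ?_
    exact E.mapTo_comp hD hR' (ξ₃.cod_belongs U₃) (i := q') (j := b₂') hq' g₂' e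

end CompatSys

end Compat

/-! ### The tangent bundle of an orbifold -/

section Tangent

variable {n : ℕ} {X : Type*} [TopologicalSpace X]

/-- The tangent bundle of a manifold. -/
noncomputable def SmoothVB.tangent (M : Type) [TopologicalSpace M]
    [ChartedSpace (EuclideanSpace ℝ (Fin n)) M] [IsManifold (𝓡 n) ∞ M] : SmoothVB n n M where
  Fib := fun x : M => TangentSpace (𝓡 n) x

/-- The tangent bundle of an orbifold, whose transition maps are the derivatives of the
injections. -/
noncomputable def OrbBundle.tangent (O : OrbStruct n X) : OrbBundle O n where
  bun S _ := SmoothVB.tangent S.V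
  map {S T} _ _ i x :=
    ((i.localDiffeo x).mfderivToContinuousLinearEquiv (by simp)).toLinearEquiv
  map_smooth {S T} _ _ i := by
    have h := i.localDiffeo.contMDiff.contMDiff_tangentMap (m := ∞) (n := ∞) (by simp)
    exact h
  map_comp {R S T} _ _ _ j i x e :=
    DFunLike.congr_fun (mfderiv_comp (I := 𝓡 n) (I' := 𝓡 n) (I'' := 𝓡 n) x
      (j.localDiffeo.mdifferentiable (by simp) (i x))
      (i.localDiffeo.mdifferentiable (by simp) x)) e

theorem OrbBundle.tangent_mapTo {O : OrbStruct n X} {S T : UnifSys n X} (hS : O.Belongs S)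
    (hT : O.Belongs T) (i : Inj S T) {x : S.V} {y : T.V} (h : i x = y)
    (e : EuclideanSpace ℝ (Fin n)) :
    (OrbBundle.tangent O).mapTo hS hT i h e = modelDeriv n i.toFun x e := by
  subst h; rfl

/-- Injections are determined by their derivatives at a point. -/
theorem OrbBundle.inj_eq_of_tangent {O : OrbStruct n X} (hO : O.Reduced) {S T : UnifSys n X}
    (hS : O.Belongs S) (hT : O.Belongs T) {i j : Inj S T} {x : S.V} {y : T.V} (hi : i x = y)
    (hj : j x = y) (h : ∀ e, (OrbBundle.tangent O).mapTo hS hT i hi e =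
      (OrbBundle.tangent O).mapTo hS hT j hj e) : i = j := by
  obtain ⟨g, rfl⟩ := Inj.exists_aut_comp (hT.effective hO) i j
  have hg : g • y = y := by
    have := hj
    rwa [Inj.comp_apply, hi] at this
  have hd : modelDeriv n (fun v : T.V => g • v) y = ContinuousLinearMap.id ℝ _ := by
    refine ContinuousLinearMap.ext fun v => ?_
    obtain ⟨w, rfl⟩ := (modelDeriv_bijective (i.localDiffeo x)).2 v
    have h1 := h w
    rw [OrbBundle.tangent_mapTo, OrbBundle.tangent_mapTo] at h1
    have h2 := modelDeriv_comp (n := n) (g := fun v : T.V => g • v) (f := i.toFun) (x := x)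
      (T.mdifferentiableAt_smul _ _) (i.localDiffeo.mdifferentiable (by simp) x)
    have h3 := DFunLike.congr_fun h2 w
    subst hi
    exact h3.symm.trans h1.symm
  have := (hT.effective hO).eq_one_of_modelDeriv hg hd
  subst this
  exact Inj.ext_of_effective (hT.effective hO) fun v => (one_smul _ (i v)).symm

end Tangent

/-! ### Compatible systems of a constant map with values in one uniformizing system -/

theorem UnifSys.eq_of_fixed {n : ℕ} {X : Type*} [TopologicalSpace X] {S : UnifSys n X} {x₀ x : S.V}
    (hfix : ∀ g : S.G, g • x₀ = x₀) (h : S.π x = S.π x₀) : x = x₀ := by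
  obtain ⟨g, hg⟩ := (S.π_eq_iff x₀ x).1 h.symm
  rw [← hg, hfix]

section Compat

variable {n n' : ℕ} {X X' : Type*} [TopologicalSpace X] [TopologicalSpace X']
  {O : OrbStruct n X} {O' : OrbStruct n' X'}

namespace CompatSys

section Tau

variable {f : X → X'} (ξ : CompatSys O O' f) {S : UnifSys n' X'} (hS : S.Effective)
  (c : ∀ U, Inj (ξ.cod U) S)

/-- The element `τ(i)` of the group of `S` by which the injection assigned to `i` acts, when the
sets on the side of the target are included in the set uniformized by `S` through `c`. -/
noncomputable def tau {U₂ U₁ : ξ.cover} (i : Inj (ξ.dom U₂) (ξ.dom U₁)) : S.G :=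
  (Inj.exists_aut_comp hS (c U₂) ((c U₁).comp (ξ.lam i))).choose

theorem tau_spec {U₂ U₁ : ξ.cover} (i : Inj (ξ.dom U₂) (ξ.dom U₁)) :
    (c U₁).comp (ξ.lam i) = (S.aut (ξ.tau hS c i)).comp (c U₂) :=
  (Inj.exists_aut_comp hS (c U₂) ((c U₁).comp (ξ.lam i))).choose_spec

theorem tau_apply {U₂ U₁ : ξ.cover} (i : Inj (ξ.dom U₂) (ξ.dom U₁)) (y : (ξ.cod U₂).V) :
    c U₁ (ξ.lam i y) = ξ.tau hS c i • c U₂ y :=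
  congrArg (fun k : Inj (ξ.cod U₂) S => k y) (ξ.tau_spec hS c i)

theorem eq_tau {U₂ U₁ : ξ.cover} {i : Inj (ξ.dom U₂) (ξ.dom U₁)} {g : S.G}
    (hg : ∀ y, c U₁ (ξ.lam i y) = g • c U₂ y) : g = ξ.tau hS c i :=
  hS.smul_comp_injective (c U₂).localDiffeo fun y => (hg y).symm.trans (ξ.tau_apply hS c i y)

theorem tau_comp {U₃ U₂ U₁ : ξ.cover} (j : Inj (ξ.dom U₂) (ξ.dom U₁))
    (i : Inj (ξ.dom U₃) (ξ.dom U₂)) :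
    ξ.tau hS c (j.comp i) = ξ.tau hS c j * ξ.tau hS c i := by
  symm
  refine ξ.eq_tau hS c fun y => ?_
  rw [ξ.lam_comp, Inj.comp_apply, tau_apply ξ hS c, tau_apply ξ hS c, mul_smul]

theorem tau_aut_eq_one (U : ξ.cover) (g : (ξ.dom U).G) :
    ξ.tau hS c ((ξ.dom U).aut g) = 1 ↔ ∀ y, ξ.lam ((ξ.dom U).aut g) y = y := by
  constructor
  · intro h y
    refine (c U).injective ?_
    rw [tau_apply ξ hS c, h, one_smul]
  · intro h
    exact (ξ.eq_tau hS c fun y => by rw [h, one_smul]).symm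

end Tau

section Delta

variable {p : X'} {ξ₁ ξ₂ : CompatSys O O' (fun _ => p)} {S : UnifSys n' X'} {x₀ : S.V}

theorem apply_lift_eq (ξ : CompatSys O O' (fun _ => p)) (hx₀ : S.π x₀ = p)
    (hfix : ∀ g : S.G, g • x₀ = x₀) {U : ξ.cover} (c : Inj (ξ.cod U) S) (x : (ξ.dom U).V) :
    c (ξ.lift U x) = x₀ :=
  eq_of_fixed hfix (by rw [c.π_toFun, (ξ.lift U).π_toFun, hx₀])

/-- A comparison of two compatible systems with values in the same uniformizing system `S`: an
element of the group of `S` for each common refinement of elements of the two covers, compatible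
with the restrictions and with the elements `τ(i)`. -/
structure Comparison (hS : S.Effective) (c₁ : ∀ U, Inj (ξ₁.cod U) S)
    (c₂ : ∀ U, Inj (ξ₂.cod U) S) where
  /-- the element of the group -/
  δ : ∀ (W : UnifSys n X) (U₁ : ξ₁.cover) (U₂ : ξ₂.cover), Inj W (ξ₁.dom U₁) →
    Inj W (ξ₂.dom U₂) → S.G
  restrict : ∀ (W' W : UnifSys n X) (b : Inj W' W) (U₁ : ξ₁.cover) (U₂ : ξ₂.cover)
    (a₁ : Inj W (ξ₁.dom U₁)) (a₂ : Inj W (ξ₂.dom U₂)),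
    δ W' U₁ U₂ (a₁.comp b) (a₂.comp b) = δ W U₁ U₂ a₁ a₂
  left : ∀ (W : UnifSys n X) (U₁ T₁ : ξ₁.cover) (U₂ : ξ₂.cover) (a₁ : Inj W (ξ₁.dom U₁))
    (j : Inj (ξ₁.dom U₁) (ξ₁.dom T₁)) (a₂ : Inj W (ξ₂.dom U₂)),
    δ W T₁ U₂ (j.comp a₁) a₂ * ξ₁.tau hS c₁ j = δ W U₁ U₂ a₁ a₂
  right : ∀ (W : UnifSys n X) (U₁ : ξ₁.cover) (U₂ T₂ : ξ₂.cover) (a₁ : Inj W (ξ₁.dom U₁))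
    (a₂ : Inj W (ξ₂.dom U₂)) (j : Inj (ξ₂.dom U₂) (ξ₂.dom T₂)),
    δ W U₁ T₂ a₁ (j.comp a₂) = ξ₂.tau hS c₂ j * δ W U₁ U₂ a₁ a₂

variable {c₁ : ∀ U, Inj (ξ₁.cod U) S} {c₂ : ∀ U, Inj (ξ₂.cod U) S}

/-- Compatible systems which admit a comparison are isomorphic: an orbifold bundle is transported
from one to the other through its fibre over the fixed point of `S`. -/
theorem Comparison.iso (hO' : O'.Reduced) (hSb : O'.Belongs S) (hS : S.Effective)
    (hx₀ : S.π x₀ = p) (hfix : ∀ g : S.G, g • x₀ = x₀) (D : Comparison hS c₁ c₂) :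
    ξ₁.Iso ξ₂ := by
  intro k E
  have h₁ : ∀ (U : ξ₁.cover) (x : (ξ₁.dom U).V), c₁ U (ξ₁.lift U x) = x₀ := fun U x =>
    ξ₁.apply_lift_eq hx₀ hfix _ x
  have h₂ : ∀ (U : ξ₂.cover) (x : (ξ₂.dom U).V), c₂ U (ξ₂.lift U x) = x₀ := fun U x =>
    ξ₂.apply_lift_eq hx₀ hfix _ x
  let m₁ := fun (U : ξ₁.cover) (x : (ξ₁.dom U).V) =>
    E.mapTo (ξ₁.cod_belongs U) hSb (c₁ U) (h₁ U x)
  let m₂ := fun (U : ξ₂.cover) (x : (ξ₂.dom U).V) =>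
    E.mapTo (ξ₂.cod_belongs U) hSb (c₂ U) (h₂ U x)
  let a := fun g : S.G => E.mapTo hSb hSb (S.aut g) (hfix g)
  have ha : ∀ g h e, a g (a h e) = a (g * h) e := fun g h e =>
    (E.mapTo_comp hSb hSb hSb (hfix h) (hfix g) e).trans
      (E.mapTo_congr hSb hSb (S.aut_comp_aut g h) _ _ e)
  refine ⟨
    { ψ := fun W U₁ U₂ a₁ a₂ y =>
        ((m₁ U₁ (a₁ y)).trans (a (D.δ W U₁ U₂ a₁ a₂))).trans (m₂ U₂ (a₂ y)).symm
      natural_restrict := ?_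
      natural_left := ?_
      natural_right := ?_
      over_base := ?_ }⟩
  · intro W' W b U₁ U₂ a₁ a₂ y e
    exact congrArg (fun g => (m₂ U₂ (a₂ (b y))).symm (a g (m₁ U₁ (a₁ (b y)) e)))
      (D.restrict W' W b U₁ U₂ a₁ a₂)
  · intro W U₁ T₁ U₂ a₁ j a₂ y e
    refine congrArg (m₂ U₂ (a₂ y)).symm ?_
    refine Eq.trans (congrArg (a _) (?_ : _ = a (ξ₁.tau hS c₁ j) (m₁ U₁ (a₁ y) e)))
      ((ha _ _ _).trans (congrArg (fun g => a g (m₁ U₁ (a₁ y) e)) (D.left W U₁ T₁ U₂ a₁ j a₂)))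
    refine (E.mapTo_comp (ξ₁.cod_belongs U₁) (ξ₁.cod_belongs T₁) hSb
      (ξ₁.lam_lift j (a₁ y)) (h₁ T₁ (j (a₁ y))) e).trans ?_
    refine Eq.trans ?_ (E.mapTo_comp (ξ₁.cod_belongs U₁) hSb hSb (h₁ U₁ (a₁ y)) (hfix _) e).symm
    exact E.mapTo_congr _ _ (ξ₁.tau_spec hS c₁ j) _ _ e
  · intro W U₁ U₂ T₂ a₁ a₂ j y e
    refine (LinearEquiv.symm_apply_eq _).2 ?_
    set u := a (D.δ W U₁ U₂ a₁ a₂) (m₁ U₁ (a₁ y) e) with hu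
    have e1 : a (D.δ W U₁ T₂ a₁ (j.comp a₂)) (m₁ U₁ (a₁ y) e) = a (ξ₂.tau hS c₂ j) u :=
      (congrArg (fun g => a g (m₁ U₁ (a₁ y) e)) (D.right W U₁ U₂ T₂ a₁ a₂ j)).trans
        (ha _ _ _).symm
    refine e1.trans ?_
    obtain ⟨w, hw⟩ := (m₂ U₂ (a₂ y)).surjective u
    have e2 : (m₂ U₂ (a₂ y)).symm u = w := (LinearEquiv.symm_apply_eq _).2 hw.symm
    refine Eq.trans ?_ (congrArg (fun v => m₂ T₂ (j (a₂ y)) (ξ₂.pullMap E j (a₂ y) v)) e2).symm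
    rw [← hw]
    refine (E.mapTo_comp (ξ₂.cod_belongs U₂) hSb hSb (h₂ U₂ (a₂ y)) (hfix _) w).trans ?_
    refine Eq.trans ?_ (E.mapTo_comp (ξ₂.cod_belongs U₂) (ξ₂.cod_belongs T₂) hSb
      (ξ₂.lam_lift j (a₂ y)) (h₂ T₂ (j (a₂ y))) w).symm
    exact E.mapTo_congr _ _ (ξ₂.tau_spec hS c₂ j).symm _ _ w
  · intro W U₁ U₂ a₁ a₂ y₀
    set g := D.δ W U₁ U₂ a₁ a₂ with hg
    have hmeet : ((S.aut g).comp (c₁ U₁)) (ξ₁.lift U₁ (a₁ y₀)) =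
        c₂ U₂ (ξ₂.lift U₂ (a₂ y₀)) := by
      rw [h₂, Inj.comp_apply, h₁]; exact hfix g
    obtain ⟨R, r, b₁, b₂, -, hb₁, hb₂, hbb⟩ := Inj.exists_refine hS _ _ hmeet
    have hR : O'.Belongs R := (ξ₁.cod_belongs U₁).of_inj hO' b₁
    refine ⟨R, hR, b₁, b₂, Filter.Eventually.of_forall fun y => ?_⟩
    have k₁ : b₁ r = ξ₁.lift U₁ (a₁ y) := hb₁.trans ((ξ₁.lift U₁).apply_eq _ _)
    have k₂ : b₂ r = ξ₂.lift U₂ (a₂ y) := hb₂.trans ((ξ₂.lift U₂).apply_eq _ _)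
    refine ⟨r, k₁, k₂, fun e => (LinearEquiv.symm_apply_eq _).2 ?_⟩
    refine (congrArg (a g)
      (E.mapTo_comp hR (ξ₁.cod_belongs U₁) hSb k₁ (h₁ U₁ (a₁ y)) e)).trans ?_
    refine (E.mapTo_comp hR hSb hSb ((congrArg (c₁ U₁) k₁).trans (h₁ U₁ (a₁ y)))
      (hfix g) e).trans ?_
    refine Eq.trans ?_ (E.mapTo_comp hR (ξ₂.cod_belongs U₂) hSb k₂ (h₂ U₂ (a₂ y)) e).symm
    exact E.mapTo_congr hR hSb hbb _ _ e

/-- Conversely, an isomorphism of the pull-backs of the tangent bundle determines a comparison,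
since an element of the group of `S` is determined by its derivative at the fixed point. -/
theorem Iso.comparison (hO' : O'.Reduced) (hSb : O'.Belongs S) (hS : S.Effective)
    (hx₀ : S.π x₀ = p) (hfix : ∀ g : S.G, g • x₀ = x₀) (h : ξ₁.Iso ξ₂)
    (c₁ : ∀ U, Inj (ξ₁.cod U) S) (c₂ : ∀ U, Inj (ξ₂.cod U) S) :
    Nonempty (Comparison hS c₁ c₂) := by
  let E := OrbBundle.tangent O'
  obtain ⟨Ψ⟩ := h n' E
  have h₁ : ∀ (U : ξ₁.cover) (x : (ξ₁.dom U).V), c₁ U (ξ₁.lift U x) = x₀ := fun U x =>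
    ξ₁.apply_lift_eq hx₀ hfix _ x
  have h₂ : ∀ (U : ξ₂.cover) (x : (ξ₂.dom U).V), c₂ U (ξ₂.lift U x) = x₀ := fun U x =>
    ξ₂.apply_lift_eq hx₀ hfix _ x
  let m₁ := fun (U : ξ₁.cover) (x : (ξ₁.dom U).V) =>
    E.mapTo (ξ₁.cod_belongs U) hSb (c₁ U) (h₁ U x)
  let m₂ := fun (U : ξ₂.cover) (x : (ξ₂.dom U).V) =>
    E.mapTo (ξ₂.cod_belongs U) hSb (c₂ U) (h₂ U x)
  let a := fun g : S.G => E.mapTo hSb hSb (S.aut g) (hfix g)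
  have ha : ∀ g h e, a g (a h e) = a (g * h) e := fun g h e =>
    (E.mapTo_comp hSb hSb hSb (hfix h) (hfix g) e).trans
      (E.mapTo_congr hSb hSb (S.aut_comp_aut g h) _ _ e)
  have hainj : ∀ g g' : S.G, (∀ e, a g e = a g' e) → g = g' := by
    intro g g' hgg
    have := OrbBundle.inj_eq_of_tangent hO' hSb hSb (hfix g) (hfix g') hgg
    exact hS.smul_comp_injective (Inj.refl S).localDiffeo
      fun x => congrArg (fun k : Inj S S => k x) this
  -- `P g y` says that, over `y`, the isomorphism is the derivative of `g` at the fixed point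
  let P := fun (W : UnifSys n X) (U₁ : ξ₁.cover) (U₂ : ξ₂.cover) (a₁ : Inj W (ξ₁.dom U₁))
    (a₂ : Inj W (ξ₂.dom U₂)) (g : S.G) (y : W.V) =>
      ∀ e, m₂ U₂ (a₂ y) (Ψ.ψ W U₁ U₂ a₁ a₂ y e) = a g (m₁ U₁ (a₁ y) e)
  have huniq : ∀ {W U₁ U₂ a₁ a₂ g g' y}, P W U₁ U₂ a₁ a₂ g y → P W U₁ U₂ a₁ a₂ g' y →
      g = g' := by
    intro W U₁ U₂ a₁ a₂ g g' y hg hg'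
    refine hainj g g' fun e => ?_
    obtain ⟨w, rfl⟩ := (m₁ U₁ (a₁ y)).surjective e
    exact (hg w).symm.trans (hg' w)
  have hloc : ∀ W U₁ U₂ a₁ a₂ (y₀ : W.V), ∃ g, ∀ᶠ y in 𝓝 y₀, P W U₁ U₂ a₁ a₂ g y := by
    intro W U₁ U₂ a₁ a₂ y₀
    obtain ⟨R, hR, b₁, b₂, hev⟩ := Ψ.over_base W U₁ U₂ a₁ a₂ y₀
    obtain ⟨g, hg⟩ := Inj.exists_aut_comp hS ((c₁ U₁).comp b₁) ((c₂ U₂).comp b₂)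
    refine ⟨g, hev.mono ?_⟩
    rintro y ⟨r, k₁, k₂, hr⟩ e
    obtain ⟨w, rfl⟩ := (E.mapTo hR (ξ₁.cod_belongs U₁) b₁ k₁).surjective e
    refine (congrArg (m₂ U₂ (a₂ y)) (hr w)).trans ?_
    refine (E.mapTo_comp hR (ξ₂.cod_belongs U₂) hSb k₂ (h₂ U₂ (a₂ y)) w).trans ?_
    refine Eq.trans ?_ (congrArg (a g)
      (E.mapTo_comp hR (ξ₁.cod_belongs U₁) hSb k₁ (h₁ U₁ (a₁ y)) w)).symm
    refine Eq.trans ?_ (E.mapTo_comp hR hSb hSb ((congrArg (c₁ U₁) k₁).trans (h₁ U₁ (a₁ y)))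
      (hfix g) w).symm
    exact E.mapTo_congr hR hSb hg _ _ w
  have hglob : ∀ W U₁ U₂ a₁ a₂, ∃ g, ∀ y, P W U₁ U₂ a₁ a₂ g y := by
    intro W U₁ U₂ a₁ a₂
    choose g hg using hloc W U₁ U₂ a₁ a₂
    have hconst : IsLocallyConstant g := by
      refine (IsLocallyConstant.iff_eventually_eq g).2 fun y => ?_
      filter_upwards [hg y] with u hu
      exact huniq (hg u).self_of_nhds hu
    obtain ⟨y₀⟩ : Nonempty W.V := inferInstance
    refine ⟨g y₀, fun y => ?_⟩
    rw [hconst.apply_eq_of_preconnectedSpace y₀ y]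
    exact (hg y).self_of_nhds
  choose δ hδ using hglob
  refine ⟨⟨δ, ?_, ?_, ?_⟩⟩
  · intro W' W b U₁ U₂ a₁ a₂
    obtain ⟨y⟩ : Nonempty W'.V := inferInstance
    refine huniq (hδ W' U₁ U₂ (a₁.comp b) (a₂.comp b) y) fun e => ?_
    refine Eq.trans ?_ (hδ W U₁ U₂ a₁ a₂ (b y) e)
    exact congrArg (m₂ U₂ (a₂ (b y))) (Ψ.natural_restrict W' W b U₁ U₂ a₁ a₂ y e)
  · intro W U₁ T₁ U₂ a₁ j a₂
    obtain ⟨y⟩ : Nonempty W.V := inferInstance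
    refine (huniq (hδ W U₁ U₂ a₁ a₂ y) fun e => ?_).symm
    refine Eq.trans ?_ (ha _ _ _)
    refine (congrArg (m₂ U₂ (a₂ y)) (Ψ.natural_left W U₁ T₁ U₂ a₁ j a₂ y e)).symm.trans ?_
    refine (hδ W T₁ U₂ (j.comp a₁) a₂ y _).trans (congrArg (a _) ?_)
    refine (E.mapTo_comp (ξ₁.cod_belongs U₁) (ξ₁.cod_belongs T₁) hSb
      (ξ₁.lam_lift j (a₁ y)) (h₁ T₁ (j (a₁ y))) e).trans ?_
    refine Eq.trans ?_ (E.mapTo_comp (ξ₁.cod_belongs U₁) hSb hSb (h₁ U₁ (a₁ y)) (hfix _) e).symm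
    exact E.mapTo_congr _ _ (ξ₁.tau_spec hS c₁ j) _ _ e
  · intro W U₁ U₂ T₂ a₁ a₂ j
    obtain ⟨y⟩ : Nonempty W.V := inferInstance
    refine huniq (hδ W U₁ T₂ a₁ (j.comp a₂) y) fun e => ?_
    refine Eq.trans ?_ (ha _ _ _)
    refine (congrArg (m₂ T₂ (j (a₂ y))) (Ψ.natural_right W U₁ U₂ T₂ a₁ a₂ j y e)).trans ?_
    refine Eq.trans ?_ (congrArg (a _) (hδ W U₁ U₂ a₁ a₂ y e))
    generalize Ψ.ψ W U₁ U₂ a₁ a₂ y e = w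
    refine (E.mapTo_comp (ξ₂.cod_belongs U₂) (ξ₂.cod_belongs T₂) hSb
      (ξ₂.lam_lift j (a₂ y)) (h₂ T₂ (j (a₂ y))) w).trans ?_
    refine Eq.trans ?_ (E.mapTo_comp (ξ₂.cod_belongs U₂) hSb hSb (h₂ U₂ (a₂ y)) (hfix _) w).symm
    exact E.mapTo_congr _ _ (ξ₂.tau_spec hS c₂ j) _ _ w

end Delta

/-- Monomorphy of the group homomorphisms is invariant under isomorphism. -/
theorem Monomorphic.of_iso (hO : O.Reduced) (hO' : O'.Reduced) {f : X → X'}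
    {ξ₁ ξ₂ : CompatSys O O' f} (hm : ξ₁.Monomorphic) (h : ξ₁.Iso ξ₂) : ξ₂.Monomorphic := by
  intro U₂ v g hgv hg
  let E := OrbBundle.tangent O'
  obtain ⟨Ψ⟩ := h n' E
  have heff₂ : (ξ₂.dom U₂).Effective := (ξ₂.dom_belongs U₂).effective hO
  obtain ⟨U₁, v₁, hv₁⟩ := ξ₁.exists_mem_cover ((ξ₂.dom U₂).π v)
  have heff₁ : (ξ₁.dom U₁).Effective := (ξ₁.dom_belongs U₁).effective hO
  obtain ⟨W, w, a₂, a₁, hW, hw₂, hw₁⟩ := ((ξ₂.dom_belongs U₂).equivAt hO (ξ₁.dom_belongs U₁)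
    ((ξ₂.dom U₂).π_mem v) ⟨v₁, hv₁⟩).exists_inj heff₂ rfl hv₁
  obtain ⟨k, hkw, hk⟩ := a₂.exists_hom_eq heff₂ (x := w) (h := g) (by rw [hw₂, hgv])
  set g₁ := a₁.hom k with hg₁
  have e₂ : a₂.comp (W.aut k) = ((ξ₂.dom U₂).aut g).comp a₂ := by
    rw [Inj.comp_aut _ _ heff₂, hk]
  have e₁ : a₁.comp (W.aut k) = ((ξ₁.dom U₁).aut g₁).comp a₁ := Inj.comp_aut _ _ heff₁
  obtain ⟨R, hR, b₁, b₂, hev⟩ := Ψ.over_base W U₁ U₂ a₁ a₂ w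
  obtain ⟨r, k₁, k₂, hr⟩ := hev.self_of_nhds
  have hr' : ∀ y, y = w → ∃ (k₁ : b₁ r = ξ₁.lift U₁ (a₁ y)) (k₂ : b₂ r = ξ₂.lift U₂ (a₂ y)),
      ∀ e, Ψ.ψ W U₁ U₂ a₁ a₂ y (E.mapTo hR (ξ₁.cod_belongs U₁) b₁ k₁ e) =
        E.mapTo hR (ξ₂.cod_belongs U₂) b₂ k₂ e := by
    rintro y rfl
    exact ⟨k₁, k₂, hr⟩
  obtain ⟨l₁, l₂, hl⟩ := hr' (W.aut k w) hkw
  -- naturality of `Ψ` with respect to the automorphism given by `k`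
  have hrestr : ∀ (A₁ : Inj W (ξ₁.dom U₁)) (A₂ : Inj W (ξ₂.dom U₂)),
      A₁ = a₁.comp (W.aut k) → A₂ = a₂.comp (W.aut k) →
      ∀ (q₁ : b₁ r = ξ₁.lift U₁ (A₁ w)) (q₂ : b₂ r = ξ₂.lift U₂ (A₂ w)) e,
      Ψ.ψ W U₁ U₂ A₁ A₂ w (E.mapTo hR (ξ₁.cod_belongs U₁) b₁ q₁ e) =
        E.mapTo hR (ξ₂.cod_belongs U₂) b₂ q₂ e := by
    rintro _ _ rfl rfl q₁ q₂ e
    exact (Ψ.natural_restrict W W (W.aut k) U₁ U₂ a₁ a₂ w _).trans (hl e)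
  have hA₁ : ((ξ₁.dom U₁).aut g₁).comp a₁ w = a₁ (W.aut k w) :=
    congrArg (fun i : Inj W (ξ₁.dom U₁) => i w) e₁.symm
  have hA₂ : ((ξ₂.dom U₂).aut g).comp a₂ w = a₂ (W.aut k w) :=
    congrArg (fun i : Inj W (ξ₂.dom U₂) => i w) e₂.symm
  have q₁ : b₁ r = ξ₁.lift U₁ (((ξ₁.dom U₁).aut g₁).comp a₁ w) := by rw [hA₁]; exact l₁
  have q₂ : b₂ r = ξ₂.lift U₂ (((ξ₂.dom U₂).aut g).comp a₂ w) := by rw [hA₂]; exact l₂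
  have key := hrestr _ _ e₁.symm e₂.symm q₁ q₂
  have hlam₂ : ξ₂.lam ((ξ₂.dom U₂).aut g) = Inj.refl _ :=
    Inj.ext_of_effective ((ξ₂.cod_belongs U₂).effective hO') hg
  have hi₁ : ((ξ₁.lam ((ξ₁.dom U₁).aut g₁)).comp b₁) r =
      ξ₁.lift U₁ (((ξ₁.dom U₁).aut g₁).comp a₁ w) :=
    (congrArg (ξ₁.lam ((ξ₁.dom U₁).aut g₁)) k₁).trans (ξ₁.lam_lift ((ξ₁.dom U₁).aut g₁) (a₁ w))
  have hinj : (ξ₁.lam ((ξ₁.dom U₁).aut g₁)).comp b₁ = b₁ := by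
    refine OrbBundle.inj_eq_of_tangent hO' hR (ξ₁.cod_belongs U₁) hi₁ q₁ fun e => ?_
    apply (Ψ.ψ W U₁ U₂ (((ξ₁.dom U₁).aut g₁).comp a₁) (((ξ₂.dom U₂).aut g).comp a₂) w).injective
    refine Eq.trans ?_ (key e).symm
    refine (congrArg _ (E.mapTo_comp hR (ξ₁.cod_belongs U₁) (ξ₁.cod_belongs U₁) k₁
      (ξ₁.lam_lift ((ξ₁.dom U₁).aut g₁) (a₁ w)) e).symm).trans ?_
    refine (Ψ.natural_left W U₁ U₁ U₂ a₁ ((ξ₁.dom U₁).aut g₁)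
      (((ξ₂.dom U₂).aut g).comp a₂) w _).trans ?_
    refine (Ψ.natural_right W U₁ U₂ U₂ a₁ a₂ ((ξ₂.dom U₂).aut g) w _).trans ?_
    refine (congrArg (ξ₂.pullMap E ((ξ₂.dom U₂).aut g) (a₂ w)) (hr e)).trans ?_
    refine (E.mapTo_comp hR (ξ₂.cod_belongs U₂) (ξ₂.cod_belongs U₂) k₂
      (ξ₂.lam_lift ((ξ₂.dom U₂).aut g) (a₂ w)) e).trans ?_
    exact E.mapTo_congr hR (ξ₂.cod_belongs U₂) (by rw [hlam₂]; rfl) _ _ e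
  have hlam₁ : ∀ y, ξ₁.lam ((ξ₁.dom U₁).aut g₁) y = y := by
    obtain ⟨t, ht⟩ := Inj.exists_aut_comp ((ξ₁.cod_belongs U₁).effective hO')
      (Inj.refl _) (ξ₁.lam ((ξ₁.dom U₁).aut g₁))
    have ht1 : t = 1 := by
      refine ((ξ₁.cod_belongs U₁).effective hO').smul_comp_injective b₁.localDiffeo fun y => ?_
      have := congrArg (fun i : Inj R (ξ₁.cod U₁) => i y) hinj
      rw [ht] at this
      exact this.trans (one_smul _ _).symm
    intro y
    rw [ht, ht1]
    exact one_smul _ y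
  have hfixed : g₁ • a₁ w = a₁ w := by
    rw [hg₁, ← a₁.equivariant, hkw]
  have : g₁ = 1 := hm U₁ (a₁ w) g₁ hfixed hlam₁
  have hk1 : k = 1 := a₁.hom_injective (this.trans (map_one _).symm)
  rw [← hk, hk1, map_one]

end CompatSys

end Compat

/-! ### Local transport between regular points -/

/-- A property of homotopy classes of paths which is stable under concatenation and holds for paths
that are small enough holds for all paths. -/
theorem Path.Homotopic.Quotient.induction_of_small {Y : Type*} [TopologicalSpace Y]
    {P : ∀ {x y : Y}, Path.Homotopic.Quotient x y → Prop}
    (htrans : ∀ {x y w : Y} (γ : Path.Homotopic.Quotient x y) (δ : Path.Homotopic.Quotient y w),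
      P γ → P δ → P (γ.trans δ))
    (hsmall : ∀ x : Y, ∃ N ∈ 𝓝 x, ∀ {x₁ y₁ : Y} (γ : Path x₁ y₁), range γ ⊆ N →
      P (Path.Homotopic.Quotient.mk γ)) {x y : Y} (γ : Path.Homotopic.Quotient x y) : P γ := by
  obtain ⟨p, rfl⟩ := Path.Homotopic.Quotient.mk_surjective γ
  choose N hN hP using hsmall
  obtain ⟨t, ht0, hmono, ⟨m, hm⟩, hsub⟩ := exists_monotone_Icc_subset_open_cover_unitInterval
    (c := fun x => p ⁻¹' interior (N x)) (fun x => isOpen_interior.preimage p.continuous)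
    (fun s _ => mem_iUnion.2 ⟨p s, mem_interior_iff_mem_nhds.2 (hN _)⟩)
  have hpiece : ∀ a b : unitInterval, a ≤ b → (∃ x, Icc a b ⊆ p ⁻¹' interior (N x)) →
      P (Path.Homotopic.Quotient.mk (p.subpath a b)) := by
    rintro a b hab ⟨x, hx⟩
    refine hP x _ ?_
    rw [Path.range_subpath_of_le _ _ _ hab]
    rintro _ ⟨s, hs, rfl⟩
    exact interior_subset (hx hs)
  have hind : ∀ k, P (Path.Homotopic.Quotient.mk (p.subpath 0 (t k))) := by
    intro k
    induction k with
    | zero =>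
      obtain ⟨x, hx⟩ := hsub 0
      rw [ht0] at hx ⊢
      exact hpiece 0 0 le_rfl ⟨x, (Icc_subset_Icc_right bot_le).trans hx⟩
    | succ k ih =>
      have := htrans _ _ ih (hpiece (t k) (t (k + 1)) (hmono (Nat.le_succ k)) (hsub k))
      rwa [← Path.Homotopic.Quotient.mk_trans,
        Path.Homotopic.Quotient.eq.2 ⟨Path.Homotopy.subpathTransSubpath p 0 (t k) (t (k + 1))⟩]
        at this
  have h1 := hind m
  rw [hm m le_rfl, Path.subpath_zero_one] at h1
  have hcast : ∀ {x' y' : Y} (hx : x' = x) (hy : y' = y),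
      P (Path.Homotopic.Quotient.mk (p.cast hx hy)) → P (Path.Homotopic.Quotient.mk p) := by
    rintro _ _ rfl rfl h
    exact h
  exact hcast _ _ h1

section Transport

variable {n n' : ℕ} {X X' : Type*} [TopologicalSpace X] [TopologicalSpace X']
  {O : OrbStruct n X} {O' : OrbStruct n' X'} {f : X → X'} {ξ : CompatSys O O' f}
  {S : UnifSys n' X'} {z : Set X}

namespace UnifSys

/-- Injections which agree at a point with trivial stabilizer are equal. -/
theorem Inj.eq_of_free {R T : UnifSys n X} (hT : T.Effective) {i j : Inj R T} {u : R.V}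
    (h : i u = j u) (hfree : ∀ g : T.G, g • i u = i u → g = 1) : i = j := by
  obtain ⟨g, rfl⟩ := Inj.exists_aut_comp hT i j
  have : g = 1 := hfree g h.symm
  subst this
  exact Inj.ext_of_effective hT fun v => (one_smul _ (i v)).symm

/-- The projection is injective near a point with trivial stabilizer. -/
theorem exists_injOn (T : UnifSys n X) {v : T.V} (hfree : ∀ g : T.G, g • v = v → g = 1) :
    ∃ N : Set T.V, IsOpen N ∧ v ∈ N ∧ InjOn T.π N := by
  obtain ⟨W, hvW, -, -, -, htr⟩ := T.exists_slice v (N := univ) Filter.univ_mem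
  refine ⟨W, W.isOpen, hvW, fun x hx y hy hxy => ?_⟩
  obtain ⟨g, rfl⟩ := (T.π_eq_iff x y).1 hxy
  rw [hfree g (htr x hx g hy), one_smul]

end UnifSys

namespace CompatSys

/-- The points of the uniformizing systems of the cover which lie outside of `z` have trivial
stabilizers. -/
def FreeOutside (ξ : CompatSys O O' f) (z : Set X) : Prop :=
  ∀ (U : ξ.cover) (v : (ξ.dom U).V), (ξ.dom U).π v ∉ z → ∀ g : (ξ.dom U).G, g • v = v → g = 1

theorem exists_common_point (ξ : CompatSys O O' f) {U U' : ξ.cover} {v : (ξ.dom U).V}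
    {v' : (ξ.dom U').V} (h : (ξ.dom U).π v = (ξ.dom U').π v') :
    ∃ (U'' : ξ.cover) (w : (ξ.dom U'').V) (j : Inj (ξ.dom U'') (ξ.dom U))
      (j' : Inj (ξ.dom U'') (ξ.dom U')), j w = v ∧ j' w = v' := by
  obtain ⟨U'', hx, hsub⟩ := ξ.dom_inter U U' ((ξ.dom U).π v)
    ⟨by rw [← ξ.dom_U]; exact π_mem _ v, by rw [← ξ.dom_U, h]; exact π_mem _ v'⟩
  obtain ⟨j⟩ := ξ.dom_inj U'' U (hsub.trans inter_subset_left)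
  obtain ⟨j'⟩ := ξ.dom_inj U'' U' (hsub.trans inter_subset_right)
  rw [← ξ.dom_U] at hx
  obtain ⟨w, hw⟩ := hx
  obtain ⟨g, hg⟩ := ((ξ.dom U).π_eq_iff (j w) v).1 ((j.π_toFun w).trans hw)
  obtain ⟨g', hg'⟩ := ((ξ.dom U').π_eq_iff (j' w) v').1 ((j'.π_toFun w).trans (hw.trans h))
  exact ⟨U'', w, ((ξ.dom U).aut g).comp j, ((ξ.dom U').aut g').comp j', hg, hg'⟩

variable (hS : S.Effective) (c : ∀ U, Inj (ξ.cod U) S)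

/-- `g` is the transport between two regular points over the same point, through an element of the
cover that is included in both of theirs. -/
def LocalTransport (a b : ξ.RegPt z) (g : S.G) : Prop :=
  ∃ (U : ξ.cover) (w : (ξ.dom U).V) (j : Inj (ξ.dom U) (ξ.dom a.U))
    (j' : Inj (ξ.dom U) (ξ.dom b.U)), j w = a.v ∧ j' w = b.v ∧
      g = ξ.tau hS c j' * (ξ.tau hS c j)⁻¹

namespace LocalTransport

variable {hS c} {a b d : ξ.RegPt z} {g h : S.G}

theorem exists_of_pt_eq (hS : S.Effective) (c : ∀ U, Inj (ξ.cod U) S) {a b : ξ.RegPt z}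
    (hab : a.pt = b.pt) : ∃ g, LocalTransport hS c a b g := by
  obtain ⟨U, w, j, j', h1, h2⟩ := ξ.exists_common_point (congrArg Subtype.val hab)
  exact ⟨_, U, w, j, j', h1, h2, rfl⟩

theorem pt_eq (H : LocalTransport hS c a b g) : a.pt = b.pt := by
  obtain ⟨U, w, j, j', h1, h2, -⟩ := H
  refine Subtype.ext ?_
  change (ξ.dom a.U).π a.v = (ξ.dom b.U).π b.v
  rw [← h1, ← h2, j.π_toFun, j'.π_toFun]

theorem symm (H : LocalTransport hS c a b g) : LocalTransport hS c b a g⁻¹ := by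
  obtain ⟨U, w, j, j', h1, h2, rfl⟩ := H
  exact ⟨U, w, j', j, h2, h1, by group⟩

theorem trans (hO : O.Reduced) (hfree : ξ.FreeOutside z) (H : LocalTransport hS c a b g)
    (H' : LocalTransport hS c b d h) : LocalTransport hS c a d (h * g) := by
  obtain ⟨U, w, j, j', h1, h2, rfl⟩ := H
  obtain ⟨T, u, i, i', k1, k2, rfl⟩ := H'
  obtain ⟨Q, t, l, l', m1, m2⟩ := ξ.exists_common_point (v := w) (v' := u)
    (by rw [← j'.π_toFun, ← i.π_toFun, h2, k1])
  have heq : j'.comp l = i.comp l' := by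
    refine Inj.eq_of_free (u := t) ((ξ.dom_belongs _).effective hO) ?_ ?_
    · rw [Inj.comp_apply, Inj.comp_apply, m1, m2, h2, k1]
    · rw [Inj.comp_apply, m1, h2]
      exact hfree b.U b.v b.notMem
  have h3 := congrArg (ξ.tau hS c) heq
  rw [tau_comp, tau_comp] at h3
  refine ⟨Q, t, j.comp l, i'.comp l', ?_, ?_, ?_⟩
  · rw [Inj.comp_apply, m1, h1]
  · rw [Inj.comp_apply, m2, k2]
  · rw [tau_comp, tau_comp, eq_mul_inv_of_mul_eq h3]
    group

theorem eq_one (hO : O.Reduced) (hfree : ξ.FreeOutside z) (H : LocalTransport hS c a a g) :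
    g = 1 := by
  obtain ⟨U, w, j, j', h1, h2, rfl⟩ := H
  have : j = j' := by
    refine Inj.eq_of_free (u := w) ((ξ.dom_belongs _).effective hO) (h1.trans h2.symm) ?_
    rw [h1]
    exact hfree a.U a.v a.notMem
  rw [this, mul_inv_cancel]

theorem unique (hO : O.Reduced) (hfree : ξ.FreeOutside z) (H : LocalTransport hS c a b g)
    (H' : LocalTransport hS c a b h) : g = h := by
  have := (H'.symm.trans hO hfree H).eq_one hO hfree
  exact mul_inv_eq_one.1 this

theorem refl (hO : O.Reduced) (hfree : ξ.FreeOutside z) (a : ξ.RegPt z) :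
    LocalTransport hS c a a 1 := by
  obtain ⟨g, hg⟩ := exists_of_pt_eq hS c (rfl : a.pt = a.pt)
  rwa [hg.eq_one hO hfree] at hg

theorem hop {U₂ U₁ : ξ.cover} (i : Inj (ξ.dom U₂) (ξ.dom U₁)) {v : (ξ.dom U₂).V}
    (hv : (ξ.dom U₂).π v ∉ z) (hiv : (ξ.dom U₁).π (i v) ∉ z) :
    LocalTransport hS c (z := z) ⟨U₂, v, hv⟩ ⟨U₁, i v, hiv⟩ (ξ.tau hS c i) := by
  refine ⟨U₂, v, Inj.refl _, i, rfl, rfl, ?_⟩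
  have h1 : ξ.tau hS c (Inj.refl (ξ.dom U₂)) =
      ξ.tau hS c (Inj.refl (ξ.dom U₂)) * ξ.tau hS c (Inj.refl (ξ.dom U₂)) :=
    ξ.tau_comp hS c (Inj.refl (ξ.dom U₂)) (Inj.refl (ξ.dom U₂))
  rw [left_eq_mul.1 h1, inv_one, mul_one]

/-- Local transport is locally constant: it is the same for points near `a` and the points over
them near `b`. -/
theorem eventually (H : LocalTransport hS c a b g) {N : Set (ξ.dom b.U).V} (hN : N ∈ 𝓝 b.v)
    (hinj : InjOn (ξ.dom b.U).π N) :
    ∀ᶠ v in 𝓝 a.v, ∀ (hv : (ξ.dom a.U).π v ∉ z) (v' : (ξ.dom b.U).V)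
      (hv' : (ξ.dom b.U).π v' ∉ z), v' ∈ N → (ξ.dom b.U).π v' = (ξ.dom a.U).π v →
      LocalTransport hS c (z := z) ⟨a.U, v, hv⟩ ⟨b.U, v', hv'⟩ g := by
  obtain ⟨U, w, j, j', h1, h2, rfl⟩ := H
  have hpre : j'.toFun ⁻¹' N ∈ 𝓝 w := j'.continuous.continuousAt (by rw [h2]; exact hN)
  have := j.isOpenMap.image_mem_nhds hpre
  rw [h1] at this
  filter_upwards [this]
  rintro _ ⟨u, hu, rfl⟩ hv v' hv' hv'N hπ
  refine ⟨U, u, j, j', rfl, hinj hu hv'N ?_, rfl⟩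
  rw [hπ, j.π_toFun, j'.π_toFun]

/-- Local transport is a transport along the constant path. -/
theorem transport (H : LocalTransport hS c a b g) :
    ξ.Transport S c z a b ((Path.Homotopic.Quotient.refl a.pt).cast rfl H.pt_eq.symm) g := by
  have hπ := H.pt_eq
  obtain ⟨U, w, j, j', h1, h2, rfl⟩ := H
  obtain ⟨Ua, va, ha⟩ := a
  obtain ⟨Ub, vb, hb⟩ := b
  dsimp only at h1 h2 j j'
  subst h1; subst h2
  have hw : (ξ.dom U).π w ∉ z := by rw [← j.π_toFun]; exact ha
  have T1 := Transport.hop (S := S) (c := c) (z := z) j w hw ha _ (ξ.tau_apply hS c j)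
  have T2 := Transport.hop (S := S) (c := c) (z := z) j' w hw hb _ (ξ.tau_apply hS c j')
  have T3 := Transport.trans (Transport.symm T1) T2
  have key : ∀ {x y w : {x : X // x ∉ z}} (hy : y = x) (hw : w = x),
      (Path.Homotopic.Quotient.mk ((Path.refl x).cast rfl hy)).symm.trans
        (Path.Homotopic.Quotient.mk ((Path.refl x).cast rfl hw)) =
      (Path.Homotopic.Quotient.refl y).cast rfl (hw.trans hy.symm) := by
    rintro x _ _ rfl rfl
    exact Path.Homotopic.Quotient.symm_trans _
  have e := key (x := ⟨(ξ.dom U).π w, hw⟩) (y := (⟨Ua, j w, ha⟩ : ξ.RegPt z).pt)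
    (w := (⟨Ub, j' w, hb⟩ : ξ.RegPt z).pt) (Subtype.ext (j.π_toFun w))
    (Subtype.ext (j'.π_toFun w))
  exact e ▸ T3

end LocalTransport

/-! ### Existence of transport -/

theorem exists_regPt (ξ : CompatSys O O' f) (x : {x : X // x ∉ z}) : ∃ a : ξ.RegPt z, a.pt = x := by
  obtain ⟨U, v, hv⟩ := ξ.exists_mem_cover x.1
  exact ⟨⟨U, v, by rw [hv]; exact x.2⟩, Subtype.ext hv⟩

/-- A continuous section of the projection over a neighbourhood of a regular point. -/
theorem exists_section (hfree : ξ.FreeOutside z) (a : ξ.RegPt z) :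
    ∃ (N : Set (ξ.dom a.U).V) (s : X → (ξ.dom a.U).V), IsOpen N ∧ a.v ∈ N ∧
      InjOn (ξ.dom a.U).π N ∧ ContinuousOn s ((ξ.dom a.U).π '' N) ∧
      (∀ v ∈ N, s ((ξ.dom a.U).π v) = v) := by
  obtain ⟨N, hNo, hvN, hinj⟩ := (ξ.dom a.U).exists_injOn (hfree a.U a.v a.notMem)
  have : Nonempty (ξ.dom a.U).V := ⟨a.v⟩
  refine ⟨N, Function.invFunOn (ξ.dom a.U).π N, hNo, hvN, hinj, ?_,
    fun v hv => hinj.leftInvOn_invFunOn hv⟩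
  rintro _ ⟨v, hv, rfl⟩
  refine ContinuousAt.continuousWithinAt ?_
  intro M hM
  rw [hinj.leftInvOn_invFunOn hv] at hM
  have := (ξ.dom a.U).isOpenMap_π.image_mem_nhds (Filter.inter_mem hM (hNo.mem_nhds hv))
  refine Filter.mem_map.2 (Filter.mem_of_superset this ?_)
  rintro _ ⟨u, ⟨huM, huN⟩, rfl⟩
  rw [mem_preimage, hinj.leftInvOn_invFunOn huN]
  exact huM

theorem Transport.congr_path {a b : ξ.RegPt z} {γ δ : Path.Homotopic.Quotient a.pt b.pt} {g : S.G}
    (H : ξ.Transport S c z a b γ g) (h : γ = δ) : ξ.Transport S c z a b δ g := h ▸ H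

/-- Transport exists along every path between regular points. -/
theorem exists_transport (hS : S.Effective) (c : ∀ U, Inj (ξ.cod U) S) (hfree : ξ.FreeOutside z)
    (a b : ξ.RegPt z)
    (γ : Path.Homotopic.Quotient a.pt b.pt) : ∃ g, ξ.Transport S c z a b γ g := by
  suffices h : ∀ {x y : {x : X // x ∉ z}} (γ : Path.Homotopic.Quotient x y) (a b : ξ.RegPt z)
      (ha : a.pt = x) (hb : b.pt = y), ∃ g, ξ.Transport S c z a b (γ.cast ha hb) g by
    simpa using h γ a b rfl rfl
  intro x y γ
  refine Path.Homotopic.Quotient.induction_of_small (P := fun {x y} γ => ∀ (a b : ξ.RegPt z)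
      (ha : a.pt = x) (hb : b.pt = y), ∃ g, ξ.Transport S c z a b (γ.cast ha hb) g) ?_ ?_ γ
  · intro x y w γ δ h1 h2 a b ha hb
    obtain ⟨d, hd⟩ := ξ.exists_regPt y
    obtain ⟨g, hg⟩ := h1 a d ha hd
    obtain ⟨h, hh⟩ := h2 d b hd hb
    subst ha hb hd
    exact ⟨h * g, (hg.trans hh).congr_path c (by simp)⟩
  · intro x
    obtain ⟨a₀, rfl⟩ := ξ.exists_regPt x
    obtain ⟨N, s, hNo, hvN, hinj, hsc, hs⟩ := exists_section hfree a₀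
    refine ⟨Subtype.val ⁻¹' ((ξ.dom a₀.U).π '' N), ?_, ?_⟩
    · exact continuous_subtype_val.continuousAt
        ((ξ.dom a₀.U).isOpenMap_π.image_mem_nhds (hNo.mem_nhds hvN))
    · intro x₁ y₁ γ hγ a b ha hb
      subst ha hb
      have hmem : ∀ t, (γ t).1 ∈ (ξ.dom a₀.U).π '' N := fun t => hγ (mem_range_self t)
      have hπs : ∀ t, (ξ.dom a₀.U).π (s (γ t).1) = (γ t).1 := by
        intro t
        obtain ⟨u, hu, he⟩ := hmem t
        rw [← he, hs u hu]
      let σ : Path (s (γ 0).1) (s (γ 1).1) :=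
        { toFun := fun t => s (γ t).1
          continuous_toFun := hsc.comp_continuous
            (continuous_subtype_val.comp γ.continuous) hmem
          source' := rfl
          target' := rfl }
      have hreg : ∀ t, (ξ.dom a₀.U).π (s (γ t).1) ∉ z := fun t => by rw [hπs]; exact (γ t).2
      have T := Transport.path (S := S) (c := c) (z := z) a₀.U σ hreg (hreg 0) (hreg 1)
      obtain ⟨g, hg⟩ := LocalTransport.exists_of_pt_eq (hS := hS) (c := c)
        (a := a) (b := ⟨a₀.U, s (γ 0).1, hreg 0⟩) (Subtype.ext (by
          change _ = (ξ.dom a₀.U).π (s (γ 0).1)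
          rw [hπs, γ.source]))
      obtain ⟨h, hh⟩ := LocalTransport.exists_of_pt_eq (hS := hS) (c := c)
        (a := ⟨a₀.U, s (γ 1).1, hreg 1⟩) (b := b) (Subtype.ext (by
          change (ξ.dom a₀.U).π (s (γ 1).1) = _
          rw [hπs, γ.target]))
      refine ⟨_, ((hg.transport.trans T).trans hh.transport).congr_path c ?_⟩
      have key : ∀ {x y x' y' : {x : X // x ∉ z}} (hx : x' = x) (hy : y' = y) (p : Path x y)
          (q : Path x' y'), (∀ t, p t = q t) →
          (((Path.Homotopic.Quotient.refl x).cast rfl hx).trans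
            (Path.Homotopic.Quotient.mk q)).trans
            ((Path.Homotopic.Quotient.refl y').cast rfl hy.symm) =
            Path.Homotopic.Quotient.mk p := by
        rintro x y _ _ rfl rfl p q hpq
        have : p = q := Path.ext (funext hpq)
        subst this
        change ((Path.Homotopic.Quotient.refl _).trans _).trans (Path.Homotopic.Quotient.refl _) = _
        rw [Path.Homotopic.Quotient.trans_refl, Path.Homotopic.Quotient.refl_trans]
      exact key _ hh.pt_eq γ _ fun t => Subtype.ext (hπs t).symm

end CompatSys

end Transport

/-! ### Uniqueness of transport -/

namespace CompatSys

section Covering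

variable {n n' : ℕ} {X X' : Type*} [TopologicalSpace X] [TopologicalSpace X']
  {O : OrbStruct n X} {O' : OrbStruct n' X'} {f : X → X'} {ξ : CompatSys O O' f}
  {S : UnifSys n' X'} {z : Set X} (hS : S.Effective) (c : ∀ U, Inj (ξ.cod U) S)
  (hO : O.Reduced) (hfree : ξ.FreeOutside z)

open Classical in
/-- The element of the group which transports `a` to `b`, for regular points over the same point
(and `1` otherwise). -/
noncomputable def localElt (a b : ξ.RegPt z) : S.G :=
  if h : ∃ g, LocalTransport hS c a b g then h.choose else 1

variable {hS c}

include hO hfree in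
theorem LocalTransport.localElt_eq {a b : ξ.RegPt z} {g : S.G} (H : LocalTransport hS c a b g) :
    localElt hS c a b = g := by
  have hex : ∃ g, LocalTransport hS c a b g := ⟨g, H⟩
  rw [localElt, dif_pos hex]
  exact hex.choose_spec.unique hO hfree H

variable (hS c)

theorem localTransport_localElt {a b : ξ.RegPt z} (hab : a.pt = b.pt) :
    LocalTransport hS c a b (localElt hS c a b) := by
  have hex := LocalTransport.exists_of_pt_eq hS c hab
  rw [localElt, dif_pos hex]
  exact hex.choose_spec

/-- A neighbourhood of a regular point on which the projection is injective. -/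
noncomputable def sheet (a : ξ.RegPt z) : Set (ξ.dom a.U).V := (exists_section hfree a).choose

/-- The inverse of the projection on the sheet of a regular point. -/
noncomputable def sheetSection (a : ξ.RegPt z) : X → (ξ.dom a.U).V :=
  (exists_section hfree a).choose_spec.choose

theorem isOpen_sheet (a : ξ.RegPt z) : IsOpen (sheet hfree a) :=
  (exists_section hfree a).choose_spec.choose_spec.1

theorem mem_sheet (a : ξ.RegPt z) : a.v ∈ sheet hfree a :=
  (exists_section hfree a).choose_spec.choose_spec.2.1

theorem injOn_sheet (a : ξ.RegPt z) : InjOn (ξ.dom a.U).π (sheet hfree a) :=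
  (exists_section hfree a).choose_spec.choose_spec.2.2.1

theorem continuousOn_sheetSection (a : ξ.RegPt z) :
    ContinuousOn (sheetSection hfree a) ((ξ.dom a.U).π '' sheet hfree a) :=
  (exists_section hfree a).choose_spec.choose_spec.2.2.2.1

theorem sheetSection_π (a : ξ.RegPt z) {v : (ξ.dom a.U).V} (hv : v ∈ sheet hfree a) :
    sheetSection hfree a ((ξ.dom a.U).π v) = v :=
  (exists_section hfree a).choose_spec.choose_spec.2.2.2.2 v hv

theorem π_sheetSection (a : ξ.RegPt z) {x : X} (hx : x ∈ (ξ.dom a.U).π '' sheet hfree a) :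
    (ξ.dom a.U).π (sheetSection hfree a x) = x := by
  obtain ⟨v, hv, rfl⟩ := hx
  rw [sheetSection_π hfree a hv]

theorem sheetSection_mem (a : ξ.RegPt z) {x : X} (hx : x ∈ (ξ.dom a.U).π '' sheet hfree a) :
    sheetSection hfree a x ∈ sheet hfree a := by
  obtain ⟨v, hv, rfl⟩ := hx
  rwa [sheetSection_π hfree a hv]

open Classical in
/-- The point over `x` in the sheet of `a` (and `a` itself if there is none). -/
noncomputable def sheetPt (a : ξ.RegPt z) (x : {x : X // x ∉ z}) : ξ.RegPt z :=
  if h : x.1 ∈ (ξ.dom a.U).π '' sheet hfree a then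
    ⟨a.U, sheetSection hfree a x.1, by rw [π_sheetSection hfree a h]; exact x.2⟩ else a

theorem sheetPt_eq (a : ξ.RegPt z) {x : {x : X // x ∉ z}}
    (h : x.1 ∈ (ξ.dom a.U).π '' sheet hfree a)
    (h' : (ξ.dom a.U).π (sheetSection hfree a x.1) ∉ z) :
    sheetPt hfree a x = ⟨a.U, sheetSection hfree a x.1, h'⟩ := dif_pos h

theorem sheetPt_pt (a : ξ.RegPt z) {x : {x : X // x ∉ z}}
    (h : x.1 ∈ (ξ.dom a.U).π '' sheet hfree a) : (sheetPt hfree a x).pt = x := by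
  rw [sheetPt_eq hfree a h (by rw [π_sheetSection hfree a h]; exact x.2)]
  exact Subtype.ext (π_sheetSection hfree a h)

include hO in
/-- The transport to the sheet of `b` is locally constant. -/
theorem eventually_localElt {a b : ξ.RegPt z}
    (h : a.pt.1 ∈ (ξ.dom b.U).π '' sheet hfree b) :
    ∀ᶠ v in 𝓝 a.v, ∀ hv : (ξ.dom a.U).π v ∉ z, (ξ.dom a.U).π v ∈ (ξ.dom b.U).π '' sheet hfree b →
      localElt hS c ⟨a.U, v, hv⟩ (sheetPt hfree b ⟨(ξ.dom a.U).π v, hv⟩) =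
        localElt hS c a (sheetPt hfree b a.pt) := by
  have H := localTransport_localElt hS c (a := a) (b := sheetPt hfree b a.pt)
    (sheetPt_pt hfree b h).symm
  have hreg : (ξ.dom b.U).π (sheetSection hfree b a.pt.1) ∉ z := by
    rw [π_sheetSection hfree b h]; exact a.pt.2
  generalize localElt hS c a (sheetPt hfree b a.pt) = g at H ⊢
  rw [sheetPt_eq hfree b h hreg] at H
  filter_upwards [H.eventually (N := sheet hfree b)
    ((isOpen_sheet hfree b).mem_nhds (sheetSection_mem hfree b h)) (injOn_sheet hfree b)]
    with v hev hv hvb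
  have hreg' : (ξ.dom b.U).π (sheetSection hfree b ((ξ.dom a.U).π v)) ∉ z := by
    rw [π_sheetSection hfree b hvb]; exact hv
  rw [sheetPt_eq hfree b hvb hreg']
  exact LocalTransport.localElt_eq hO hfree
    (hev hv _ hreg' (sheetSection_mem hfree b hvb) (π_sheetSection hfree b hvb))

include hO hfree in
theorem localElt_mul {a b d : ξ.RegPt z} (hab : a.pt = b.pt) (hbd : b.pt = d.pt) :
    localElt hS c b d * localElt hS c a b = localElt hS c a d :=
  (((localTransport_localElt hS c hab).trans hO hfree
    (localTransport_localElt hS c hbd)).localElt_eq hO hfree).symm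

variable [TopologicalSpace S.G] [DiscreteTopology S.G]

/-- The principal bundle with discrete fibre `G` over the complement of `z` whose transition
functions are the local transports between sheets. It is a covering space, the monodromy of which
is the transport. -/
noncomputable def transportCore :
    FiberBundleCore (ξ.RegPt z) {x : X // x ∉ z} S.G where
  baseSet a := Subtype.val ⁻¹' ((ξ.dom a.U).π '' sheet hfree a)
  isOpen_baseSet a :=
    ((ξ.dom a.U).isOpenMap_π _ (isOpen_sheet hfree a)).preimage continuous_subtype_val
  indexAt x := (ξ.exists_regPt x).choose
  mem_baseSet_at x := by
    have h := congrArg Subtype.val (ξ.exists_regPt x).choose_spec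
    exact ⟨_, mem_sheet hfree _, h⟩
  coordChange a b x g := localElt hS c (sheetPt hfree a x) (sheetPt hfree b x) * g
  coordChange_self a x _ g := by
    rw [(LocalTransport.refl hO hfree (sheetPt hfree a x)).localElt_eq hO hfree, one_mul]
  continuousOn_coordChange a b := by
    rintro ⟨x, g⟩ ⟨⟨hxa, hxb⟩, -⟩
    have hxa' : x.1 ∈ (ξ.dom a.U).π '' sheet hfree a := hxa
    have hxb' : x.1 ∈ (ξ.dom b.U).π '' sheet hfree b := hxb
    have hreg : (ξ.dom a.U).π (sheetSection hfree a x.1) ∉ z := by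
      rw [π_sheetSection hfree a hxa']; exact x.2
    let a' : ξ.RegPt z := ⟨a.U, sheetSection hfree a x.1, hreg⟩
    have ha' : a'.pt = x := Subtype.ext (π_sheetSection hfree a hxa')
    have hev := eventually_localElt hS c hO hfree (a := a') (b := b) (by rw [ha']; exact hxb')
    have hcont : ContinuousAt (fun p : {x : X // x ∉ z} × S.G => sheetSection hfree a p.1.1)
        (x, g) := by
      have h1 : ContinuousAt (sheetSection hfree a) x.1 :=
        (continuousOn_sheetSection hfree a).continuousAt
          (((ξ.dom a.U).isOpenMap_π _ (isOpen_sheet hfree a)).mem_nhds hxa')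
      exact ContinuousAt.comp (f := fun p : {x : X // x ∉ z} × S.G => p.1.1) h1
        (continuous_subtype_val.comp continuous_fst).continuousAt
    have hconst : ContinuousWithinAt
        (fun p : {x : X // x ∉ z} × S.G => localElt hS c a' (sheetPt hfree b a'.pt) * p.2)
        ((Subtype.val ⁻¹' ((ξ.dom a.U).π '' sheet hfree a) ∩
          Subtype.val ⁻¹' ((ξ.dom b.U).π '' sheet hfree b)) ×ˢ univ) (x, g) :=
      ((continuous_of_discreteTopology
        (f := fun h : S.G => localElt hS c a' (sheetPt hfree b a'.pt) * h)).comp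
          continuous_snd).continuousWithinAt
    have heq : ∀ y : {x : X // x ∉ z}, (∀ hv : (ξ.dom a.U).π (sheetSection hfree a y.1) ∉ z,
        (ξ.dom a.U).π (sheetSection hfree a y.1) ∈ (ξ.dom b.U).π '' sheet hfree b →
        localElt hS c ⟨a.U, sheetSection hfree a y.1, hv⟩
          (sheetPt hfree b ⟨(ξ.dom a.U).π (sheetSection hfree a y.1), hv⟩) =
        localElt hS c a' (sheetPt hfree b a'.pt)) →
        y.1 ∈ (ξ.dom a.U).π '' sheet hfree a → y.1 ∈ (ξ.dom b.U).π '' sheet hfree b →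
        localElt hS c (sheetPt hfree a y) (sheetPt hfree b y) =
        localElt hS c a' (sheetPt hfree b a'.pt) := by
      intro y hy hya hyb
      have hπ := π_sheetSection hfree a hya
      have hr : (ξ.dom a.U).π (sheetSection hfree a y.1) ∉ z := by rw [hπ]; exact y.2
      have h2 := hy hr (by rw [hπ]; exact hyb)
      have h3 : (⟨(ξ.dom a.U).π (sheetSection hfree a y.1), hr⟩ : {x : X // x ∉ z}) = y :=
        Subtype.ext hπ
      rw [h3] at h2
      rw [sheetPt_eq hfree a hya hr, h2]
    refine hconst.congr_of_eventuallyEq ?_ ?_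
    · filter_upwards [mem_nhdsWithin_of_mem_nhds (hcont.eventually hev), self_mem_nhdsWithin]
        with p hp hps
      rw [heq p.1 hp hps.1.1 hps.1.2]
    · exact congrArg (· * g) (heq x hev.self_of_nhds hxa' hxb')
  coordChange_comp a b d x hx g := by
    rw [← mul_assoc, localElt_mul hS c hO hfree
      ((sheetPt_pt hfree a hx.1.1).trans (sheetPt_pt hfree b hx.1.2).symm)
      ((sheetPt_pt hfree b hx.1.2).trans (sheetPt_pt hfree d hx.2).symm)]

/-- The point of the covering space with coordinate `h` with respect to the regular point `a`. -/
noncomputable def transportPt (a : ξ.RegPt z) (h : S.G) :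
    (transportCore hS c hO hfree).TotalSpace :=
  ⟨a.pt, (localElt hS c a (sheetPt hfree ((transportCore hS c hO hfree).indexAt a.pt) a.pt) * h :
    S.G)⟩

theorem transportPt_congr {a b : ξ.RegPt z} {g : S.G} (H : LocalTransport hS c a b g) (h : S.G) :
    transportPt hS c hO hfree a h = transportPt hS c hO hfree b (g * h) := by
  have hpt := H.pt_eq
  have hmem := (transportCore hS c hO hfree).mem_baseSet_at b.pt
  have e : localElt hS c a (sheetPt hfree ((transportCore hS c hO hfree).indexAt b.pt) b.pt) * h =
      localElt hS c b (sheetPt hfree ((transportCore hS c hO hfree).indexAt b.pt) b.pt) *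
        (g * h) := by
    rw [← localElt_mul hS c hO hfree hpt (sheetPt_pt hfree _ hmem).symm,
      H.localElt_eq hO hfree, mul_assoc]
  have mk : ∀ {x y : {x : X // x ∉ z}} (u w : S.G), x = y → u = w →
      (⟨x, u⟩ : (transportCore hS c hO hfree).TotalSpace) = ⟨y, w⟩ := by
    rintro x _ u _ rfl rfl; rfl
  refine mk _ _ hpt ?_
  rw [hpt]
  exact e

theorem continuous_transportPt {U : ξ.cover} {v w : (ξ.dom U).V} (σ : Path v w)
    (h : ∀ t, (ξ.dom U).π (σ t) ∉ z) (k : S.G) :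
    Continuous fun t => transportPt hS c hO hfree ⟨U, σ t, h t⟩ k := by
  have hπ : Continuous fun t => (⟨(ξ.dom U).π (σ t), h t⟩ : {x : X // x ∉ z}) :=
    ((ξ.dom U).continuous_π.comp σ.continuous).subtype_mk _
  rw [continuous_iff_continuousAt]
  intro t₀
  rw [FiberBundle.continuousAt_totalSpace]
  refine ⟨hπ.continuousAt, ?_⟩
  set i := (transportCore hS c hO hfree).indexAt ⟨(ξ.dom U).π (σ t₀), h t₀⟩ with hi
  have hmem := (transportCore hS c hO hfree).mem_baseSet_at ⟨(ξ.dom U).π (σ t₀), h t₀⟩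
  have hev := eventually_localElt hS c hO hfree (a := ⟨U, σ t₀, h t₀⟩) (b := i) hmem
  have hnear : ∀ᶠ t in 𝓝 t₀, (⟨(ξ.dom U).π (σ t), h t⟩ : {x : X // x ∉ z}) ∈
      (transportCore hS c hO hfree).baseSet i :=
    hπ.continuousAt ((transportCore hS c hO hfree).isOpen_baseSet i |>.mem_nhds hmem)
  refine (continuousAt_const (y := (localElt hS c ⟨U, σ t₀, h t₀⟩
    (sheetPt hfree i ⟨(ξ.dom U).π (σ t₀), h t₀⟩) * k : S.G))).congr ?_
  filter_upwards [σ.continuous.continuousAt.eventually hev, hnear] with t ht htn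
  have hmem_t := (transportCore hS c hO hfree).mem_baseSet_at ⟨(ξ.dom U).π (σ t), h t⟩
  change _ = localElt hS c (sheetPt hfree
      ((transportCore hS c hO hfree).indexAt ⟨(ξ.dom U).π (σ t), h t⟩) ⟨(ξ.dom U).π (σ t), h t⟩)
      (sheetPt hfree i ⟨(ξ.dom U).π (σ t), h t⟩) * (localElt hS c ⟨U, σ t, h t⟩ (sheetPt hfree
      ((transportCore hS c hO hfree).indexAt ⟨(ξ.dom U).π (σ t), h t⟩)
        ⟨(ξ.dom U).π (σ t), h t⟩) * k)
  have hsheet := sheetPt_pt hfree _ hmem_t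
  have e := localElt_mul hS c hO hfree (a := ⟨U, σ t, h t⟩)
    (b := sheetPt hfree ((transportCore hS c hO hfree).indexAt ⟨(ξ.dom U).π (σ t), h t⟩)
      ⟨(ξ.dom U).π (σ t), h t⟩)
    (d := sheetPt hfree i ⟨(ξ.dom U).π (σ t), h t⟩) hsheet.symm
    (hsheet.trans (sheetPt_pt hfree i htn).symm)
  rw [← mul_assoc, e, ht (h t) htn]
  rfl

theorem transport_lift {a b : ξ.RegPt z} {γ : Path.Homotopic.Quotient a.pt b.pt} {g : S.G}
    (H : ξ.Transport S c z a b γ g) (k : S.G) :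
    ∃ Γ : Path (transportPt hS c hO hfree a k) (transportPt hS c hO hfree b (g * k)),
      Path.Homotopic.Quotient.mk (Γ.map (transportCore hS c hO hfree).continuous_proj) = γ := by
  induction H generalizing k with
  | path U σ h hv hw =>
    refine ⟨{ toFun := fun t => transportPt hS c hO hfree ⟨U, σ t, h t⟩ k
              continuous_toFun := continuous_transportPt hS c hO hfree σ h k
              source' := by simp
              target' := by simp }, rfl⟩
  | hop i v hv hiv g hg =>
    have hτ := ξ.eq_tau hS c hg
    subst hτ
    refine ⟨(Path.refl _).cast rfl (transportPt_congr hS c hO hfree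
      (LocalTransport.hop i hv hiv) k).symm, ?_⟩
    congr 1
  | @symm a b γ g H ih =>
    obtain ⟨Γ, hΓ⟩ := ih (g⁻¹ * k)
    refine ⟨Γ.symm.cast (by rw [mul_inv_cancel_left]) rfl, ?_⟩
    rw [← hΓ]
    exact (congrArg Path.Homotopic.Quotient.mk (Path.ext rfl)).trans
      (Path.Homotopic.Quotient.mk_symm (Γ.map (transportCore hS c hO hfree).continuous_proj))
  | @trans a b d γ δ g h H H' ih ih' =>
    obtain ⟨Γ, hΓ⟩ := ih k
    obtain ⟨Δ, hΔ⟩ := ih' (g * k)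
    refine ⟨(Γ.trans Δ).cast rfl (by rw [mul_assoc]), ?_⟩
    rw [← hΓ, ← hΔ]
    exact (congrArg Path.Homotopic.Quotient.mk
      (Path.map_trans Γ Δ (transportCore hS c hO hfree).continuous_proj)).trans
      (Path.Homotopic.Quotient.mk_trans _ _)

end Covering

/-- The transport along a homotopy class of paths is unique. -/
theorem Transport.unique {n n' : ℕ} {X X' : Type*} [TopologicalSpace X] [TopologicalSpace X']
    {O : OrbStruct n X} {O' : OrbStruct n' X'} {f : X → X'} {ξ : CompatSys O O' f}
    {S : UnifSys n' X'} {z : Set X} {c : ∀ U, Inj (ξ.cod U) S} (hS : S.Effective)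
    (hO : O.Reduced) (hfree : ξ.FreeOutside z) {a b : ξ.RegPt z}
    {γ : Path.Homotopic.Quotient a.pt b.pt} {g h : S.G}
    (H : ξ.Transport S c z a b γ g) (H' : ξ.Transport S c z a b γ h) : g = h := by
  let _ : TopologicalSpace S.G := ⊥
  have : DiscreteTopology S.G := ⟨rfl⟩
  obtain ⟨Γ, hΓ⟩ := transport_lift hS c hO hfree H 1
  obtain ⟨Γ', hΓ'⟩ := transport_lift hS c hO hfree H' 1
  have cov : IsCoveringMap (transportCore hS c hO hfree).proj := FiberBundle.isCoveringMap
  have h1 := cov.monodromy_eq_of_map_eq (γ := γ) (ex := ⟨transportPt hS c hO hfree a 1, rfl⟩)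
    (ey := ⟨transportPt hS c hO hfree b (g * 1), rfl⟩) (Path.Homotopic.Quotient.mk Γ)
    (hΓ.trans (Path.Homotopic.Quotient.cast_rfl_rfl γ).symm)
  have h2 := cov.monodromy_eq_of_map_eq (γ := γ) (ex := ⟨transportPt hS c hO hfree a 1, rfl⟩)
    (ey := ⟨transportPt hS c hO hfree b (h * 1), rfl⟩) (Path.Homotopic.Quotient.mk Γ')
    (hΓ'.trans (Path.Homotopic.Quotient.cast_rfl_rfl γ).symm)
  have h3 : transportPt hS c hO hfree b (g * 1) = transportPt hS c hO hfree b (h * 1) :=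
    congrArg Subtype.val (h1.symm.trans h2)
  have h4 := eq_of_heq (Bundle.TotalSpace.mk.inj h3).2
  rw [mul_one, mul_one] at h4
  exact mul_left_cancel h4

end CompatSys

/-! ### Complements of finite sets in manifolds -/

section Complement

variable {E : Type*} [NormedAddCommGroup E] [InnerProductSpace ℝ E] {M : Type*}
  [TopologicalSpace M] [ChartedSpace E M]

/-- In a manifold of dimension at least two, each point has arbitrarily small open neighbourhoods
the complements in which of a given finite set are path connected. -/
theorem exists_isPathConnected_diff (hE : 1 < Module.rank ℝ E) {F : Set M} (hF : F.Finite)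
    {x : M} {A : Set M} (hA : A ∈ 𝓝 x) :
    ∃ N ⊆ A, IsOpen N ∧ x ∈ N ∧ IsPathConnected (N \ F) := by
  let φ := chartAt E x
  have hx : φ x ∈ φ.target := φ.map_source (mem_chart_source E x)
  have hnear : φ.target ∩ φ.symm ⁻¹' A ∈ 𝓝 (φ x) := by
    refine Filter.inter_mem (φ.open_target.mem_nhds hx)
      ((φ.continuousAt_symm hx).preimage_mem_nhds ?_)
    rwa [φ.left_inv (mem_chart_source E x)]
  obtain ⟨r, hr, hball⟩ := Metric.mem_nhds_iff.1 hnear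
  let β := OpenPartialHomeomorph.univBall (φ x) r
  have hβ : ∀ y, β y ∈ φ.target ∩ φ.symm ⁻¹' A := fun y => hball (by
    rw [← OpenPartialHomeomorph.univBall_target (φ x) hr]
    exact β.map_source (by simp [β, OpenPartialHomeomorph.univBall_source]))
  let ψ : E → M := fun y => φ.symm (β y)
  have hψc : Continuous ψ := φ.continuousOn_symm.comp_continuous
    (OpenPartialHomeomorph.continuous_univBall (φ x) r) fun y => (hβ y).1
  have hβinj : Function.Injective β := fun y y' h =>
    β.injOn (by simp [β, OpenPartialHomeomorph.univBall_source])
      (by simp [β, OpenPartialHomeomorph.univBall_source]) h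
  have hψinj : Function.Injective ψ := fun y y' h =>
    hβinj (φ.symm.injOn (hβ y).1 (hβ y').1 h)
  have hrange : range ψ = φ.symm '' Metric.ball (φ x) r := by
    have : range β = Metric.ball (φ x) r := by
      rw [← OpenPartialHomeomorph.univBall_target (φ x) hr, ← β.image_source_eq_target]
      simp [β, OpenPartialHomeomorph.univBall_source]
    rw [← this, ← range_comp]; rfl
  refine ⟨range ψ, ?_, ?_, ?_, ?_⟩
  · rintro _ ⟨y, rfl⟩
    exact (hβ y).2
  · rw [hrange]
    exact φ.symm.isOpen_image_of_subset_source Metric.isOpen_ball fun y hy => (hball hy).1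
  · rw [hrange]
    exact ⟨φ x, Metric.mem_ball_self hr, φ.left_inv (mem_chart_source E x)⟩
  · have : range ψ \ F = ψ '' (ψ ⁻¹' F)ᶜ := by
      rw [← preimage_compl, image_preimage_eq_inter_range, inter_comm, sdiff_eq]
    rw [this]
    exact ((hF.preimage hψinj.injOn).countable.isPathConnected_compl_of_one_lt_rank hE).image hψc

/-- The complement of a finite set in a connected manifold of dimension at least two is path
connected. -/
theorem isPathConnected_compl_of_finite [ConnectedSpace M] (hE : 1 < Module.rank ℝ E) {F : Set M}
    (hF : F.Finite) : IsPathConnected Fᶜ := by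
  obtain ⟨x₀⟩ : Nonempty M := inferInstance
  obtain ⟨N₀, -, -, -, hN₀⟩ := exists_isPathConnected_diff hE hF (x := x₀) Filter.univ_mem
  obtain ⟨a, haN, haF⟩ := hN₀.nonempty
  have hsub : ∀ N : Set M, N \ F ⊆ Fᶜ := fun N y hy => hy.2
  -- the points near which the complement of `F` is joined to `a`
  let A : Set M := {x | ∃ N, IsOpen N ∧ x ∈ N ∧ ∀ y ∈ N \ F, JoinedIn Fᶜ a y}
  have hAo : IsOpen A := isOpen_iff_mem_nhds.2 fun x ⟨N, hN, hxN, h⟩ =>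
    Filter.mem_of_superset (hN.mem_nhds hxN) fun y hy => ⟨N, hN, hy, h⟩
  have hAc : IsClosed A := by
    refine isClosed_iff_nhds.2 fun x hx => ?_
    obtain ⟨N, -, hNo, hxN, hN⟩ := exists_isPathConnected_diff hE hF (x := x) Filter.univ_mem
    obtain ⟨y, hyN, N', hN'o, hyN', hN'⟩ := hx N (hNo.mem_nhds hxN)
    obtain ⟨B, hB, -, -, hBp⟩ := exists_isPathConnected_diff hE hF (x := y)
      ((hNo.inter hN'o).mem_nhds ⟨hyN, hyN'⟩)
    obtain ⟨w, hwB, hwF⟩ := hBp.nonempty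
    exact ⟨N, hNo, hxN, fun u hu => (hN' w ⟨(hB hwB).2, hwF⟩).trans
      ((hN.joinedIn w ⟨(hB hwB).1, hwF⟩ u hu).mono (hsub N))⟩
  have hAne : a ∈ A := by
    obtain ⟨N, -, hNo, haN, hN⟩ := exists_isPathConnected_diff hE hF (x := a) Filter.univ_mem
    exact ⟨N, hNo, haN, fun y hy => (hN.joinedIn a ⟨haN, haF⟩ y hy).mono (hsub N)⟩
  have hA : A = univ := IsClopen.eq_univ ⟨hAc, hAo⟩ ⟨a, hAne⟩
  refine ⟨a, haF, fun {y} hy => ?_⟩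
  obtain ⟨N, -, hyN, h⟩ : y ∈ A := hA ▸ mem_univ y
  exact h y ⟨hyN, hy⟩

end Complement

theorem UnifSys.finite_preimage {n : ℕ} {X : Type*} [TopologicalSpace X] (S : UnifSys n X)
    {z : Set X} (hz : z.Finite) : (S.π ⁻¹' z).Finite := by
  refine hz.preimage' fun x _ => ?_
  rcases (S.π ⁻¹' {x}).eq_empty_or_nonempty with h | ⟨v, hv⟩
  · rw [h]; exact finite_empty
  · refine (finite_range fun g : S.G => g • v).subset fun w hw => ?_
    exact (S.π_eq_iff v w).1 (hv.trans hw.symm)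

theorem UnifSys.isPathConnected_preimage_compl {X : Type*} [TopologicalSpace X]
    (S : UnifSys 2 X) {z : Set X} (hz : z.Finite) : IsPathConnected (S.π ⁻¹' zᶜ) := by
  rw [preimage_compl]
  refine isPathConnected_compl_of_finite (E := EuclideanSpace ℝ (Fin 2)) ?_ (S.finite_preimage hz)
  exact Module.one_lt_rank_of_one_lt_finrank (by simp)

/-! ### Holonomy and framings -/

/-- A functor from the fundamental groupoid of `Y` to the group `G`. As in `FundamentalGroup`, the
product `h * g` belongs to the path of `g` followed by the path of `h`. -/
structure Holonomy (Y : Type*) [TopologicalSpace Y] (G : Type*) [Group G] where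
  /-- the value on a homotopy class of paths -/
  toFun : ∀ {x y : Y}, Path.Homotopic.Quotient x y → G
  map_trans : ∀ {x y w : Y} (γ : Path.Homotopic.Quotient x y) (δ : Path.Homotopic.Quotient y w),
    toFun (γ.trans δ) = toFun δ * toFun γ

namespace Holonomy

variable {Y : Type*} [TopologicalSpace Y] {G : Type*} [Group G] (H : Holonomy Y G)

@[simp]
theorem map_refl (x : Y) : H.toFun (Path.Homotopic.Quotient.refl x) = 1 := by
  have h := H.map_trans (Path.Homotopic.Quotient.refl x) (Path.Homotopic.Quotient.refl x)
  rw [Path.Homotopic.Quotient.refl_trans] at h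
  exact mul_eq_left.1 h.symm

theorem map_symm {x y : Y} (γ : Path.Homotopic.Quotient x y) :
    H.toFun γ.symm = (H.toFun γ)⁻¹ := by
  have h := H.map_trans γ γ.symm
  rw [Path.Homotopic.Quotient.trans_symm, map_refl] at h
  exact eq_inv_of_mul_eq_one_left h.symm

theorem map_cast {x y x' y' : Y} (γ : Path.Homotopic.Quotient x y) (hx : x' = x) (hy : y' = y) :
    H.toFun (γ.cast hx hy) = H.toFun γ := by
  subst hx hy; rw [Path.Homotopic.Quotient.cast_rfl_rfl]

/-- A homomorphism on the fundamental group extends to the fundamental groupoid. -/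
theorem exists_of_hom [PathConnectedSpace Y] (y₀ : Y) (θ : FundamentalGroup Y y₀ →* G) :
    ∃ H : Holonomy Y G, ∀ γ : Path.Homotopic.Quotient y₀ y₀,
      H.toFun γ = θ (FundamentalGroup.fromPath γ) := by
  classical
  have hmul : ∀ γ δ : Path.Homotopic.Quotient y₀ y₀, θ (FundamentalGroup.fromPath (γ.trans δ)) =
      θ (FundamentalGroup.fromPath δ) * θ (FundamentalGroup.fromPath γ) := fun γ δ =>
    map_mul θ (FundamentalGroup.fromPath δ) (FundamentalGroup.fromPath γ)
  -- paths from the base point, the one to the base point itself being constant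
  obtain ⟨p, hp⟩ : ∃ p : ∀ y, Path.Homotopic.Quotient y₀ y,
      p y₀ = Path.Homotopic.Quotient.refl y₀ := by
    refine ⟨fun y => if h : y = y₀ then (Path.Homotopic.Quotient.refl y₀).cast rfl h else
      Path.Homotopic.Quotient.mk (PathConnectedSpace.somePath y₀ y), ?_⟩
    simp
  refine ⟨⟨fun {x y} γ => θ (FundamentalGroup.fromPath (((p x).trans γ).trans (p y).symm)), ?_⟩, ?_⟩
  · intro x y w γ δ
    rw [← hmul]
    congr 2
    simp only [Path.Homotopic.Quotient.trans_assoc]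
    rw [← Path.Homotopic.Quotient.trans_assoc (p y).symm (p y), Path.Homotopic.Quotient.symm_trans,
      Path.Homotopic.Quotient.refl_trans]
  · intro γ
    simp only [hp, Path.Homotopic.Quotient.refl_trans]
    have : (Path.Homotopic.Quotient.refl y₀).symm = Path.Homotopic.Quotient.refl y₀ := by
      rw [← Path.Homotopic.Quotient.refl_trans (Path.Homotopic.Quotient.refl y₀).symm,
        Path.Homotopic.Quotient.trans_symm]
    rw [this, Path.Homotopic.Quotient.trans_refl]

end Holonomy

/-- A map into the image of an open set on which the projection is injective lifts. -/
theorem UnifSys.exists_lift {n : ℕ} {X Y : Type*} [TopologicalSpace X] [TopologicalSpace Y]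
    (S : UnifSys n X) {N : Set S.V} (hN : IsOpen N) (hinj : InjOn S.π N) {γ : Y → X}
    (hγc : Continuous γ) (hγ : ∀ t, γ t ∈ S.π '' N) :
    ∃ σ : Y → S.V, Continuous σ ∧ ∀ t, σ t ∈ N ∧ S.π (σ t) = γ t := by
  choose σ hσN hσ using hγ
  refine ⟨σ, ?_, fun t => ⟨hσN t, hσ t⟩⟩
  rw [continuous_iff_continuousAt]
  intro t A hA
  have h1 : S.π '' (A ∩ N) ∈ 𝓝 (γ t) := by
    rw [← hσ t]
    exact S.isOpenMap_π.image_mem_nhds (Filter.inter_mem hA (hN.mem_nhds (hσN t)))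
  refine Filter.mem_map.2 ?_
  filter_upwards [hγc.continuousAt.eventually h1]
  rintro s ⟨v, ⟨hvA, hvN⟩, hv⟩
  rwa [mem_preimage, ← hinj hvN (hσN s) (hv.trans (hσ s).symm)]

theorem UnifSys.exists_lift_path {n : ℕ} {X : Type*} [TopologicalSpace X] (S : UnifSys n X)
    {N : Set S.V} (hN : IsOpen N) (hinj : InjOn S.π N) {x y : X} (γ : Path x y)
    (hγ : ∀ t, γ t ∈ S.π '' N) :
    ∃ (v w : S.V) (σ : Path v w), ∀ t, S.π (σ t) = γ t := by
  obtain ⟨σ, hσ, h⟩ := S.exists_lift hN hinj γ.continuous hγ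
  exact ⟨_, _, ⟨⟨σ, hσ⟩, rfl, rfl⟩, fun t => (h t).2⟩

namespace CompatSys

section Framing

variable {n n' : ℕ} {X X' : Type*} [TopologicalSpace X] [TopologicalSpace X']
  {O : OrbStruct n X} {O' : OrbStruct n' X'} {f : X → X'} {ξ : CompatSys O O' f}
  {S : UnifSys n' X'} {z : Set X} {c : ∀ U, Inj (ξ.cod U) S}

/-- A trivialization of the transport of a compatible system up to the holonomy `H`: an element of
the group for each regular point, in terms of which the transport along a class `γ` of paths is
the value of `H` on `γ`. -/
def IsFraming (c : ∀ U, Inj (ξ.cod U) S) (H : Holonomy {x : X // x ∉ z} S.G)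
    (F : ξ.RegPt z → S.G) : Prop :=
  ∀ (a b : ξ.RegPt z) (γ : Path.Homotopic.Quotient a.pt b.pt) (g : S.G),
    ξ.Transport S c z a b γ g → g * F a = F b * H.toFun γ

variable {H : Holonomy {x : X // x ∉ z} S.G} {F : ξ.RegPt z → S.G}

theorem IsFraming.of_generators (hS : S.Effective)
    (hpath : ∀ (U : ξ.cover) {v w : (ξ.dom U).V} (σ : Path v w) (h : ∀ t, (ξ.dom U).π (σ t) ∉ z)
      (hv : (ξ.dom U).π v ∉ z) (hw : (ξ.dom U).π w ∉ z), F ⟨U, v, hv⟩ =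
        F ⟨U, w, hw⟩ * H.toFun (Path.Homotopic.Quotient.mk ((ξ.dom U).projPath σ h hv hw)))
    (hhop : ∀ {U₂ U₁ : ξ.cover} (i : Inj (ξ.dom U₂) (ξ.dom U₁)) (v : (ξ.dom U₂).V)
      (hv : (ξ.dom U₂).π v ∉ z) (hiv : (ξ.dom U₁).π (i v) ∉ z),
      ξ.tau hS c i * F ⟨U₂, v, hv⟩ = F ⟨U₁, i v, hiv⟩) : IsFraming c H F := by
  intro a b γ g T
  induction T with
  | path U σ h hv hw => rw [one_mul]; exact hpath U σ h hv hw
  | hop i v hv hiv g hg =>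
    have hτ := ξ.eq_tau hS c hg
    subst hτ
    rw [hhop i v hv hiv]
    refine (mul_eq_left.2 ?_).symm
    exact (H.map_cast (Path.Homotopic.Quotient.refl _) rfl _).trans (H.map_refl _)
  | symm _ ih =>
    rw [Holonomy.map_symm, inv_mul_eq_iff_eq_mul, ← mul_assoc, ih, mul_inv_cancel_right]
  | trans _ _ ih ih' =>
    rw [Holonomy.map_trans, mul_assoc, ih, ← mul_assoc, ih', mul_assoc]

theorem IsFraming.path (hF : IsFraming c H F) (U : ξ.cover) {v w : (ξ.dom U).V} (σ : Path v w)
    (h : ∀ t, (ξ.dom U).π (σ t) ∉ z) (hv : (ξ.dom U).π v ∉ z) (hw : (ξ.dom U).π w ∉ z) :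
    F ⟨U, v, hv⟩ =
      F ⟨U, w, hw⟩ * H.toFun (Path.Homotopic.Quotient.mk ((ξ.dom U).projPath σ h hv hw)) :=
  (one_mul _).symm.trans (hF _ _ _ _ (Transport.path U σ h hv hw))

theorem IsFraming.hop (hF : IsFraming c H F) (hS : S.Effective) {U₂ U₁ : ξ.cover}
    (i : Inj (ξ.dom U₂) (ξ.dom U₁)) (v : (ξ.dom U₂).V)
    (hv : (ξ.dom U₂).π v ∉ z) (hiv : (ξ.dom U₁).π (i v) ∉ z) :
    ξ.tau hS c i * F ⟨U₂, v, hv⟩ = F ⟨U₁, i v, hiv⟩ := by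
  refine (hF _ _ _ _ (Transport.hop i v hv hiv _ fun y => ξ.tau_apply hS c i y)).trans ?_
  refine mul_eq_left.2 ?_
  exact (H.map_cast (Path.Homotopic.Quotient.refl _) rfl _).trans (H.map_refl _)

/-- A compatible system has a framing as soon as its transport along the loops at one point is
conjugate to the holonomy. -/
theorem exists_framing [PathConnectedSpace {x : X // x ∉ z}] (hS : S.Effective) (hO : O.Reduced)
    (hfree : ξ.FreeOutside z) {z₀ : {x : X // x ∉ z}} {b : ξ.RegPt z} (hb : b.pt = z₀) (k : S.G)
    (h : ∀ γ : Path.Homotopic.Quotient z₀ z₀,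
      ξ.Transport S c z b b (γ.cast hb hb) (k * H.toFun γ * k⁻¹)) :
    ∃ F : ξ.RegPt z → S.G, IsFraming c H F := by
  subst hb
  let p : ∀ a : ξ.RegPt z, Path.Homotopic.Quotient b.pt a.pt := fun a =>
    Path.Homotopic.Quotient.mk (PathConnectedSpace.somePath _ _)
  choose g hg using fun a : ξ.RegPt z => exists_transport hS c hfree b a (p a)
  refine ⟨fun a => g a * k * (H.toFun (p a))⁻¹, fun a a' γ l hl => ?_⟩
  have h1 := ((hg a).trans hl).trans (hg a').symm
  have h2 := h1.unique hS hO hfree ((h _).congr_path c (Path.Homotopic.Quotient.cast_rfl_rfl _))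
  rw [H.map_trans, H.map_trans, H.map_symm] at h2
  have h3 : l * g a = g a' * (k * ((H.toFun (p a'))⁻¹ * (H.toFun γ * H.toFun (p a))) * k⁻¹) := by
    rw [← h2]; group
  rw [← mul_assoc, ← mul_assoc, h3]
  group

/-- The transport of a framed system along loops is conjugate to the holonomy. -/
theorem IsFraming.transport (hF : IsFraming c H F) (hS : S.Effective) (hfree : ξ.FreeOutside z)
    (a b : ξ.RegPt z) (γ : Path.Homotopic.Quotient a.pt b.pt) :
    ξ.Transport S c z a b γ (F b * H.toFun γ * (F a)⁻¹) := by
  obtain ⟨g, hg⟩ := exists_transport hS c hfree a b γ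
  rwa [← hF a b γ g hg, mul_inv_cancel_right]

end Framing

section Comparison

variable {n n' : ℕ} {X X' : Type*} [TopologicalSpace X] [TopologicalSpace X']
  {O : OrbStruct n X} {O' : OrbStruct n' X'} {p : X'} {ξ₁ ξ₂ : CompatSys O O' (fun _ => p)}
  {S : UnifSys n' X'} {z : Set X} {c₁ : ∀ U, Inj (ξ₁.cod U) S} {c₂ : ∀ U, Inj (ξ₂.cod U) S}
  {H₁ H₂ : Holonomy {x : X // x ∉ z} S.G} {F₁ : ξ₁.RegPt z → S.G} {F₂ : ξ₂.RegPt z → S.G}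
  {hS : S.Effective}

/-- The holonomies of two systems which admit a comparison are conjugate. -/
theorem Comparison.exists_conj (D : Comparison hS c₁ c₂) (hO : O.Reduced)
    (hfree : ξ₁.FreeOutside z) (hF₁ : IsFraming c₁ H₁ F₁) (hF₂ : IsFraming c₂ H₂ F₂)
    (z₀ : {x : X // x ∉ z}) :
    ∃ k : S.G, ∀ γ : Path.Homotopic.Quotient z₀ z₀, H₂.toFun γ = k * H₁.toFun γ * k⁻¹ := by
  have hdom₁ : ∀ U, (ξ₁.dom U).Effective := fun U => (ξ₁.dom_belongs U).effective hO
  have hdom₂ : ∀ U, (ξ₂.dom U).Effective := fun U => (ξ₂.dom_belongs U).effective hO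
  have hr₁ : ∀ {W : UnifSys n X} {U₁ : ξ₁.cover} (a₁ : Inj W (ξ₁.dom U₁)) {y : W.V},
      W.π y ∉ z → (ξ₁.dom U₁).π (a₁ y) ∉ z := fun a₁ y hy => by rwa [a₁.π_toFun]
  have hr₂ : ∀ {W : UnifSys n X} {U₂ : ξ₂.cover} (a₂ : Inj W (ξ₂.dom U₂)) {y : W.V},
      W.π y ∉ z → (ξ₂.dom U₂).π (a₂ y) ∉ z := fun a₂ y hy => by rwa [a₂.π_toFun]
  -- the comparison read in the framings
  let K : ∀ (W : UnifSys n X) (U₁ : ξ₁.cover) (U₂ : ξ₂.cover) (_ : Inj W (ξ₁.dom U₁))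
      (_ : Inj W (ξ₂.dom U₂)) (y : W.V), W.π y ∉ z → S.G := fun W U₁ U₂ a₁ a₂ y hy =>
    (F₂ ⟨U₂, a₂ y, hr₂ a₂ hy⟩)⁻¹ * (D.δ W U₁ U₂ a₁ a₂ * F₁ ⟨U₁, a₁ y, hr₁ a₁ hy⟩)
  have K_restrict : ∀ {W' W : UnifSys n X} (b : Inj W' W) {U₁ U₂} (a₁ : Inj W (ξ₁.dom U₁))
      (a₂ : Inj W (ξ₂.dom U₂)) (y : W'.V) (hy : W'.π y ∉ z) (hy' : W.π (b y) ∉ z),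
      K W' U₁ U₂ (a₁.comp b) (a₂.comp b) y hy = K W U₁ U₂ a₁ a₂ (b y) hy' := by
    intro W' W b U₁ U₂ a₁ a₂ y hy hy'
    simp only [K, D.restrict]
    rfl
  have K_left : ∀ {W : UnifSys n X} {U₁ T₁ U₂} (a₁ : Inj W (ξ₁.dom U₁))
      (j : Inj (ξ₁.dom U₁) (ξ₁.dom T₁)) (a₂ : Inj W (ξ₂.dom U₂)) (y : W.V) (hy : W.π y ∉ z),
      K W T₁ U₂ (j.comp a₁) a₂ y hy = K W U₁ U₂ a₁ a₂ y hy := by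
    intro W U₁ T₁ U₂ a₁ j a₂ y hy
    have h1 := hF₁.hop hS j (a₁ y) (hr₁ a₁ hy) (hr₁ (j.comp a₁) hy)
    have h2 : F₁ ⟨T₁, (j.comp a₁) y, hr₁ (j.comp a₁) hy⟩ =
      ξ₁.tau hS c₁ j * F₁ ⟨U₁, a₁ y, hr₁ a₁ hy⟩ := h1.symm
    simp only [K]
    rw [h2, ← D.left W U₁ T₁ U₂ a₁ j a₂, mul_assoc]
  have K_right : ∀ {W : UnifSys n X} {U₁ U₂ T₂} (a₁ : Inj W (ξ₁.dom U₁))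
      (j : Inj (ξ₂.dom U₂) (ξ₂.dom T₂)) (a₂ : Inj W (ξ₂.dom U₂)) (y : W.V) (hy : W.π y ∉ z),
      K W U₁ T₂ a₁ (j.comp a₂) y hy = K W U₁ U₂ a₁ a₂ y hy := by
    intro W U₁ U₂ T₂ a₁ j a₂ y hy
    have h1 := hF₂.hop hS j (a₂ y) (hr₂ a₂ hy) (hr₂ (j.comp a₂) hy)
    have h2 : F₂ ⟨T₂, (j.comp a₂) y, hr₂ (j.comp a₂) hy⟩ =
      ξ₂.tau hS c₂ j * F₂ ⟨U₂, a₂ y, hr₂ a₂ hy⟩ := h1.symm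
    simp only [K]
    rw [h2, D.right W U₁ U₂ T₂ a₁ a₂ j]
    group
  have K_unique : ∀ {W W' : UnifSys n X} {U₁ U₂ U₁' U₂'} (a₁ : Inj W (ξ₁.dom U₁))
      (a₂ : Inj W (ξ₂.dom U₂)) (a₁' : Inj W' (ξ₁.dom U₁')) (a₂' : Inj W' (ξ₂.dom U₂'))
      (y : W.V) (y' : W'.V) (hy : W.π y ∉ z) (hy' : W'.π y' ∉ z), W.π y = W'.π y' →
      K W U₁ U₂ a₁ a₂ y hy = K W' U₁' U₂' a₁' a₂' y' hy' := by
    intro W W' U₁ U₂ U₁' U₂' a₁ a₂ a₁' a₂' y y' hy hy' hyy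
    obtain ⟨R, r, b, b', -, rfl, rfl⟩ :=
      (((ξ₁.dom_belongs U₁).of_inj hO a₁).equivAt hO ((ξ₁.dom_belongs U₁').of_inj hO a₁')
        (W.π_mem y) (hyy ▸ W'.π_mem y')).exists_inj (a₁.effective_source (hdom₁ _))
        (x := y) (y := y') rfl hyy.symm
    have hr : R.π r ∉ z := by rwa [b.π_toFun] at hy
    rw [← K_restrict b a₁ a₂ r hr hy, ← K_restrict b' a₁' a₂' r hr hy']
    obtain ⟨B, s, m, V, l, j, j', rfl, e, e'⟩ :=
      exists_common hO ξ₁ (a₁.comp b) (a₁'.comp b') r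
    have hs : B.π s ∉ z := by rwa [m.π_toFun] at hr
    rw [← K_restrict m _ _ s hs hr, ← K_restrict m _ _ s hs hr, e, e', K_left, K_left]
    obtain ⟨B', s', m', V', l', k, k', rfl, d, d'⟩ :=
      exists_common hO ξ₂ ((a₂.comp b).comp m) ((a₂'.comp b').comp m) s
    have hs' : B'.π s' ∉ z := by rwa [m'.π_toFun] at hs
    rw [← K_restrict m' _ _ s' hs' hs, ← K_restrict m' _ _ s' hs' hs, d, d', K_right, K_right]
    all_goals assumption
  have K_exists : ∀ x ∉ z, ∃ (W : UnifSys n X) (U₁ : ξ₁.cover) (U₂ : ξ₂.cover)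
      (a₁ : Inj W (ξ₁.dom U₁)) (_ : Inj W (ξ₂.dom U₂)) (y : W.V), W.π y = x := by
    intro x hx
    obtain ⟨U₁, v₁, hv₁⟩ := ξ₁.exists_mem_cover x
    obtain ⟨U₂, v₂, hv₂⟩ := ξ₂.exists_mem_cover x
    obtain ⟨R, r, b₁, b₂, -, h1, -⟩ := ((ξ₁.dom_belongs U₁).equivAt hO (ξ₂.dom_belongs U₂)
      ⟨v₁, hv₁⟩ ⟨v₂, hv₂⟩).exists_inj (hdom₁ _) hv₁ hv₂
    exact ⟨R, U₁, U₂, b₁, b₂, r, by rw [← b₁.π_toFun, h1, hv₁]⟩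
  choose W U₁ U₂ a₁ a₂ q hq using K_exists
  let κ : {x : X // x ∉ z} → S.G := fun x =>
    K (W x x.2) _ _ (a₁ x x.2) (a₂ x x.2) (q x x.2) (by rw [hq]; exact x.2)
  have key : ∀ {x y : {x : X // x ∉ z}} (γ : Path.Homotopic.Quotient x y),
      H₂.toFun γ * κ x = κ y * H₁.toFun γ := by
    intro x y γ
    refine Path.Homotopic.Quotient.induction_of_small (P := fun {x y} γ =>
      H₂.toFun γ * κ x = κ y * H₁.toFun γ) ?_ ?_ γ
    · intro x y w γ δ h1 h2
      rw [H₁.map_trans, H₂.map_trans, mul_assoc, h1, ← mul_assoc, h2, mul_assoc]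
    · intro x
      have hfx : ∀ g : (W x x.2).G, g • q x x.2 = q x x.2 → g = 1 := by
        intro g hg
        refine (a₁ x x.2).hom_injective ?_
        rw [map_one]
        refine hfree _ (a₁ x x.2 (q x x.2)) (hr₁ _ (by rw [hq]; exact x.2)) _ ?_
        rw [← (a₁ x x.2).equivariant, hg]
      obtain ⟨N, hN, hyN, hinj⟩ := (W x x.2).exists_injOn hfx
      refine ⟨Subtype.val ⁻¹' ((W x x.2).π '' N), continuous_subtype_val.continuousAt ?_, ?_⟩
      · exact ((W x x.2).isOpenMap_π _ hN).mem_nhds ⟨_, hyN, hq x x.2⟩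
      · intro x' y' γ hγ
        obtain ⟨v, w, σ, hσ⟩ := (W x x.2).exists_lift_path hN hinj
          (γ.map continuous_subtype_val) (fun t => hγ (mem_range_self t))
        have hσ' : ∀ t, (W x x.2).π (σ t) ∉ z := fun t => by
          rw [hσ]; exact (γ t).2
        have hv : (W x x.2).π v = x'.1 := by
          rw [← σ.source, hσ]; simp
        have hw : (W x x.2).π w = y'.1 := by
          rw [← σ.target, hσ]; simp
        have hvz : (W x x.2).π v ∉ z := hv ▸ x'.2
        have hwz : (W x x.2).π w ∉ z := hw ▸ y'.2
        have e1 : κ x' = K _ _ _ (a₁ x x.2) (a₂ x x.2) v hvz :=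
          K_unique _ _ _ _ _ _ (by rw [hq]; exact x'.2) hvz ((hq x' x'.2).trans hv.symm)
        have e2 : κ y' = K _ _ _ (a₁ x x.2) (a₂ x x.2) w hwz :=
          K_unique _ _ _ _ _ _ (by rw [hq]; exact y'.2) hwz ((hq y' y'.2).trans hw.symm)
        have hcast : ∀ {H : Holonomy {x : X // x ∉ z} S.G} {u u' : {x : X // x ∉ z}}
            (q : Path u u') (hu : u = x') (hu' : u' = y'), (∀ t, q t = γ t) →
            H.toFun (Path.Homotopic.Quotient.mk q) =
              H.toFun (Path.Homotopic.Quotient.mk γ) := by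
          rintro H _ _ q rfl rfl h
          rw [show q = γ from Path.ext (funext h)]
        have p1 := hF₁.path _ (σ.map (a₁ x x.2).continuous) (fun t => hr₁ _ (hσ' t))
          (hr₁ (a₁ x x.2) hvz) (hr₁ (a₁ x x.2) hwz)
        have p2 := hF₂.path _ (σ.map (a₂ x x.2).continuous) (fun t => hr₂ _ (hσ' t))
          (hr₂ (a₂ x x.2) hvz) (hr₂ (a₂ x x.2) hwz)
        rw [hcast _ (Subtype.ext (((a₁ x x.2).π_toFun v).trans hv))
          (Subtype.ext (((a₁ x x.2).π_toFun w).trans hw))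
          (fun t => Subtype.ext (((a₁ x x.2).π_toFun (σ t)).trans (hσ t)))] at p1
        rw [hcast _ (Subtype.ext (((a₂ x x.2).π_toFun v).trans hv))
          (Subtype.ext (((a₂ x x.2).π_toFun w).trans hw))
          (fun t => Subtype.ext (((a₂ x x.2).π_toFun (σ t)).trans (hσ t)))] at p2
        rw [e1, e2]
        simp only [K]
        rw [p1, p2]
        group
  exact ⟨κ z₀, fun γ => by rw [← key γ, mul_inv_cancel_right]⟩

end Comparison

/-- Two systems over a surface with the same holonomy admit a comparison: over a connected surface
the framings differ by a constant, as the surface stays connected without the marked points. -/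
theorem IsFraming.comparison {n' : ℕ} {X X' : Type*} [TopologicalSpace X] [TopologicalSpace X']
    {O : OrbStruct 2 X} {O' : OrbStruct n' X'} {p : X'} {ξ₁ ξ₂ : CompatSys O O' (fun _ => p)}
    {S : UnifSys n' X'} {z : Set X} (hz : z.Finite) {c₁ : ∀ U, Inj (ξ₁.cod U) S}
    {c₂ : ∀ U, Inj (ξ₂.cod U) S} {H : Holonomy {x : X // x ∉ z} S.G} {F₁ : ξ₁.RegPt z → S.G}
    {F₂ : ξ₂.RegPt z → S.G} (hS : S.Effective) (hF₁ : IsFraming c₁ H F₁)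
    (hF₂ : IsFraming c₂ H F₂) : Nonempty (Comparison hS c₁ c₂) := by
  have hr₁ : ∀ {W : UnifSys 2 X} {U₁ : ξ₁.cover} (a₁ : Inj W (ξ₁.dom U₁)) {y : W.V},
      W.π y ∉ z → (ξ₁.dom U₁).π (a₁ y) ∉ z := fun a₁ y hy => by rwa [a₁.π_toFun]
  have hr₂ : ∀ {W : UnifSys 2 X} {U₂ : ξ₂.cover} (a₂ : Inj W (ξ₂.dom U₂)) {y : W.V},
      W.π y ∉ z → (ξ₂.dom U₂).π (a₂ y) ∉ z := fun a₂ y hy => by rwa [a₂.π_toFun]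
  have hex : ∀ W : UnifSys 2 X, ∃ y : W.V, W.π y ∉ z := fun W =>
    (W.isPathConnected_preimage_compl hz).nonempty
  choose y hy using hex
  let δ : ∀ (W : UnifSys 2 X) (U₁ : ξ₁.cover) (U₂ : ξ₂.cover), Inj W (ξ₁.dom U₁) →
    Inj W (ξ₂.dom U₂) → S.G := fun W U₁ U₂ a₁ a₂ =>
      F₂ ⟨U₂, a₂ (y W), hr₂ a₂ (hy W)⟩ * (F₁ ⟨U₁, a₁ (y W), hr₁ a₁ (hy W)⟩)⁻¹
  have hδ : ∀ W U₁ U₂ (a₁ : Inj W (ξ₁.dom U₁)) (a₂ : Inj W (ξ₂.dom U₂)) (v : W.V)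
      (hv : W.π v ∉ z), δ W U₁ U₂ a₁ a₂ =
        F₂ ⟨U₂, a₂ v, hr₂ a₂ hv⟩ * (F₁ ⟨U₁, a₁ v, hr₁ a₁ hv⟩)⁻¹ := by
    intro W U₁ U₂ a₁ a₂ v hv
    have hj := (W.isPathConnected_preimage_compl hz).joinedIn (y W) (hy W) v hv
    let σ := hj.somePath
    have hσ : ∀ t, W.π (σ t) ∉ z := hj.somePath_mem
    have p1 := hF₁.path _ (σ.map a₁.continuous) (fun t => hr₁ _ (hσ t)) (hr₁ a₁ (hy W)) (hr₁ a₁ hv)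
    have p2 := hF₂.path _ (σ.map a₂.continuous) (fun t => hr₂ _ (hσ t)) (hr₂ a₂ (hy W)) (hr₂ a₂ hv)
    have hcast : ∀ {u w u' w' : {x : X // x ∉ z}} (q : Path u w) (q' : Path u' w'),
        u = u' → w = w' → (∀ t, q t = q' t) → H.toFun (Path.Homotopic.Quotient.mk q) =
          H.toFun (Path.Homotopic.Quotient.mk q') := by
      rintro u w _ _ q q' rfl rfl h
      rw [show q = q' from Path.ext (funext h)]
    rw [hcast _ (W.projPath σ hσ (hy W) hv) (Subtype.ext (a₁.π_toFun _))
      (Subtype.ext (a₁.π_toFun _)) (fun t => Subtype.ext (a₁.π_toFun _))] at p1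
    rw [hcast _ (W.projPath σ hσ (hy W) hv) (Subtype.ext (a₂.π_toFun _))
      (Subtype.ext (a₂.π_toFun _)) (fun t => Subtype.ext (a₂.π_toFun _))] at p2
    simp only [δ]
    rw [p1, p2]
    group
  refine ⟨⟨δ, ?_, ?_, ?_⟩⟩
  · intro W' W b U₁ U₂ a₁ a₂
    rw [hδ W U₁ U₂ a₁ a₂ (b (y W')) (by rw [b.π_toFun]; exact hy W')]
    rfl
  · intro W U₁ T₁ U₂ a₁ j a₂
    have h1 : _ = F₁ ⟨T₁, (j.comp a₁) (y W), hr₁ (j.comp a₁) (hy W)⟩ :=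
      hF₁.hop hS j (a₁ (y W)) (hr₁ a₁ (hy W)) (hr₁ (j.comp a₁) (hy W))
    simp only [δ]
    rw [← h1]
    group
  · intro W U₁ U₂ T₂ a₁ a₂ j
    have h1 : _ = F₂ ⟨T₂, (j.comp a₂) (y W), hr₂ (j.comp a₂) (hy W)⟩ :=
      hF₂.hop hS j (a₂ (y W)) (hr₂ a₂ (hy W)) (hr₂ (j.comp a₂) (hy W))
    simp only [δ]
    rw [← h1, mul_assoc]

end CompatSys

/-! ### Uniformizing systems adapted to a holonomy -/

namespace UnifSys

section Hol

variable {n : ℕ} {X : Type*} [TopologicalSpace X] {z : Set X} {G : Type*} [Group G]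
  (H : Holonomy {x : X // x ∉ z} G)

/-- The holonomy along the image of a path in the manifold of a uniformizing system. -/
def hol (T : UnifSys n X) {v w : T.V} (σ : Path v w) (h : ∀ t, T.π (σ t) ∉ z) : G :=
  H.toFun (Path.Homotopic.Quotient.mk
    (T.projPath σ h (by simpa using h 0) (by simpa using h 1)))

variable {H}

theorem _root_.Holonomy.toFun_mk_congr (H : Holonomy {x : X // x ∉ z} G)
    {u w u' w' : {x : X // x ∉ z}} (q : Path u w) (q' : Path u' w')
    (h : ∀ t, (q t).1 = (q' t).1) : H.toFun (Path.Homotopic.Quotient.mk q) =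
      H.toFun (Path.Homotopic.Quotient.mk q') := by
  obtain rfl : u = u' := by simpa using Subtype.ext (h 0)
  obtain rfl : w = w' := by simpa using Subtype.ext (h 1)
  rw [show q = q' from Path.ext (funext fun t => Subtype.ext (h t))]

theorem hol_congr {T T' : UnifSys n X} {v w : T.V} {v' w' : T'.V} (σ : Path v w) (σ' : Path v' w')
    (h : ∀ t, T.π (σ t) ∉ z) (h' : ∀ t, T'.π (σ' t) ∉ z) (he : ∀ t, T.π (σ t) = T'.π (σ' t)) :
    T.hol H σ h = T'.hol H σ' h' :=
  H.toFun_mk_congr _ _ he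

theorem hol_trans (T : UnifSys n X) {u v w : T.V} (σ : Path u v) (ρ : Path v w)
    (h : ∀ t, T.π (σ t) ∉ z) (h' : ∀ t, T.π (ρ t) ∉ z) (h'' : ∀ t, T.π (σ.trans ρ t) ∉ z) :
    T.hol H (σ.trans ρ) h'' = T.hol H ρ h' * T.hol H σ h := by
  refine Eq.trans ?_ (H.map_trans _ _)
  refine Eq.trans ?_ (congrArg H.toFun (Path.Homotopic.Quotient.mk_trans _ _))
  refine H.toFun_mk_congr _ _ fun t => ?_
  change T.π ((σ.trans ρ) t) = _
  rw [Path.trans_apply, Path.trans_apply]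
  split_ifs <;> rfl

theorem hol_symm (T : UnifSys n X) {v w : T.V} (σ : Path v w)
    (h : ∀ t, T.π (σ t) ∉ z) (h' : ∀ t, T.π (σ.symm t) ∉ z) :
    T.hol H σ.symm h' = (T.hol H σ h)⁻¹ := by
  refine Eq.trans ?_ (H.map_symm _)
  refine Eq.trans ?_ (congrArg H.toFun (Path.Homotopic.Quotient.mk_symm (T.projPath σ h _ _)))
  exact H.toFun_mk_congr _ _ fun t => rfl

theorem notMem_trans {T : UnifSys n X} {u v w : T.V} {σ : Path u v} {ρ : Path v w}
    (h : ∀ t, T.π (σ t) ∉ z) (h' : ∀ t, T.π (ρ t) ∉ z) (t) : T.π (σ.trans ρ t) ∉ z := by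
  rw [Path.trans_apply]
  split_ifs
  exacts [h _, h' _]

theorem notMem_symm {T : UnifSys n X} {u v : T.V} {σ : Path u v}
    (h : ∀ t, T.π (σ t) ∉ z) (t) : T.π (σ.symm t) ∉ z := h _

variable (H)

/-- The uniformizing system `T` is adapted to the holonomy: over the complement of `z`, it is the
covering associated with the kernel of the holonomy. The path `σ` runs from a point to its image
under `g`, so that it lies over a loop. -/
def IsAdapted (T : UnifSys n X) : Prop :=
  ∀ (g : T.G) (v w : T.V), g • v = w → ∀ (σ : Path v w) (h : ∀ t, T.π (σ t) ∉ z),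
    T.hol H σ h = 1 ↔ g = 1

variable {H}

theorem IsAdapted.of_inj {R T : UnifSys n X} (hT : T.IsAdapted H) (i : Inj R T) :
    R.IsAdapted H := by
  intro g v w hg σ h
  have h' : ∀ t, T.π (σ.map i.continuous t) ∉ z := fun t => by
    rw [Path.map_coe, Function.comp_apply, i.π_toFun]; exact h t
  rw [hol_congr σ (σ.map i.continuous) h h' fun t => (i.π_toFun (σ t)).symm,
    hT (i.hom g) _ _ (by rw [← hg, i.equivariant]) _ h', map_eq_one_iff _ i.hom_injective]

theorem IsAdapted.hol_eq {T : UnifSys n X} (hT : T.IsAdapted H) {v w : T.V} (σ ρ : Path v w)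
    (h : ∀ t, T.π (σ t) ∉ z) (h' : ∀ t, T.π (ρ t) ∉ z) : T.hol H σ h = T.hol H ρ h' := by
  have := (hT 1 v v (one_smul _ v) (σ.trans ρ.symm) (notMem_trans h (notMem_symm h'))).2 rfl
  rw [hol_trans T σ ρ.symm h (notMem_symm h'), hol_symm T ρ h', inv_mul_eq_one] at this
  exact this.symm

end Hol

section Surface

variable {X : Type*} [TopologicalSpace X] {z : Set X} (hz : z.Finite) {G : Type*} [Group G]
  {H : Holonomy {x : X // x ∉ z} G}

include hz

theorem exists_regular_path (T : UnifSys 2 X) {v w : T.V} (hv : T.π v ∉ z) (hw : T.π w ∉ z) :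
    ∃ σ : Path v w, ∀ t, T.π (σ t) ∉ z := by
  have h := (T.isPathConnected_preimage_compl hz).joinedIn v hv w hw
  exact ⟨h.somePath, h.somePath_mem⟩

theorem exists_regular (T : UnifSys 2 X) : ∃ v : T.V, T.π v ∉ z :=
  (T.isPathConnected_preimage_compl hz).nonempty

/-- The covering given by an adapted uniformizing system has trivial holonomy. -/
theorem IsAdapted.exists_frame {T : UnifSys 2 X} (hT : T.IsAdapted H) :
    ∃ F : T.V → G, ∀ {v w : T.V} (σ : Path v w) (h : ∀ t, T.π (σ t) ∉ z),
      F v = F w * T.hol H σ h := by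
  classical
  obtain ⟨u, hu⟩ := T.exists_regular hz
  choose p hp using fun (v : T.V) (hv : T.π v ∉ z) => T.exists_regular_path hz hu hv
  refine ⟨fun v => if hv : T.π v ∉ z then (T.hol H (p v hv) (hp v hv))⁻¹ else 1, ?_⟩
  intro v w σ h
  have hv : T.π v ∉ z := by simpa using h 0
  have hw : T.π w ∉ z := by simpa using h 1
  simp only [dif_pos hv, dif_pos hw]
  have e := hT.hol_eq ((p v hv).trans σ) (p w hw) (notMem_trans (hp v hv) h) (hp w hw)
  rw [hol_trans T _ _ (hp v hv) h] at e
  rw [← e]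
  group

/-- The group of an adapted uniformizing system which fixes a point over `x` embeds into the group
of any adapted uniformizing system around `x`. -/
theorem IsAdapted.card_le {R T : UnifSys 2 X} (hR : R.IsAdapted H) (hT : T.IsAdapted H)
    (hRe : R.Effective) (hfree : ∀ v : T.V, T.π v ∉ z → ∀ g : T.G, g • v = v → g = 1)
    {r : R.V} (hr : ∀ g : R.G, g • r = r) (hrT : R.π r ∈ T.U) : Nat.card R.G ≤ Nat.card T.G := by
  -- a smaller system with the same group over a neighbourhood uniformized by `T`
  obtain ⟨Q, i, q, hQ, hiq, hQT, -⟩ := hRe.exists_restrict r (N := R.π ⁻¹' T.U)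
    (R.continuous_π.continuousAt (T.isOpen_U.mem_nhds hrT))
  have hQad := hR.of_inj i
  have hcard : Nat.card R.G = Nat.card Q.G := by
    refine (Nat.card_congr (Equiv.ofBijective i.hom ⟨i.hom_injective, fun h => ?_⟩)).symm
    obtain ⟨g, -, hg⟩ := i.exists_hom_eq hRe (x := q) (h := h) (by rw [hiq]; exact hr h)
    exact ⟨g, hg⟩
  rw [hcard]
  have hQU : ∀ y : Q.V, Q.π y ∈ T.U := fun y => by rw [← i.π_toFun]; exact hQT y
  have lift : ∀ {x y : {x : X // x ∈ T.U ∧ x ∉ z}} (γ : Path.Homotopic.Quotient x y) (v : T.V),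
      T.π v = x.1 → ∃ (w : T.V) (σ : Path v w) (h : ∀ t, T.π (σ t) ∉ z), T.π w = y.1 ∧
        T.hol H σ h = H.toFun (γ.map ⟨fun u : {x : X // x ∈ T.U ∧ x ∉ z} =>
          (⟨u.1, u.2.2⟩ : {x : X // x ∉ z}), by fun_prop⟩) := by
    intro x y γ
    refine Path.Homotopic.Quotient.induction_of_small (P := fun {x y} γ => ∀ (v : T.V),
      T.π v = x.1 → ∃ (w : T.V) (σ : Path v w) (h : ∀ t, T.π (σ t) ∉ z), T.π w = y.1 ∧
        T.hol H σ h = H.toFun (γ.map ⟨fun u : {x : X // x ∈ T.U ∧ x ∉ z} =>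
          (⟨u.1, u.2.2⟩ : {x : X // x ∉ z}), by fun_prop⟩)) ?_ ?_ γ
    · intro x y u γ δ h1 h2 v hv
      obtain ⟨w, σ, h, hw, hσ⟩ := h1 v hv
      obtain ⟨w', σ', h', hw', hσ'⟩ := h2 w hw
      refine ⟨w', σ.trans σ', notMem_trans h h', hw', ?_⟩
      rw [hol_trans T σ σ' h h', hσ, hσ', ← H.map_trans]
      induction γ using Path.Homotopic.Quotient.ind
      induction δ using Path.Homotopic.Quotient.ind
      exact congrArg H.toFun (congrArg Path.Homotopic.Quotient.mk (Path.map_trans _ _ _).symm)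
    · rintro ⟨x, ⟨v₀, rfl⟩, hx⟩
      obtain ⟨N, hN, hvN, hinj⟩ := T.exists_injOn (hfree v₀ hx)
      refine ⟨Subtype.val ⁻¹' (T.π '' N), continuous_subtype_val.continuousAt
        (T.isOpenMap_π.image_mem_nhds (hN.mem_nhds hvN)), ?_⟩
      intro x' y' γ hγ v hv
      obtain ⟨u, w, σ, hσ⟩ := T.exists_lift_path hN hinj
          (γ.map continuous_subtype_val) (fun t => hγ (mem_range_self t))
      have hu : T.π u = x'.1 := by rw [← σ.source, hσ]; simp
      have hw : T.π w = y'.1 := by rw [← σ.target, hσ]; simp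
      obtain ⟨g, rfl⟩ := (T.π_eq_iff u v).1 (hu.trans hv.symm)
      have hgσ : ∀ t, T.π (σ.map (T.continuous_smul g) t) = (γ t).1 := fun t => by
        rw [Path.map_coe, Function.comp_apply, T.π_smul, hσ]; rfl
      refine ⟨g • w, σ.map (T.continuous_smul g), fun t => by rw [hgσ]; exact (γ t).2.2,
        by rw [T.π_smul, hw], ?_⟩
      exact H.toFun_mk_congr _ _ hgσ
  obtain ⟨v₁, hv₁⟩ := Q.exists_regular hz
  obtain ⟨v₂, hv₂⟩ := hQU v₁
  choose p hp using fun g : Q.G => Q.exists_regular_path hz hv₁ (w := g • v₁)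
    (by rw [Q.π_smul]; exact hv₁)
  have hφ : ∀ g : Q.G, ∃ (h : T.G) (σ : Path v₂ (h • v₂)) (hσ : ∀ t, T.π (σ t) ∉ z),
      T.hol H σ hσ = Q.hol H (p g) (hp g) := by
    intro g
    let γ : Path (⟨Q.π v₁, hQU v₁, hv₁⟩ : {x : X // x ∈ T.U ∧ x ∉ z})
        ⟨Q.π (g • v₁), hQU _, by rw [Q.π_smul]; exact hv₁⟩ :=
      { toFun := fun t => ⟨Q.π (p g t), hQU _, hp g t⟩
        continuous_toFun := (Q.continuous_π.comp (p g).continuous).subtype_mk _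
        source' := by simp
        target' := by simp }
    obtain ⟨w, σ, h, hw, hσ⟩ := lift (Path.Homotopic.Quotient.mk γ) v₂ hv₂
    obtain ⟨k, rfl⟩ := (T.π_eq_iff v₂ w).1 (hv₂.trans ((hw.trans (Q.π_smul g v₁)).symm))
    exact ⟨k, σ, h, hσ⟩
  choose φ σ hσ hσp using hφ
  refine Nat.card_le_card_of_injective φ fun g g' hgg => ?_
  have e : Q.hol H (p g) (hp g) = Q.hol H (p g') (hp g') := by
    have key : ∀ {h h' : T.G} (ρ : Path v₂ (h • v₂)) (ρ' : Path v₂ (h' • v₂))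
        (k : ∀ t, T.π (ρ t) ∉ z) (k' : ∀ t, T.π (ρ' t) ∉ z), h = h' →
        T.hol H ρ k = T.hol H ρ' k' := by
      rintro h _ ρ ρ' k k' rfl
      exact hT.hol_eq ρ ρ' k k'
    exact (hσp g).symm.trans ((key _ _ (hσ g) (hσ g') hgg).trans (hσp g'))
  have := (hQad (g' * g⁻¹) (g • v₁) (g' • v₁) (by rw [mul_smul, inv_smul_smul])
    ((p g).symm.trans (p g')) (notMem_trans (notMem_symm (hp g)) (hp g'))).1 (by
      rw [hol_trans Q _ _ (notMem_symm (hp g)) (hp g'), hol_symm Q _ (hp g), e, mul_inv_cancel])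
  exact (mul_inv_eq_one.1 this).symm

end Surface

end UnifSys

/-! ### Orbifold structures and compatible systems from adapted covers -/

section ConstantMap

variable {n n' : ℕ} {X X' : Type*} [TopologicalSpace X] [TopologicalSpace X']
  {O : OrbStruct n X} {O' : OrbStruct n' X'} {p : X'}

/-- The constant lifting of a constant map. -/
def LocalLift.const (T : UnifSys n X) (S : UnifSys n' X') {x₀ : S.V} (hx₀ : S.π x₀ = p) :
    LocalLift T S (fun _ => p) where
  toFun _ := x₀
  smooth := contMDiff_const
  π_toFun _ := hx₀
  equivariant _ := ⟨1, fun _ => one_smul _ _⟩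

/-- All liftings of a constant map are locally equivalent. -/
theorem LocalLift.equivAt_of_const {S₁ S₂ : UnifSys n X} {T₁ T₂ : UnifSys n' X'}
    (F₁ : LocalLift S₁ T₁ (fun _ => p)) (F₂ : LocalLift S₂ T₂ (fun _ => p)) {q : X}
    (hS : UnifSys.EquivAt q S₁ S₂) (hT : UnifSys.EquivAt p T₁ T₂) (hTe : T₁.Effective) :
    F₁.EquivAt q F₂ := by
  obtain ⟨R, hq, ⟨a₁⟩, ⟨a₂⟩⟩ := hS
  obtain ⟨y⟩ : Nonempty R.V := inferInstance
  obtain ⟨R', r, b₁, b₂, -, h1, h2⟩ := hT.exists_inj hTe (F₁.π_toFun (a₁ y)) (F₂.π_toFun (a₂ y))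
  have hr : R'.π r = p := by rw [← b₁.π_toFun, h1, F₁.π_toFun]
  exact ⟨R, R', a₁, a₂, b₁, b₂, LocalLift.const R R' hr, hq, fun x =>
    ⟨(F₁.apply_eq _ _).trans h1.symm, (F₂.apply_eq _ _).trans h2.symm⟩⟩

theorem LocalLift.mem_U {T : UnifSys n X} {S : UnifSys n' X'} (F : LocalLift T S (fun _ => p)) :
    p ∈ S.U := by
  obtain ⟨y⟩ : Nonempty T.V := inferInstance
  exact ⟨F y, F.π_toFun y⟩

/-- A constant map of reduced orbifolds has only one smooth structure. -/
theorem SmoothLift.equiv_of_const (hO : O.Reduced) (hO' : O'.Reduced)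
    (L₁ L₂ : SmoothLift O O' (fun _ => p)) : L₁.Equiv L₂ := fun x =>
  LocalLift.equivAt_of_const _ _
    ((L₁.src_belongs x).equivAt hO (L₂.src_belongs x) (L₁.mem_src x) (L₂.mem_src x))
    ((L₁.tgt_belongs x).equivAt hO' (L₂.tgt_belongs x) (L₁.lift x).mem_U (L₂.lift x).mem_U)
    ((L₁.tgt_belongs x).effective hO')

theorem CompatSys.isSystemOf_of_const (hO : O.Reduced) (hO' : O'.Reduced)
    (ξ : CompatSys O O' (fun _ => p)) (L : SmoothLift O O' (fun _ => p)) : ξ.IsSystemOf L :=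
  fun U x hx => LocalLift.equivAt_of_const _ _
    ((ξ.dom_belongs U).equivAt hO (L.src_belongs x) (by rwa [ξ.dom_U]) (L.mem_src x))
    ((ξ.cod_belongs U).equivAt hO' (L.tgt_belongs x) (ξ.lift U).mem_U (L.lift x).mem_U)
    ((ξ.cod_belongs U).effective hO')

/-- The constant map, with constant liftings into a given uniformizing system. -/
def SmoothLift.const (O : OrbStruct n X) {S : UnifSys n' X'} (hSb : O'.Belongs S)
    (hS : S.Effective) {x₀ : S.V} (hx₀ : S.π x₀ = p) : SmoothLift O O' (fun _ => p) where
  src := O.chart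
  tgt _ := S
  src_belongs := O.compat
  tgt_belongs _ := hSb
  mem_src := O.mem_chart
  lift x := LocalLift.const (O.chart x) S hx₀
  compat x q hq := LocalLift.equivAt_of_const _ _ (O.compat x q hq)
    ⟨S, ⟨x₀, hx₀⟩, ⟨Inj.refl S⟩, ⟨Inj.refl S⟩⟩ hS

end ConstantMap

/-- A compatible cover by effective uniformizing systems adapted to a holonomy. -/
structure AdaptedCover {X : Type*} [TopologicalSpace X] {z : Set X} {G : Type*} [Group G]
    (H : Holonomy {x : X // x ∉ z} G) where
  /-- the cover -/
  cover : Set (Set X)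
  /-- the uniformizing system of an element of the cover -/
  dom : cover → UnifSys 2 X
  dom_U : ∀ U : cover, (dom U).U = U
  sUnion_cover : ⋃₀ cover = univ
  dom_inj : ∀ U₂ U₁ : cover, (U₂ : Set X) ⊆ U₁ → Nonempty (Inj (dom U₂) (dom U₁))
  dom_inter : ∀ U₁ U₂ : cover, ∀ x ∈ (U₁ : Set X) ∩ U₂,
    ∃ U₃ : cover, x ∈ (U₃ : Set X) ∧ (U₃ : Set X) ⊆ (U₁ : Set X) ∩ U₂
  effective : ∀ U, (dom U).Effective
  adapted : ∀ U, (dom U).IsAdapted H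

namespace AdaptedCover

variable {X X' : Type*} [TopologicalSpace X] [TopologicalSpace X'] {z : Set X}
  {n' : ℕ} {O' : OrbStruct n' X'} {p : X'} {S : UnifSys n' X'}

theorem exists_mem {G : Type*} [Group G] {H : Holonomy {x : X // x ∉ z} G} (A : AdaptedCover H)
    (x : X) : ∃ U : A.cover, x ∈ (A.dom U).U := by
  have : x ∈ ⋃₀ A.cover := by rw [A.sUnion_cover]; trivial
  obtain ⟨U, hU, hx⟩ := this
  exact ⟨⟨U, hU⟩, by rwa [A.dom_U]⟩

theorem equivAt {G : Type*} [Group G] {H : Holonomy {x : X // x ∉ z} G} (A : AdaptedCover H)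
    {U U' : A.cover} {x : X} (hx : x ∈ (A.dom U).U) (hx' : x ∈ (A.dom U').U) :
    UnifSys.EquivAt x (A.dom U) (A.dom U') := by
  rw [A.dom_U] at hx hx'
  obtain ⟨V, hV, hVU⟩ := A.dom_inter U U' x ⟨hx, hx'⟩
  exact ⟨A.dom V, by rwa [A.dom_U], A.dom_inj V U (hVU.trans inter_subset_left),
    A.dom_inj V U' (hVU.trans inter_subset_right)⟩

/-- The orbifold structure of an adapted cover. -/
noncomputable def orb {G : Type*} [Group G] {H : Holonomy {x : X // x ∉ z} G}
    (A : AdaptedCover H) : OrbStruct 2 X where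
  chart x := A.dom (A.exists_mem x).choose
  mem_chart x := (A.exists_mem x).choose_spec
  compat _ q hq := A.equivAt hq (A.exists_mem q).choose_spec

theorem belongs {G : Type*} [Group G] {H : Holonomy {x : X // x ∉ z} G} (A : AdaptedCover H)
    (U : A.cover) : A.orb.Belongs (A.dom U) :=
  fun q hq => A.equivAt hq (A.exists_mem q).choose_spec

theorem reduced {G : Type*} [Group G] {H : Holonomy {x : X // x ∉ z} G} (A : AdaptedCover H) :
    A.orb.Reduced := fun _ => A.effective _

variable {H : Holonomy {x : X // x ∉ z} S.G} (A : AdaptedCover H) (hz : z.Finite)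

/-- A trivialization of the holonomy over an element of the cover. -/
noncomputable def frame (U : A.cover) : (A.dom U).V → S.G :=
  ((A.adapted U).exists_frame hz).choose

theorem frame_spec (U : A.cover) {v w : (A.dom U).V} (σ : Path v w)
    (h : ∀ t, (A.dom U).π (σ t) ∉ z) :
    A.frame hz U v = A.frame hz U w * (A.dom U).hol H σ h :=
  ((A.adapted U).exists_frame hz).choose_spec σ h

/-- The element of the group by which the trivializations differ along an injection. -/
noncomputable def transition {U₂ U₁ : A.cover} (i : Inj (A.dom U₂) (A.dom U₁)) : S.G :=
  A.frame hz U₁ (i ((A.dom U₂).exists_regular hz).choose) *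
    (A.frame hz U₂ ((A.dom U₂).exists_regular hz).choose)⁻¹

theorem transition_mul_frame {U₂ U₁ : A.cover} (i : Inj (A.dom U₂) (A.dom U₁)) {v : (A.dom U₂).V}
    (hv : (A.dom U₂).π v ∉ z) :
    A.transition hz i * A.frame hz U₂ v = A.frame hz U₁ (i v) := by
  obtain ⟨σ, hσ⟩ := (A.dom U₂).exists_regular_path hz ((A.dom U₂).exists_regular hz).choose_spec hv
  have hσ' : ∀ t, (A.dom U₁).π (σ.map i.continuous t) ∉ z := fun t => by
    rw [Path.map_coe, Function.comp_apply, i.π_toFun]; exact hσ t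
  rw [transition, A.frame_spec hz U₂ σ hσ, A.frame_spec hz U₁ (σ.map i.continuous) hσ',
    hol_congr σ (σ.map i.continuous) hσ hσ' fun t => (i.π_toFun (σ t)).symm]
  group

theorem transition_comp {U₃ U₂ U₁ : A.cover} (j : Inj (A.dom U₂) (A.dom U₁))
    (i : Inj (A.dom U₃) (A.dom U₂)) :
    A.transition hz (j.comp i) = A.transition hz j * A.transition hz i := by
  obtain ⟨v, hv⟩ := (A.dom U₃).exists_regular hz
  have hiv : (A.dom U₂).π (i v) ∉ z := by rwa [i.π_toFun]
  refine mul_right_cancel (b := A.frame hz U₃ v) ?_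
  rw [mul_assoc, A.transition_mul_frame hz i hv, A.transition_mul_frame hz j hiv]
  exact A.transition_mul_frame hz (j.comp i) hv

variable (hSb : O'.Belongs S) {x₀ : S.V} (hx₀ : S.π x₀ = p) (hfix : ∀ g : S.G, g • x₀ = x₀)

/-- The compatible system of the constant map given by an adapted cover: an injection is sent to
the automorphism by which the trivializations of the holonomy differ along it. -/
noncomputable def compatSys : CompatSys A.orb O' (fun _ => p) where
  cover := A.cover
  dom := A.dom
  dom_U := A.dom_U
  dom_belongs := A.belongs
  sUnion_cover := A.sUnion_cover
  dom_inj := A.dom_inj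
  dom_inter := A.dom_inter
  cod _ := S
  cod_belongs _ := hSb
  cod_inj _ _ _ := ⟨Inj.refl S⟩
  cod_inter U₁ _ _ hx := ⟨U₁, hx.1, fun _ hy => ⟨hy, hy⟩⟩
  cod_mono _ _ _ := Subset.rfl
  lift U := LocalLift.const (A.dom U) S hx₀
  lam i := S.aut (A.transition hz i)
  lam_lift _ _ := hfix _
  lam_comp j i := (congrArg S.aut (A.transition_comp hz j i)).trans (S.aut_comp_aut _ _).symm

theorem isFraming_compatSys (hS : S.Effective) :
    CompatSys.IsFraming (ξ := A.compatSys hz hSb hx₀ hfix) (fun _ => Inj.refl S) H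
      (fun a => A.frame hz a.U a.v) := by
  refine CompatSys.IsFraming.of_generators hS ?_ ?_
  · intro U v w σ h hv hw
    exact A.frame_spec hz U σ h
  · intro U₂ U₁ i v hv hiv
    have : CompatSys.tau _ hS (fun _ => Inj.refl S) i = A.transition hz i :=
      ((A.compatSys hz hSb hx₀ hfix).eq_tau hS _ fun y => rfl).symm
    rw [this]
    exact A.transition_mul_frame hz i hv

theorem monomorphic_compatSys (hS : S.Effective) :
    (A.compatSys hz hSb hx₀ hfix).Monomorphic := by
  intro (U : A.cover) _ (g : (A.dom U).G) _ hg
  have h1 : A.transition hz ((A.dom U).aut g) = 1 :=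
    hS _ hg
  obtain ⟨v, hv⟩ := (A.dom U).exists_regular hz
  have hgv : (A.dom U).π (g • v) ∉ z := by rwa [UnifSys.π_smul]
  obtain ⟨σ, hσ⟩ := (A.dom U).exists_regular_path hz hv hgv
  refine (A.adapted U g v (g • v) rfl σ hσ).1 ?_
  have h2 := A.transition_mul_frame hz ((A.dom U).aut g) hv
  rw [h1, one_mul, A.frame_spec hz U σ hσ] at h2
  exact mul_eq_left.1 h2

end AdaptedCover

/-! ### The characteristic of a framed system -/

namespace CompatSys

variable {n' : ℕ} {X X' : Type*} [TopologicalSpace X] [TopologicalSpace X']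
  {O : OrbStruct 2 X} {O' : OrbStruct n' X'} {p : X'} {ξ ξ' : CompatSys O O' (fun _ => p)}
  {S : UnifSys n' X'} {z : Set X} {c : ∀ U, Inj (ξ.cod U) S} {c' : ∀ U, Inj (ξ'.cod U) S}
  {H : Holonomy {x : X // x ∉ z} S.G} {F : ξ.RegPt z → S.G} {F' : ξ'.RegPt z → S.G}
  {x₀ : S.V} {z₀ : {x : X // x ∉ z}} {θ : FundamentalGroup {x : X // x ∉ z} z₀ →* S.G}

theorem IsFraming.iso (hF : IsFraming c H F) (hF' : IsFraming c' H F') (hz : z.Finite)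
    (hO' : O'.Reduced) (hSb : O'.Belongs S) (hx₀ : S.π x₀ = p) (hfix : ∀ g : S.G, g • x₀ = x₀) :
    ξ.Iso ξ' := by
  have hS := hSb.effective hO'
  obtain ⟨D⟩ := hF.comparison hz hS hF'
  exact D.iso hO' hSb hS hx₀ hfix

/-- The characteristic of a framed system is the class of its holonomy. -/
theorem IsFraming.hasCharacteristic (hF : IsFraming c H F) (hS : S.Effective)
    (hfree : ξ.FreeOutside z)
    (hH : ∀ γ : Path.Homotopic.Quotient z₀ z₀, H.toFun γ = θ (FundamentalGroup.fromPath γ))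
    (h : ξ'.Iso ξ) : ξ'.HasCharacteristic S z z₀ (Quotient.mk _ θ) := by
  obtain ⟨b, hb⟩ := ξ.exists_regPt z₀
  refine ⟨ξ, h, c, b, hb, (MulAut.conj (F b)).toMonoidHom.comp θ, Quotient.sound ?_, fun γ => ?_⟩
  · exact ⟨(F b)⁻¹, fun γ => by simp [mul_assoc]⟩
  · have := hF.transport hS hfree b b (γ.cast hb hb)
    rwa [H.map_cast, hH] at this

/-- A system with a given characteristic is isomorphic to one which is framed by the holonomy. -/
theorem HasCharacteristic.exists_framing [PathConnectedSpace {x : X // x ∉ z}] (hO : O.Reduced)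
    (hS : S.Effective) (hfree : ∀ ξ' : CompatSys O O' (fun _ => p), ξ'.FreeOutside z)
    (hH : ∀ γ : Path.Homotopic.Quotient z₀ z₀, H.toFun γ = θ (FundamentalGroup.fromPath γ))
    (h : ξ.HasCharacteristic S z z₀ (Quotient.mk _ θ)) :
    ∃ ξ' : CompatSys O O' (fun _ => p), ξ.Iso ξ' ∧ ∃ (c : ∀ U, Inj (ξ'.cod U) S)
      (F : ξ'.RegPt z → S.G), IsFraming c H F := by
  obtain ⟨ξ', hiso, c, b, hb, θ', hθ', ht⟩ := h
  obtain ⟨k, hk⟩ := Quotient.exact hθ'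
  refine ⟨ξ', hiso, c, CompatSys.exists_framing hS hO (hfree ξ') hb k⁻¹ fun γ => ?_⟩
  have := ht γ
  rwa [show θ' (FundamentalGroup.fromPath γ) = k⁻¹ * H.toFun γ * k⁻¹⁻¹ by
    rw [hH, hk]; group] at this

/-- A framed system has no other characteristic than the class of its holonomy. -/
theorem IsFraming.eq_of_hasCharacteristic [PathConnectedSpace {x : X // x ∉ z}] (hO : O.Reduced)
    (hO' : O'.Reduced) (hSb : O'.Belongs S) (hx₀ : S.π x₀ = p) (hfix : ∀ g : S.G, g • x₀ = x₀)
    (hfree : ∀ ξ' : CompatSys O O' (fun _ => p), ξ'.FreeOutside z) (hF : IsFraming c H F)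
    (hH : ∀ γ : Path.Homotopic.Quotient z₀ z₀, H.toFun γ = θ (FundamentalGroup.fromPath γ))
    {Θ : ConjHom (FundamentalGroup {x : X // x ∉ z} z₀) S.G}
    (h : ξ.HasCharacteristic S z z₀ Θ) : Θ = Quotient.mk _ θ := by
  have hS := hSb.effective hO'
  obtain ⟨θ', rfl⟩ := Quotient.exists_rep Θ
  obtain ⟨H', hH'⟩ := Holonomy.exists_of_hom z₀ θ'
  obtain ⟨ξ', hiso, c', F', hF'⟩ := HasCharacteristic.exists_framing hO hS hfree hH' h
  obtain ⟨D⟩ := hiso.comparison hO' hSb hS hx₀ hfix c c'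
  obtain ⟨k, hk⟩ := D.exists_conj hO (hfree ξ) hF hF' z₀
  have hr : (conjHomSetoid (FundamentalGroup {x : X // x ∉ z} z₀) S.G).r θ θ' := ⟨k, fun γ => by
    have := hk (FundamentalGroup.toPath γ)
    rw [hH, hH'] at this
    exact this⟩
  exact (Quotient.sound hr).symm

end CompatSys

/-! ### Holomorphic maps as local diffeomorphisms -/

section Holomorphic

/-- A holomorphic map with nonzero derivative is a local diffeomorphism. -/
theorem AnalyticAt.isLocalDiffeomorphAt {f : ℂ → ℂ} {w : ℂ} (hf : AnalyticAt ℂ f w)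
    (h : deriv f w ≠ 0) : IsLocalDiffeomorphAt 𝓘(ℝ, ℂ) 𝓘(ℝ, ℂ) ∞ f w := by
  have hev : ∀ᶠ x in 𝓝 w, AnalyticAt ℂ f x ∧ deriv f x ≠ 0 :=
    hf.eventually_analyticAt.and (hf.deriv.continuousAt.eventually_ne h)
  obtain ⟨s, hs, hso, hws⟩ := eventually_nhds_iff.1 hev
  have hd : HasFDerivAt f
      ((ContinuousLinearEquiv.unitsEquivAut ℂ (Units.mk0 _ h) : ℂ ≃L[ℂ] ℂ) : ℂ →L[ℂ] ℂ) w := by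
    refine hf.differentiableAt.hasDerivAt.hasFDerivAt.congr_fderiv ?_
    ext
    simp
  have hc : ContDiffAt ℂ ω f w := hf.contDiffAt
  let Ψ := hc.toOpenPartialHomeomorph f hd (by simp)
  let Φ := Ψ.restrOpen s hso
  have hΦ : ∀ x ∈ Φ.source, x ∈ s := fun x hx => by
    rw [OpenPartialHomeomorph.restrOpen_source] at hx; exact hx.2
  refine ⟨{ toPartialEquiv := Φ.toPartialEquiv
            open_source := Φ.open_source
            open_target := Φ.open_target
            contMDiffOn_toFun := fun x hx =>
              (((hs x (hΦ x hx)).1.contDiffAt.restrict_scalars ℝ).contMDiffAt).contMDiffWithinAt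
            contMDiffOn_invFun := fun y hy => ?_ }, ?_, fun x _ => rfl⟩
  · have hy' := hs _ (hΦ _ (Φ.map_target hy))
    have h1 : ContDiffAt ℂ ω Φ.symm y := Φ.contDiffAt_symm_deriv hy'.2 hy
      hy'.1.differentiableAt.hasDerivAt hy'.1.contDiffAt
    exact (((h1.of_le le_top).restrict_scalars ℝ).contMDiffAt).contMDiffWithinAt
  · change w ∈ Φ.source
    rw [OpenPartialHomeomorph.restrOpen_source]
    exact ⟨hc.mem_toOpenPartialHomeomorph_source hd (by simp), hws⟩

theorem isLocalDiffeomorphAt_pow {m : ℕ} {w : ℂ} (h : w ≠ 0 ∨ m = 1) (hm : m ≠ 0) :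
    IsLocalDiffeomorphAt 𝓘(ℝ, ℂ) 𝓘(ℝ, ℂ) ∞ (fun x : ℂ => x ^ m) w := by
  refine AnalyticAt.isLocalDiffeomorphAt (by fun_prop) ?_
  rw [deriv_pow_field]
  rcases h with h | rfl
  · exact mul_ne_zero (Nat.cast_ne_zero.2 hm) (pow_ne_zero _ h)
  · simp

end Holomorphic

section Charts

variable {C : Type*} [TopologicalSpace C] [ChartedSpace ℂ C]
  {c c' : OpenPartialHomeomorph C ℂ}

theorem contDiffOn_transition (hc : c ∈ IsManifold.maximalAtlas 𝓘(ℂ) ω C)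
    (hc' : c' ∈ IsManifold.maximalAtlas 𝓘(ℂ) ω C) :
    ContDiffOn ℂ ω (c.symm.trans c') (c.symm.trans c').source := by
  have h := StructureGroupoid.compatible_of_mem_maximalAtlas hc hc'
  have h1 := (contDiffGroupoid ω 𝓘(ℂ)).mem_of_eqOnSource h (OpenPartialHomeomorph.eqOnSource_refl _)
  rw [contDiffGroupoid, mem_groupoid_of_pregroupoid] at h1
  have h2 := h1.1
  simp only [contDiffPregroupoid, modelWithCornersSelf_coe, modelWithCornersSelf_coe_symm,
    Function.comp_id, Function.id_comp, preimage_id, range_id, inter_univ] at h2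
  exact h2

theorem analyticAt_transition (hc : c ∈ IsManifold.maximalAtlas 𝓘(ℂ) ω C)
    (hc' : c' ∈ IsManifold.maximalAtlas 𝓘(ℂ) ω C) {x : C} (hx : x ∈ c.source)
    (hx' : x ∈ c'.source) : AnalyticAt ℂ (fun w => c' (c.symm w)) (c x) := by
  have hmem : c x ∈ (c.symm.trans c').source := by
    simp [c.map_source hx, c.left_inv hx, hx']
  exact ((contDiffOn_transition hc hc').contDiffAt
    ((c.symm.trans c').open_source.mem_nhds hmem)).analyticAt

theorem deriv_transition_ne_zero (hc : c ∈ IsManifold.maximalAtlas 𝓘(ℂ) ω C)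
    (hc' : c' ∈ IsManifold.maximalAtlas 𝓘(ℂ) ω C) {x : C} (hx : x ∈ c.source)
    (hx' : x ∈ c'.source) : deriv (fun w => c' (c.symm w)) (c x) ≠ 0 := by
  intro h0
  have h1 := (analyticAt_transition hc hc' hx hx').differentiableAt.hasDerivAt
  have h2 := (analyticAt_transition hc' hc hx' hx).differentiableAt.hasDerivAt
  rw [h0] at h1
  have e : c' (c.symm (c x)) = c' x := by rw [c.left_inv hx]
  have h3 := HasDerivAt.comp (h₂ := fun w => c (c'.symm w)) (h := fun w => c' (c.symm w)) (c x)
    (by simpa only [e] using h2) h1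
  rw [mul_zero] at h3
  have h4 : (fun w => c (c'.symm w)) ∘ (fun w => c' (c.symm w)) =ᶠ[𝓝 (c x)] id := by
    have : (c.symm.trans c').source ∈ 𝓝 (c x) := (c.symm.trans c').open_source.mem_nhds (by
      simp [c.map_source hx, c.left_inv hx, hx'])
    filter_upwards [this] with w hw
    rw [OpenPartialHomeomorph.trans_source] at hw
    simp only [Function.comp_apply, id]
    rw [c'.left_inv hw.2, c.right_inv hw.1]
  exact zero_ne_one ((h3.congr_of_eventuallyEq h4.symm).unique (hasDerivAt_id _))

/-- A holomorphic coordinate may be translated. -/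
theorem trans_sub_mem_maximalAtlas (hc : c ∈ IsManifold.maximalAtlas 𝓘(ℂ) ω C) (a : ℂ) :
    c.trans (Homeomorph.subRight a).toOpenPartialHomeomorph ∈
      IsManifold.maximalAtlas 𝓘(ℂ) ω C := by
  have ht : (Homeomorph.subRight a : ℂ ≃ₜ ℂ).toOpenPartialHomeomorph ∈
      contDiffGroupoid ω 𝓘(ℂ) := by
    rw [contDiffGroupoid, mem_groupoid_of_pregroupoid]
    constructor
    · simp only [contDiffPregroupoid, modelWithCornersSelf_coe, modelWithCornersSelf_coe_symm,
        Function.comp_id, Function.id_comp, preimage_id, range_id, inter_univ]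
      exact (contDiff_id.sub contDiff_const).contDiffOn
    · simp only [contDiffPregroupoid, modelWithCornersSelf_coe, modelWithCornersSelf_coe_symm,
        Function.comp_id, Function.id_comp, preimage_id, range_id, inter_univ]
      exact (contDiff_id.add contDiff_const).contDiffOn
  refine mem_maximalAtlas_iff.2 fun e' he' => ⟨?_, ?_⟩
  · rw [OpenPartialHomeomorph.trans_symm_eq_symm_trans_symm, OpenPartialHomeomorph.trans_assoc]
    exact (contDiffGroupoid ω 𝓘(ℂ)).trans ((contDiffGroupoid ω 𝓘(ℂ)).symm ht)
      (mem_maximalAtlas_iff.1 hc e' he').1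
  · rw [← OpenPartialHomeomorph.trans_assoc]
    exact (contDiffGroupoid ω 𝓘(ℂ)).trans (mem_maximalAtlas_iff.1 hc e' he').2 ht

end Charts

/-! ### Regular points of uniformizing systems of a Riemann surface -/

section Regular

variable {C : Type*} [TopologicalSpace C] [ChartedSpace ℂ C]

/-- The projection of the uniformizing system is a local diffeomorphism at `v`. -/
def UnifSys.IsRegularAt (T : UnifSys 2 C) (v : T.V) : Prop :=
  ∀ c ∈ IsManifold.maximalAtlas 𝓘(ℂ) ω C, T.π v ∈ c.source →
    IsLocalDiffeomorphAt (𝓡 2) 𝓘(ℝ, ℂ) ∞ (fun u => c (T.π u)) v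

variable {S T : UnifSys 2 C}

theorem exists_inj_of_isRegularAt [IsManifold 𝓘(ℂ) ω C] (hS : S.Effective) (hT : T.Effective)
    (hSinj : Function.Injective S.π)
    (hSr : ∀ v, S.IsRegularAt v) {N : Set T.V} (hN : IsOpen N) (hinj : InjOn T.π N)
    (hNr : ∀ v ∈ N, T.IsRegularAt v) (hsub : S.U ⊆ T.π '' N) : Nonempty (Inj S T) := by
  obtain ⟨f, hf, hfN⟩ := T.exists_lift hN hinj S.continuous_π fun v => hsub (S.π_mem v)
  refine ⟨Inj.ofMap hS hT f (fun v w hvw => hSinj ?_) (fun v => ?_) fun v => (hfN v).2⟩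
  · rw [← (hfN v).2, ← (hfN w).2, hvw]
  · have hc := IsManifold.chart_mem_maximalAtlas (I := 𝓘(ℂ)) (n := ω) (S.π v)
    have h1 := hNr _ (hfN v).1 _ hc (by rw [(hfN v).2]; exact mem_chart_source ℂ (S.π v))
    have h2 := hSr v _ hc (mem_chart_source ℂ (S.π v))
    refine isLocalDiffeomorphAt_of_comp h1 hf.continuousAt ?_
    have e : (fun u => chartAt ℂ (S.π v) (T.π u)) ∘ f = fun u => chartAt ℂ (S.π v) (S.π u) :=
      funext fun u => congrArg _ (hfN u).2
    rw [e]
    exact h2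

namespace IsBranchedChart

variable {x : C} {m : ℕ} (h : IsBranchedChart S x m)

include h

theorem ne_zero : m ≠ 0 := by
  obtain ⟨c, -, -, -, -, r, e, χ, -, -, -, -, -, hm, -⟩ := h
  rw [← hm]
  exact Nat.card_pos.ne'

theorem card_eq : Nat.card S.G = m := by
  obtain ⟨c, -, -, -, -, r, e, χ, -, -, -, -, -, hm, -⟩ := h
  exact hm

theorem effective : S.Effective := by
  obtain ⟨c, -, -, -, -, r, e, χ, hr, -, -, he, hχ, -, hact, -⟩ := h
  intro g hg
  have hr2 : ((r / 2 : ℝ) : ℂ) ∈ range e := by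
    rw [he, mem_ball_zero_iff, Complex.norm_real, Real.norm_of_nonneg (half_pos hr).le]
    exact half_lt_self hr
  obtain ⟨v, hv⟩ := hr2
  have h1 := hact g v
  rw [hg, eq_comm, mul_eq_right₀ (by rw [hv]; exact_mod_cast (half_pos hr).ne')] at h1
  exact hχ (by rw [map_one]; exact Units.ext h1)

/-- The centre of a branched chart is a point fixed by the group. -/
theorem exists_center : ∃ v : S.V, S.π v = x ∧ ∀ g : S.G, g • v = v := by
  have hm := h.ne_zero
  obtain ⟨c, -, hx, hcx, hU, r, e, χ, hr, hei, -, he, -, -, hact, hc⟩ := h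
  obtain ⟨v, hv⟩ : (0 : ℂ) ∈ range e := by rw [he]; exact Metric.mem_ball_self hr
  refine ⟨v, c.injOn (hU (S.π_mem v)) hx ?_, fun g => hei ?_⟩
  · rw [hc, hv, hcx, zero_pow hm]
  · rw [hact, hv, mul_zero]

theorem mem_U : x ∈ S.U := by
  obtain ⟨v, hv, -⟩ := h.exists_center
  exact ⟨v, hv⟩

theorem π_injective (hm : m = 1) : Function.Injective S.π := by
  intro v w hvw
  obtain ⟨g, rfl⟩ := (S.π_eq_iff v w).1 hvw
  have := (Nat.card_eq_one_iff_unique.1 (h.card_eq.trans hm)).1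
  rw [Subsingleton.elim g 1, one_smul]

theorem isRegularAt {v : S.V} (hv : S.π v ≠ x ∨ m = 1) :
    S.IsRegularAt v := by
  have hm := h.ne_zero
  obtain ⟨c, hcA, hx, hcx, hU, r, e, χ, hr, hei, hel, he, -, -, hact, hc⟩ := h
  intro c' hc' hv'
  have hvc : S.π v ∈ c.source := hU (S.π_mem v)
  have h1 : IsLocalDiffeomorphAt 𝓘(ℝ, ℂ) 𝓘(ℝ, ℂ) ∞ (fun x : ℂ => x ^ m) (e v) := by
    refine isLocalDiffeomorphAt_pow (hv.imp_left fun hne h0 => hne ?_) hm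
    exact c.injOn hvc hx (by rw [hc, h0, hcx, zero_pow hm])
  have h2 : IsLocalDiffeomorphAt 𝓘(ℝ, ℂ) 𝓘(ℝ, ℂ) ∞ (fun w => c' (c.symm w)) (e v ^ m) := by
    rw [← hc]
    exact (analyticAt_transition hcA hc' hvc hv').isLocalDiffeomorphAt
      (deriv_transition_ne_zero hcA hc' hvc hv')
  have h3 := ((hel v).comp 𝓘(ℝ, ℂ) ℂ h1).comp 𝓘(ℝ, ℂ) ℂ h2
  have e3 : (fun w => c' (c.symm w)) ∘ (fun x : ℂ => x ^ m) ∘ e = fun u => c' (S.π u) := by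
    funext u
    simp only [Function.comp_apply]
    rw [← hc, c.left_inv (hU (S.π_mem u))]
  rw [← e3]
  exact h3

/-- Branched charts of the same order at the same point are equivalent there. If `h` is the change
of the coordinates of the surface, `h(ζ) = ζ u(ζ)`, then `w ↦ w u(w ^ m) ^ (1 / m)` lifts it. -/
theorem equivAt (h' : IsBranchedChart T x m) : UnifSys.EquivAt x S T := by
  have hm := h.ne_zero
  have hSe := h.effective
  have hTe := h'.effective
  obtain ⟨c₁, hc₁, hx₁, hcx₁, hU₁, r₁, e₁, χ₁, hr₁, hei₁, hel₁, he₁, -, -, hact₁, hπ₁⟩ := h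
  obtain ⟨c₂, hc₂, hx₂, hcx₂, hU₂, r₂, e₂, χ₂, hr₂, hei₂, hel₂, he₂, -, -, hact₂, hπ₂⟩ := h'
  let g : ℂ → ℂ := fun w => c₂ (c₁.symm w)
  have hg : AnalyticAt ℂ g 0 := hcx₁ ▸ analyticAt_transition hc₁ hc₂ hx₁ hx₂
  have hg' : deriv g 0 ≠ 0 := hcx₁ ▸ deriv_transition_ne_zero hc₁ hc₂ hx₁ hx₂
  have hg0 : g 0 = 0 := by
    change c₂ (c₁.symm 0) = 0
    rw [show c₁.symm 0 = x by rw [← hcx₁, c₁.left_inv hx₁], hcx₂]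
  let u : ℂ → ℂ := dslope g 0
  have hu : AnalyticAt ℂ u 0 := by
    obtain ⟨s, hs, hso, h0s⟩ := eventually_nhds_iff.1 hg.eventually_analyticAt
    have hd : DifferentiableOn ℂ g s := fun w hw =>
      (hs w hw).differentiableAt.differentiableWithinAt
    exact ((Complex.differentiableOn_dslope (hso.mem_nhds h0s)).2 hd).analyticAt (hso.mem_nhds h0s)
  have hu0 : u 0 ≠ 0 := by rw [show u 0 = deriv g 0 from dslope_same g 0]; exact hg'
  have hgu : ∀ w, g w = w * u w := fun w => by
    have := sub_smul_dslope g 0 w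
    rw [sub_zero, hg0, sub_zero, smul_eq_mul] at this
    exact this.symm
  obtain ⟨a, ha⟩ := IsAlgClosed.exists_pow_nat_eq (u 0) (Nat.pos_of_ne_zero hm)
  have ha0 : a ≠ 0 := fun h0 => hu0 (by rw [← ha, h0, zero_pow hm])
  let ρ : ℂ → ℂ := fun w => a * Complex.exp (Complex.log (u w / u 0) / m)
  have hρ : AnalyticAt ℂ ρ 0 := by
    refine analyticAt_const.mul (AnalyticAt.cexp ?_)
    refine AnalyticAt.div (AnalyticAt.clog (hu.div analyticAt_const hu0) ?_) analyticAt_const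
      (Nat.cast_ne_zero.2 hm)
    simp [hu0]
  have hρm : ∀ w, u w ≠ 0 → ρ w ^ m = u w := by
    intro w hw
    simp only [ρ]
    rw [mul_pow, ha, ← Complex.exp_nat_mul, mul_div_cancel₀ _ (Nat.cast_ne_zero.2 hm),
      Complex.exp_log (div_ne_zero hw hu0), mul_div_cancel₀ _ hu0]
  have hρ0 : ρ 0 = a := by simp [ρ, hu0]
  let φ : ℂ → ℂ := fun w => w * ρ (w ^ m)
  have hpow0 : (0 : ℂ) ^ m = 0 := zero_pow hm
  have hρc : AnalyticAt ℂ (fun w : ℂ => ρ (w ^ m)) 0 := by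
    refine AnalyticAt.fun_comp (g := ρ) (f := fun w : ℂ => w ^ m) ?_ (by fun_prop)
    rw [hpow0]; exact hρ
  have hφ : AnalyticAt ℂ φ 0 := analyticAt_id.mul hρc
  have hφ' : deriv φ 0 ≠ 0 := by
    have h1 := (hasDerivAt_id (0 : ℂ)).mul hρc.differentiableAt.hasDerivAt
    have h2 : HasDerivAt φ a 0 := by
      refine h1.congr_deriv ?_
      simp [hpow0, hρ0]
    rw [h2.deriv]
    exact ha0
  have hφ0 : φ 0 = 0 := zero_mul _
  -- a neighbourhood of `0` on which `φ` lifts the change of coordinates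
  obtain ⟨Φ, hΦ0, hΦ⟩ := hφ.isLocalDiffeomorphAt hφ'
  have hpow : Filter.Tendsto (fun w : ℂ => w ^ m) (𝓝 0) (𝓝 0) := by
    have : ContinuousAt (fun w : ℂ => w ^ m) 0 := by fun_prop
    rwa [ContinuousAt, hpow0] at this
  have hev : ∀ᶠ w in 𝓝 (0 : ℂ), w ∈ Φ.source ∧ φ w ∈ Metric.ball 0 r₂ ∧ u (w ^ m) ≠ 0 ∧
      c₁.symm (w ^ m) ∈ c₂.source := by
    refine Filter.Eventually.and (Φ.open_source.mem_nhds hΦ0) (.and ?_ (.and ?_ ?_))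
    · refine hφ.continuousAt.eventually_mem ?_
      rw [hφ0]
      exact Metric.ball_mem_nhds 0 hr₂
    · exact hpow.eventually (hu.continuousAt.eventually_ne hu0)
    · have h0 : (0 : ℂ) ∈ c₁.target := hcx₁ ▸ c₁.map_source hx₁
      have hsrc : ∀ᶠ w in 𝓝 (0 : ℂ), c₁.symm w ∈ c₂.source := by
        refine (c₁.continuousAt_symm h0).eventually_mem (c₂.open_source.mem_nhds ?_)
        rwa [show c₁.symm 0 = x by rw [← hcx₁, c₁.left_inv hx₁]]
      exact hpow.eventually hsrc
  obtain ⟨v, hv⟩ : (0 : ℂ) ∈ range e₁ := by rw [he₁]; exact Metric.mem_ball_self hr₁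
  have hvx : S.π v = x := c₁.injOn (hU₁ (S.π_mem v)) hx₁ (by rw [hπ₁, hv, hcx₁, hpow0])
  have he₁c : Continuous e₁ := hel₁.contMDiff.continuous
  obtain ⟨R, i, r, hR, hir, hiN, -⟩ := hSe.exists_restrict v
    (he₁c.continuousAt.eventually_mem (by rw [hv]; exact hev))
  have hiN' : ∀ y, e₁ (i y) ∈ Φ.source ∧ φ (e₁ (i y)) ∈ Metric.ball 0 r₂ ∧
    u (e₁ (i y) ^ m) ≠ 0 ∧ c₁.symm (e₁ (i y) ^ m) ∈ c₂.source := hiN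
  have hf : ∀ y : R.V, ∃ w : T.V, e₂ w = φ (e₁ (i y)) := fun y => by
    have := (hiN' y).2.1
    rwa [← he₂] at this
  choose f hf using hf
  have hφd : ∀ y, IsLocalDiffeomorphAt 𝓘(ℝ, ℂ) 𝓘(ℝ, ℂ) ∞ φ (e₁ (i y)) := fun y =>
    ⟨Φ, (hiN' y).1, hΦ⟩
  have hcomp : e₂ ∘ f = φ ∘ e₁ ∘ i := funext hf
  have hld : ∀ y, IsLocalDiffeomorphAt (𝓡 2) 𝓘(ℝ, ℂ) ∞ (e₂ ∘ f) y := fun y => by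
    rw [hcomp]
    exact ((i.localDiffeo y).comp 𝓘(ℝ, ℂ) ℂ (hel₁ (i y))).comp 𝓘(ℝ, ℂ) ℂ (hφd y)
  have hfc : Continuous f := hei₂.continuous_of_comp_isOpenMap hel₂.isOpenMap
    (continuous_iff_continuousAt.2 fun y => (hld y).contMDiffAt.continuousAt)
  refine ⟨R, ⟨r, by rw [← i.π_toFun, hir, hvx]⟩, ⟨i⟩, ⟨Inj.ofMap hR hTe f ?_ ?_ ?_⟩⟩
  · intro y y' hyy
    have h1 : φ (e₁ (i y)) = φ (e₁ (i y')) := by rw [← hf, ← hf, hyy]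
    have h2 := hΦ (hiN' y).1
    have h3 := hΦ (hiN' y').1
    have h4 := Φ.toPartialEquiv.injOn (hiN' y).1 (hiN' y').1 (h2.symm.trans (h1.trans h3))
    exact i.injective (hei₁ h4)
  · exact fun y => isLocalDiffeomorphAt_of_comp (hel₂ _) hfc.continuousAt (hld y)
  · intro y
    have h1 : S.π (i y) ∈ c₁.source := hU₁ (S.π_mem _)
    have h2 : c₁.symm (e₁ (i y) ^ m) = S.π (i y) := by rw [← hπ₁, c₁.left_inv h1]
    refine c₂.injOn (hU₂ (T.π_mem _)) ?_ ?_
    · rw [← i.π_toFun, ← h2]; exact (hiN' y).2.2.2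
    · rw [hπ₂, hf, mul_pow, hρm _ (hiN' y).2.2.1, ← hgu]
      change c₂ (c₁.symm _) = _
      rw [h2, i.π_toFun]

end IsBranchedChart

end Regular

/-! ### Branched discs -/

section Disc

/-- The identification of the model plane with `ℂ`. -/
noncomputable def planeEquiv : EuclideanSpace ℝ (Fin 2) ≃ₗᵢ[ℝ] ℂ :=
  Complex.orthonormalBasisOneI.repr.symm

/-- The open disc of radius `r` about the origin in the model plane. -/
def planeDisc (r : ℝ) : TopologicalSpace.Opens (EuclideanSpace ℝ (Fin 2)) :=
  ⟨Metric.ball 0 r, Metric.isOpen_ball⟩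

/-- The multiplication by a root of unity, as a linear map of the model plane. -/
noncomputable def planeRot {m : ℕ} (g : rootsOfUnity m ℂ) :
    EuclideanSpace ℝ (Fin 2) →L[ℝ] EuclideanSpace ℝ (Fin 2) :=
  (planeEquiv.symm.toContinuousLinearEquiv : ℂ →L[ℝ] EuclideanSpace ℝ (Fin 2)).comp
    ((((g : ℂˣ) : ℂ) • ContinuousLinearMap.id ℝ ℂ).comp
      (planeEquiv.toContinuousLinearEquiv : EuclideanSpace ℝ (Fin 2) →L[ℝ] ℂ))

theorem planeEquiv_planeRot {m : ℕ} (g : rootsOfUnity m ℂ) (v : EuclideanSpace ℝ (Fin 2)) :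
    planeEquiv (planeRot g v) = ((g : ℂˣ) : ℂ) * planeEquiv v := by
  simp [planeRot]

variable {r : ℝ} {m : ℕ}

theorem planeRot_mem [NeZero m] (g : rootsOfUnity m ℂ) {v : EuclideanSpace ℝ (Fin 2)}
    (hv : v ∈ planeDisc r) : planeRot g v ∈ planeDisc r := by
  have h1 : ‖planeRot g v‖ = ‖v‖ := by
    rw [← planeEquiv.norm_map (planeRot g v), planeEquiv_planeRot, norm_mul,
      Complex.norm_eq_one_of_mem_rootsOfUnity g.2, one_mul, planeEquiv.norm_map]
  have h2 : ‖v‖ < r := mem_ball_zero_iff.1 hv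
  exact mem_ball_zero_iff.2 (h1.trans_lt h2)

/-- The action of the roots of unity on a disc. -/
noncomputable abbrev discAction (r : ℝ) (m : ℕ) [NeZero m] :
    MulAction (rootsOfUnity m ℂ) (planeDisc r) where
  smul g v := ⟨planeRot g v, planeRot_mem g v.2⟩
  one_smul v := Subtype.ext (planeEquiv.injective ((planeEquiv_planeRot 1 _).trans (by simp)))
  mul_smul g h v := Subtype.ext (planeEquiv.injective (by
    refine (planeEquiv_planeRot _ _).trans ?_
    refine Eq.trans ?_ (planeEquiv_planeRot g (planeRot h v)).symm
    rw [planeEquiv_planeRot, ← mul_assoc]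
    simp))

variable {C : Type*} [TopologicalSpace C]

/-- The disc of radius `r` over a disc of radius at least `r ^ m` in a coordinate `c` of the
surface, by `w ↦ w ^ m`. -/
noncomputable def discSystem (c : OpenPartialHomeomorph C ℂ) (r : ℝ) (m : ℕ) [NeZero m]
    (hr : 0 < r) (hc : Metric.ball 0 (r ^ m) ⊆ c.target) : UnifSys 2 C :=
  letI := discAction r m
  have hmem : ∀ v : planeDisc r, planeEquiv v.1 ^ m ∈ Metric.ball (0 : ℂ) (r ^ m) := fun v => by
    rw [mem_ball_zero_iff, norm_pow, planeEquiv.norm_map]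
    exact pow_lt_pow_left₀ (mem_ball_zero_iff.1 v.2) (norm_nonneg _) (NeZero.ne m)
  have hsm : ∀ g : rootsOfUnity m ℂ, ContMDiff (𝓡 2) (𝓡 2) ∞ (fun v : planeDisc r => g • v) :=
    fun g v => (ContMDiffAt.subtypeVal_comp_iff (planeDisc r)
      (fun v : planeDisc r => g • v) v).1
        (((planeRot g).contDiff.contMDiff.comp contMDiff_subtype_val) v)
  { V := planeDisc r
    G := rootsOfUnity m ℂ
    connectedV := isConnected_iff_connectedSpace.1
      ⟨⟨0, Metric.mem_ball_self hr⟩, (convex_ball 0 r).isPreconnected⟩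
    smooth_smul := hsm
    codim_two := fun g => by
      by_cases hg : g = 1
      · exact Or.inl fun v => by rw [hg, one_smul]
      refine Or.inr fun x hx => ?_
      have hval := isLocalDiffeomorph_subtype_val (E := EuclideanSpace ℝ (Fin 2)) (planeDisc r)
      set L := modelDeriv 2 (Subtype.val : planeDisc r → EuclideanSpace ℝ (Fin 2)) x with hL
      have hinj : Function.Injective L := (modelDeriv_bijective (hval x)).1
      have e1 : L.comp (modelDeriv 2 (fun y : planeDisc r => g • y) x) =
          (planeRot g).comp L := by
        have a1 := modelDeriv_comp (n := 2)
          (g := (Subtype.val : planeDisc r → EuclideanSpace ℝ (Fin 2)))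
          (f := fun y : planeDisc r => g • y) (x := x) (hval.mdifferentiable (by simp) _)
          ((hsm g).mdifferentiable (by simp) x)
        have a2 := modelDeriv_comp (n := 2) (g := planeRot g)
          (f := (Subtype.val : planeDisc r → EuclideanSpace ℝ (Fin 2))) (x := x)
          (planeRot g).differentiableAt.mdifferentiableAt (hval.mdifferentiable (by simp) x)
        have a3 : (Subtype.val : planeDisc r → EuclideanSpace ℝ (Fin 2)) ∘
          (fun y : planeDisc r => g • y) = planeRot g ∘ Subtype.val := rfl
        have a4 : modelDeriv 2 (planeRot g) x.1 = planeRot g :=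
          (mfderiv_eq_fderiv).trans (planeRot g).fderiv
        rw [hx] at a1
        rw [hL, ← a1, a3, a2, a4]
      have hker : Function.Injective (modelDeriv 2 (fun y : planeDisc r => g • y) x -
          ContinuousLinearMap.id ℝ (EuclideanSpace ℝ (Fin 2))).toLinearMap := by
        refine (injective_iff_map_eq_zero _).2 fun u hu => ?_
        have h1 : modelDeriv 2 (fun y : planeDisc r => g • y) x u = u := sub_eq_zero.1 hu
        have h2 : L u = planeRot g (L u) := by
          refine Eq.trans ?_ (DFunLike.congr_fun e1 u)
          exact congrArg L h1.symm
        have h3 : planeEquiv (L u) = ((g : ℂˣ) : ℂ) * planeEquiv (L u) :=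
          (congrArg planeEquiv h2).trans (planeEquiv_planeRot g _)
        have h4 : planeEquiv (L u) = 0 := by
          by_contra h0
          exact hg (Subtype.ext (Units.ext (mul_eq_right₀ h0 |>.1 h3.symm)))
        refine hinj ((planeEquiv.map_eq_zero_iff.1 h4).trans (map_zero L).symm)
      refine le_of_eq ?_
      refine Eq.trans ?_ (LinearMap.finrank_range_of_inj hker).symm
      simp
    π := fun v => c.symm (planeEquiv v.1 ^ m)
    continuous_π := c.continuousOn_symm.comp_continuous
      ((planeEquiv.continuous.comp continuous_subtype_val).pow m) fun v => hc (hmem v)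
    isOpenMap_π := fun A hA => by
      have h1 : IsOpen ((fun v : planeDisc r => planeEquiv v.1 ^ m) '' A) := by
        have := ((Complex.isOpenQuotientMap_pow m).isOpenMap.comp
          planeEquiv.toHomeomorph.isOpenMap).comp
            (planeDisc r).isOpen.isOpenMap_subtype_val
        exact this A hA
      have h2 := c.symm.isOpen_image_of_subset_source h1 (by
        rintro _ ⟨v, -, rfl⟩
        exact hc (hmem v))
      rwa [image_image] at h2
    π_eq_iff := fun v w => by
      constructor
      · intro h
        have h1 : planeEquiv v.1 ^ m = planeEquiv w.1 ^ m :=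
          c.symm.injOn (hc (hmem v)) (hc (hmem w)) h
        by_cases h0 : planeEquiv v.1 = 0
        · rw [h0, zero_pow (NeZero.ne m), eq_comm, pow_eq_zero_iff (NeZero.ne m)] at h1
          refine ⟨1, ?_⟩
          rw [one_smul]
          exact Subtype.ext (planeEquiv.injective (h0.trans h1.symm))
        · have hw0 : planeEquiv w.1 ≠ 0 := fun hw => h0 (by
            rwa [hw, zero_pow (NeZero.ne m), pow_eq_zero_iff (NeZero.ne m)] at h1)
          refine ⟨⟨Units.mk0 (planeEquiv w.1 / planeEquiv v.1) (div_ne_zero hw0 h0), ?_⟩,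
            Subtype.ext (planeEquiv.injective ?_)⟩
          · rw [mem_rootsOfUnity]
            refine Units.ext ?_
            rw [Units.val_pow_eq_pow_val, Units.val_mk0, div_pow, h1, div_self (pow_ne_zero m hw0),
              Units.val_one]
          · refine (planeEquiv_planeRot _ v.1).trans ?_
            exact div_mul_cancel₀ _ h0
      · rintro ⟨g, rfl⟩
        have h1 : planeEquiv (g • v).1 = ((g : ℂˣ) : ℂ) * planeEquiv v.1 :=
          planeEquiv_planeRot g v.1
        have h2 : ((g : ℂˣ) : ℂ) ^ m = 1 := by
          have := (mem_rootsOfUnity m (g : ℂˣ)).1 g.2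
          rw [← Units.val_pow_eq_pow_val, this, Units.val_one]
        rw [h1, mul_pow, h2, one_mul] }

variable {c : OpenPartialHomeomorph C ℂ} [NeZero m] (hr : 0 < r)
  (hc : Metric.ball 0 (r ^ m) ⊆ c.target)

/-- The coordinate of a branched disc. -/
noncomputable def discCoord (v : (discSystem c r m hr hc).V) : ℂ :=
  planeEquiv (v : planeDisc r).1

theorem discSystem_π (v : (discSystem c r m hr hc).V) :
    (discSystem c r m hr hc).π v = c.symm (discCoord hr hc v ^ m) := rfl

theorem norm_discCoord_lt (v : (discSystem c r m hr hc).V) : ‖discCoord hr hc v‖ < r := by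
  rw [discCoord, planeEquiv.norm_map]
  exact mem_ball_zero_iff.1 (v : planeDisc r).2

theorem discCoord_pow_mem (v : (discSystem c r m hr hc).V) :
    discCoord hr hc v ^ m ∈ Metric.ball (0 : ℂ) (r ^ m) := by
  rw [mem_ball_zero_iff, norm_pow]
  exact pow_lt_pow_left₀ (norm_discCoord_lt hr hc v) (norm_nonneg _) (NeZero.ne m)

theorem continuous_discCoord : Continuous (discCoord hr hc) :=
  planeEquiv.continuous.comp continuous_subtype_val

/-- The inclusion of the group of a branched disc into the units of `ℂ`. -/
def discChar : (discSystem c r m hr hc).G →* ℂˣ := (rootsOfUnity m ℂ).subtype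

theorem discChar_injective : Function.Injective (discChar hr hc) := Subtype.val_injective

theorem discChar_mem (g : (discSystem c r m hr hc).G) : discChar hr hc g ∈ rootsOfUnity m ℂ :=
  Subtype.prop (p := fun u => u ∈ rootsOfUnity m ℂ) g

theorem discCoord_smul (g : (discSystem c r m hr hc).G) (v : (discSystem c r m hr hc).V) :
    discCoord hr hc (g • v) = (discChar hr hc g : ℂ) * discCoord hr hc v :=
  planeEquiv_planeRot (m := m) g (v : planeDisc r).1

theorem mem_U_discSystem {x : C} (hx : x ∈ (discSystem c r m hr hc).U) :
    x ∈ c.source ∧ c x ∈ Metric.ball (0 : ℂ) (r ^ m) := by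
  obtain ⟨v, rfl⟩ := hx
  have h := discCoord_pow_mem hr hc v
  rw [discSystem_π]
  exact ⟨c.map_target (hc h), by rwa [c.right_inv (hc h)]⟩

theorem isBranchedChart_discSystem [ChartedSpace ℂ C]
    (hcA : c ∈ IsManifold.maximalAtlas 𝓘(ℂ) ω C) {x : C} (hx : x ∈ c.source) (hcx : c x = 0) :
    IsBranchedChart (discSystem c r m hr hc) x m := by
  refine ⟨c, hcA, hx, hcx, fun y hy => (mem_U_discSystem hr hc hy).1, r, discCoord hr hc,
    discChar hr hc, hr, ?_, ?_, ?_, discChar_injective hr hc,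
    Complex.card_rootsOfUnity m, fun g v => discCoord_smul hr hc g v, fun v => ?_⟩
  · exact planeEquiv.injective.comp Subtype.val_injective
  · intro v
    exact (isLocalDiffeomorph_subtype_val (E := EuclideanSpace ℝ (Fin 2)) (planeDisc r) v).comp
      𝓘(ℝ, ℂ) ℂ (planeEquiv.toContinuousLinearEquiv.toDiffeomorph.isLocalDiffeomorph _)
  · ext w
    rw [mem_ball_zero_iff]
    constructor
    · rintro ⟨v, rfl⟩
      exact norm_discCoord_lt hr hc v
    · intro hw
      exact ⟨(⟨planeEquiv.symm w, mem_ball_zero_iff.2 (by rwa [planeEquiv.symm.norm_map])⟩ :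
        planeDisc r), planeEquiv.apply_symm_apply w⟩
  · rw [discSystem_π, c.right_inv (hc (discCoord_pow_mem hr hc v))]

end Disc

/-! ### The holonomy around a marked point -/

section Puncture

/-- A uniformizing system with trivial group and simply connected manifold over the complement of
the marked points is adapted to every holonomy. -/
theorem UnifSys.IsAdapted.of_simplyConnected {n : ℕ} {X : Type*} [TopologicalSpace X] {z : Set X}
    {G : Type*} [Group G] (H : Holonomy {x : X // x ∉ z} G) {T : UnifSys n X}
    [SimplyConnectedSpace T.V] (hT : Subsingleton T.G) (hz : ∀ v, T.π v ∉ z) : T.IsAdapted H := by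
  intro g v w hg σ h
  obtain rfl : g = 1 := Subsingleton.elim _ _
  rw [one_smul] at hg
  subst hg
  refine iff_of_true ?_ rfl
  let q : C(T.V, {x : X // x ∉ z}) :=
    ⟨fun v => ⟨T.π v, hz v⟩, T.continuous_π.subtype_mk _⟩
  have h1 : Path.Homotopic.Quotient.mk σ = Path.Homotopic.Quotient.mk (Path.refl v) :=
    Quotient.sound (SimplyConnectedSpace.paths_homotopic σ (Path.refl v))
  have h2 : T.hol H σ h = H.toFun ((Path.Homotopic.Quotient.mk σ).map q) :=
    H.toFun_mk_congr _ (σ.map q.continuous) fun t => rfl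
  rw [h2, h1]
  exact (congrArg H.toFun (congrArg Path.Homotopic.Quotient.mk (Path.ext rfl))).trans
    (H.map_refl (q v))

/-- The left half plane which the exponential maps onto the punctured disc of radius `R`. -/
def halfPlane (R : ℝ) : Set ℂ := {ζ | ζ.re < Real.log R}

theorem convex_halfPlane (R : ℝ) : Convex ℝ (halfPlane R) :=
  convex_halfSpace_re_lt _

theorem mem_halfPlane_iff {R : ℝ} (hR : 0 < R) {ζ : ℂ} :
    ζ ∈ halfPlane R ↔ Complex.exp ζ ∈ Metric.ball (0 : ℂ) R := by
  rw [mem_ball_zero_iff, Complex.norm_exp, ← Real.lt_log_iff_exp_lt hR]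
  rfl

instance (R : ℝ) : SimplyConnectedSpace (halfPlane R) := by
  have : ContractibleSpace (halfPlane R) := (convex_halfPlane R).contractibleSpace
    ⟨((Real.log R - 1 : ℝ) : ℂ), by
      change (((Real.log R - 1 : ℝ) : ℂ)).re < _
      rw [Complex.ofReal_re]; linarith⟩
  infer_instance

/-- The deck transformations of the exponential. -/
noncomputable def deck {R : ℝ} (k : ℤ) (ζ : halfPlane R) : halfPlane R :=
  ⟨ζ.1 + k * (2 * Real.pi * Complex.I), by
    have h1 : (ζ.1 + k * (2 * Real.pi * Complex.I)).re = ζ.1.re := by simp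
    have h2 : ζ.1.re < Real.log R := ζ.2
    change (ζ.1 + k * (2 * Real.pi * Complex.I)).re < Real.log R
    rwa [h1]⟩

theorem continuous_deck {R : ℝ} (k : ℤ) : Continuous (deck k : halfPlane R → halfPlane R) :=
  (continuous_subtype_val.add continuous_const).subtype_mk _

theorem deck_deck {R : ℝ} (k l : ℤ) (ζ : halfPlane R) : deck k (deck l ζ) = deck (k + l) ζ := by
  refine Subtype.ext ?_
  simp only [deck]
  push_cast
  ring

theorem deck_zero {R : ℝ} (ζ : halfPlane R) : deck 0 ζ = ζ := by
  refine Subtype.ext ?_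
  simp [deck]

theorem exp_deck {R : ℝ} (k : ℤ) (ζ : halfPlane R) :
    Complex.exp (deck k ζ).1 = Complex.exp ζ.1 := by
  simp only [deck]
  rw [Complex.exp_add, Complex.exp_int_mul_two_pi_mul_I, mul_one]

variable {Y : Type*} [TopologicalSpace Y] {G : Type*} [Group G] (H : Holonomy Y G) {R : ℝ}
  (q : C(halfPlane R, Y))

/-- The holonomy along the image of any path from `ζ` to `ζ'` in the half plane. -/
noncomputable def planeHol (ζ ζ' : halfPlane R) : G :=
  H.toFun ((Path.Homotopic.Quotient.mk (PathConnectedSpace.somePath ζ ζ')).map q)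

theorem planeHol_eq {ζ ζ' : halfPlane R} (s : Path ζ ζ') :
    H.toFun ((Path.Homotopic.Quotient.mk s).map q) = planeHol H q ζ ζ' := by
  have h1 : Path.Homotopic.Quotient.mk s =
      Path.Homotopic.Quotient.mk (PathConnectedSpace.somePath ζ ζ') :=
    Quotient.sound (SimplyConnectedSpace.paths_homotopic _ _)
  rw [planeHol, h1]

theorem planeHol_mul (ζ ζ' ζ'' : halfPlane R) :
    planeHol H q ζ' ζ'' * planeHol H q ζ ζ' = planeHol H q ζ ζ'' := by
  rw [← planeHol_eq H q ((PathConnectedSpace.somePath ζ ζ').trans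
    (PathConnectedSpace.somePath ζ' ζ''))]
  refine Eq.trans (H.map_trans _ _).symm (congrArg H.toFun ?_)
  exact congrArg Path.Homotopic.Quotient.mk (Path.map_trans _ _ _).symm

variable {q} (hq : ∀ ζ, q (deck 1 ζ) = q ζ)

include hq

theorem apply_deck (k : ℤ) (ζ : halfPlane R) : q (deck k ζ) = q ζ := by
  induction k using Int.induction_on with
  | zero => rw [deck_zero]
  | succ k ih => rw [add_comm, ← deck_deck, hq, ih]
  | pred k ih => rw [← ih, ← hq (deck (-k - 1) ζ), deck_deck]; congr 2; ring

theorem planeHol_deck (k : ℤ) (ζ ζ' : halfPlane R) :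
    planeHol H q (deck k ζ) (deck k ζ') = planeHol H q ζ ζ' := by
  let s := PathConnectedSpace.somePath ζ ζ'
  rw [← planeHol_eq H q (s.map (continuous_deck k)), ← planeHol_eq H q s]
  have key : ∀ {u w u' w' : Y} (p : Path u w) (p' : Path u' w'), u = u' → w = w' →
      (∀ t, p t = p' t) →
      H.toFun (Path.Homotopic.Quotient.mk p) = H.toFun (Path.Homotopic.Quotient.mk p') := by
    rintro u w _ _ p p' rfl rfl h
    rw [show p = p' from Path.ext (funext h)]
  exact key ((s.map (continuous_deck k)).map q.continuous) (s.map q.continuous)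
    (apply_deck hq k ζ) (apply_deck hq k ζ') fun t => apply_deck hq k (s t)

theorem planeHol_deck_self (k : ℤ) (ζ : halfPlane R) :
    planeHol H q ζ (deck k ζ) = planeHol H q ζ (deck 1 ζ) ^ k := by
  have h0 : ∀ ζ, planeHol H q ζ ζ = 1 := fun ζ => mul_eq_left.1 (planeHol_mul H q ζ ζ ζ)
  have hstep : ∀ k : ℤ, planeHol H q ζ (deck (k + 1) ζ) =
      planeHol H q ζ (deck 1 ζ) * planeHol H q ζ (deck k ζ) := fun k => by
    rw [← planeHol_mul H q ζ (deck k ζ), ← deck_deck k 1, planeHol_deck H hq]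
  induction k using Int.induction_on with
  | zero => rw [deck_zero, h0, zpow_zero]
  | succ k ih => rw [hstep, ih, mul_self_zpow]
  | pred k ih =>
    have h1 := hstep (-k - 1)
    rw [sub_add_cancel, ih] at h1
    rw [← mul_left_cancel_iff (a := planeHol H q ζ (deck 1 ζ)), ← h1, mul_self_zpow,
      sub_add_cancel]

/-- The holonomy of the `k`-th power of the loop around the puncture is trivial if and only if `k`
is a multiple of the order of the holonomy of the loop, whatever the base point. -/
theorem exists_planeHol_eq_one_iff [Finite G] :
    ∃ m : ℕ, m ≠ 0 ∧ ∀ (ζ : halfPlane R) (k : ℤ), planeHol H q ζ (deck k ζ) = 1 ↔ (m : ℤ) ∣ k := by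
  obtain ⟨ζ₀⟩ : Nonempty (halfPlane R) := inferInstance
  refine ⟨orderOf (planeHol H q ζ₀ (deck 1 ζ₀)), (orderOf_pos _).ne', fun ζ k => ?_⟩
  rw [planeHol_deck_self H hq, ← orderOf_dvd_iff_zpow_eq_one]
  have h1 := planeHol_mul H q ζ₀ ζ (deck 1 ζ)
  rw [← planeHol_mul H q ζ₀ (deck 1 ζ₀) (deck 1 ζ), planeHol_deck H hq] at h1
  have h2 : planeHol H q ζ (deck 1 ζ) =
      planeHol H q ζ₀ ζ * planeHol H q ζ₀ (deck 1 ζ₀) * (planeHol H q ζ₀ ζ)⁻¹ :=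
    eq_mul_inv_of_mul_eq h1
  have h3 : orderOf (planeHol H q ζ (deck 1 ζ)) = orderOf (planeHol H q ζ₀ (deck 1 ζ₀)) := by
    rw [h2]
    exact orderOf_injective (MulAut.conj (planeHol H q ζ₀ ζ)).toMonoidHom
      (MulAut.conj _).injective _
  rw [h3]

end Puncture

/-- Around a marked point there is a branched disc adapted to the holonomy: its order is that of the
holonomy of a small loop around the point. -/
theorem exists_isAdapted_disc {C : Type*} [TopologicalSpace C] [ChartedSpace ℂ C]
    {z : Set C} {G : Type*} [Group G] [Finite G] (H : Holonomy {x : C // x ∉ z} G)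
    {c : OpenPartialHomeomorph C ℂ} (hcA : c ∈ IsManifold.maximalAtlas 𝓘(ℂ) ω C) {x : C}
    (hx : x ∈ c.source) (hcx : c x = 0) (hxz : x ∈ z) {R : ℝ} (hR : 0 < R)
    (hc : Metric.ball 0 R ⊆ c.target)
    (hz : ∀ w ∈ Metric.ball (0 : ℂ) R, c.symm w ∈ z → w = 0) :
    ∃ (T : UnifSys 2 C) (m : ℕ), IsBranchedChart T x m ∧ T.IsAdapted H ∧
      ∀ y ∈ T.U, y ∈ c.source ∧ c y ∈ Metric.ball (0 : ℂ) R := by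
  have hmem : ∀ ζ : halfPlane R, Complex.exp ζ.1 ∈ Metric.ball (0 : ℂ) R := fun ζ =>
    (mem_halfPlane_iff hR).1 ζ.2
  let q : C(halfPlane R, {x : C // x ∉ z}) :=
    ⟨fun ζ => ⟨c.symm (Complex.exp ζ.1), fun h => Complex.exp_ne_zero _ (hz _ (hmem ζ) h)⟩,
      (c.continuousOn_symm.comp_continuous (Complex.continuous_exp.comp continuous_subtype_val)
        fun ζ => hc (hmem ζ)).subtype_mk _⟩
  have hq : ∀ ζ, q (deck 1 ζ) = q ζ := fun ζ => Subtype.ext (congrArg c.symm (exp_deck 1 ζ))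
  obtain ⟨m, hm, hA⟩ := exists_planeHol_eq_one_iff H hq
  have : NeZero m := ⟨hm⟩
  have hr : 0 < min 1 R := lt_min one_pos hR
  have hrR : min 1 R ^ m ≤ R :=
    (pow_le_of_le_one hr.le (min_le_left _ _) hm).trans (min_le_right _ _)
  have hsub : Metric.ball (0 : ℂ) (min 1 R ^ m) ⊆ Metric.ball 0 R := Metric.ball_subset_ball hrR
  refine ⟨discSystem c (min 1 R) m hr (hsub.trans hc), m,
    isBranchedChart_discSystem hr _ hcA hx hcx, ?_, fun y hy => ?_⟩
  swap
  · have h := mem_U_discSystem hr _ hy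
    exact ⟨h.1, hsub h.2⟩
  intro g v w hg σ h
  let e := discCoord (c := c) (m := m) hr (hsub.trans hc)
  have he0 : ∀ t, e (σ t) ≠ 0 := fun t h0 => h t (by
    rw [discSystem_π]
    change c.symm (e (σ t) ^ m) ∈ z
    rw [h0, zero_pow hm, ← hcx, c.left_inv hx]
    exact hxz)
  -- a logarithm of the path
  let γ : C(unitInterval, {w : ℂ // w ≠ 0}) :=
    ⟨fun t => ⟨e (σ t), he0 t⟩, ((continuous_discCoord hr _).comp σ.continuous).subtype_mk _⟩
  have hγ0 : γ 0 = ⟨Complex.exp (Complex.log (e (σ 0))), Complex.exp_ne_zero _⟩ :=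
    Subtype.ext (Complex.exp_log (he0 0)).symm
  let s := Complex.isCoveringMap_exp.liftPath γ _ hγ0
  have hs : ∀ t, Complex.exp (s t) = e (σ t) := fun t =>
    congrArg Subtype.val (congrFun (Complex.isCoveringMap_exp.liftPath_lifts γ _ hγ0) t)
  have hms : ∀ t, Complex.exp (m * s t) = e (σ t) ^ m := fun t => by
    rw [Complex.exp_nat_mul, hs]
  have hsP : ∀ t, (m : ℂ) * s t ∈ halfPlane R := fun t => by
    rw [mem_halfPlane_iff hR, hms]
    exact hsub (discCoord_pow_mem hr _ (σ t))
  let ρ : Path (⟨_, hsP 0⟩ : halfPlane R) ⟨_, hsP 1⟩ :=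
    { toFun := fun t => ⟨m * s t, hsP t⟩
      continuous_toFun := (continuous_const.mul s.continuous).subtype_mk _
      source' := rfl
      target' := rfl }
  have hhol : hol H _ σ h = planeHol H q ⟨_, hsP 0⟩ ⟨_, hsP 1⟩ := by
    rw [← planeHol_eq H q ρ]
    refine H.toFun_mk_congr _ (ρ.map q.continuous) fun t => ?_
    change _ = c.symm (Complex.exp (m * s t))
    rw [hms]
    rfl
  -- the end points of the logarithm differ by a multiple of `2πi / m`
  obtain ⟨k, -, hk⟩ := (Complex.mem_rootsOfUnity m _).1 (discChar_mem hr (hsub.trans hc) g)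
  have hm0 : (m : ℂ) ≠ 0 := Nat.cast_ne_zero.2 hm
  have hend : Complex.exp (s 1) = Complex.exp (s 0 + 2 * Real.pi * Complex.I * (k / m)) := by
    rw [Complex.exp_add, hk, hs, hs, σ.source, σ.target, ← hg, mul_comm]
    exact discCoord_smul hr _ g v
  obtain ⟨l, hl⟩ := Complex.exp_eq_exp_iff_exists_int.1 hend
  have hdeck : (⟨_, hsP 1⟩ : halfPlane R) = deck (k + m * l) ⟨_, hsP 0⟩ := by
    refine Subtype.ext ?_
    simp only [deck]
    rw [hl]
    push_cast
    field_simp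
    ring
  rw [hhol, hdeck, hA, dvd_add_left (dvd_mul_right _ _)]
  constructor
  · rintro ⟨j, hj⟩
    refine discChar_injective hr (hsub.trans hc) (Units.ext ?_)
    rw [map_one, Units.val_one, ← hk]
    refine Complex.exp_eq_one_iff.2 ⟨j, ?_⟩
    have : (k : ℂ) = m * j := by exact_mod_cast hj
    rw [this]
    field_simp
  · rintro rfl
    rw [map_one, Units.val_one] at hk
    obtain ⟨j, hj⟩ := Complex.exp_eq_one_iff.1 hk
    refine ⟨j, ?_⟩
    have hpi : (2 * Real.pi * Complex.I : ℂ) ≠ 0 := Complex.two_pi_I_ne_zero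
    have h1 : (k / m : ℂ) = j := mul_left_cancel₀ hpi (hj.trans (mul_comm _ _))
    have h2 : (k : ℂ) = m * j := by rw [← h1]; field_simp
    exact_mod_cast h2

/-! ### The adapted cover of a Riemann surface -/

namespace UnifSys

theorem IsAdapted.eq_one_of_smul_eq {n : ℕ} {X : Type*} [TopologicalSpace X] {z : Set X}
    {G : Type*} [Group G] {H : Holonomy {x : X // x ∉ z} G} {T : UnifSys n X} (hT : T.IsAdapted H)
    (v : T.V) (hv : T.π v ∉ z) (g : T.G) (hg : g • v = v) : g = 1 :=
  (hT g v v hg (Path.refl v) fun _ => hv).1 (H.map_refl ⟨T.π v, hv⟩)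

end UnifSys

section Discs

variable {C : Type*} [TopologicalSpace C] [ChartedSpace ℂ C]

theorem IsBranchedChart.simplyConnectedSpace {T : UnifSys 2 C} {x : C} {m : ℕ}
    (h : IsBranchedChart T x m) : SimplyConnectedSpace T.V := by
  obtain ⟨c, -, -, -, -, r, e, χ, hr, hei, hel, he, -⟩ := h
  have hoe : IsOpenEmbedding e :=
    .of_continuous_injective_isOpenMap hel.contMDiff.continuous hei hel.isOpenMap
  have : ContractibleSpace (range e) := by
    rw [he]
    exact (convex_ball (0 : ℂ) r).contractibleSpace ⟨0, Metric.mem_ball_self hr⟩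
  have : ContractibleSpace T.V := hoe.toIsEmbedding.toHomeomorph.contractibleSpace
  infer_instance

variable [IsManifold 𝓘(ℂ) ω C]

/-- A holomorphic coordinate centred at a point, and a disc which it maps into a given
neighbourhood. -/
theorem exists_centred_coord (x : C) {A : Set C} (hA : A ∈ 𝓝 x) :
    ∃ c ∈ IsManifold.maximalAtlas 𝓘(ℂ) ω C, x ∈ c.source ∧ c x = 0 ∧ ∃ R : ℝ, 0 < R ∧
      Metric.ball 0 R ⊆ c.target ∧ ∀ w ∈ Metric.ball (0 : ℂ) R, c.symm w ∈ A := by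
  let c := (chartAt ℂ x).trans
    (Homeomorph.subRight (chartAt ℂ x x)).toOpenPartialHomeomorph
  have hcA : c ∈ IsManifold.maximalAtlas 𝓘(ℂ) ω C :=
    trans_sub_mem_maximalAtlas (IsManifold.chart_mem_maximalAtlas x) _
  have hx : x ∈ c.source := by simp [c]
  have hcx : c x = 0 := by simp [c]
  have h0 : (0 : ℂ) ∈ c.target := hcx ▸ c.map_source hx
  have h0x : c.symm 0 = x := by rw [← hcx, c.left_inv hx]
  have hev : ∀ᶠ w in 𝓝 (0 : ℂ), w ∈ c.target ∧ c.symm w ∈ A :=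
    Filter.Eventually.and (c.open_target.mem_nhds h0)
      ((c.continuousAt_symm h0).eventually_mem (by rwa [h0x]))
  obtain ⟨R, hR, hb⟩ := Metric.eventually_nhds_iff_ball.1 hev
  exact ⟨c, hcA, hx, hcx, R, hR, fun w hw => (hb w hw).1, fun w hw => (hb w hw).2⟩

/-- Every point has arbitrarily small unbranched charts. -/
theorem exists_unbranched_chart (x : C) {A : Set C} (hA : A ∈ 𝓝 x) :
    ∃ T : UnifSys 2 C, IsBranchedChart T x 1 ∧ T.U ⊆ A := by
  obtain ⟨c, hcA, hx, hcx, R, hR, hc, hcAs⟩ := exists_centred_coord x hA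
  have hc1 : Metric.ball 0 (R ^ 1) ⊆ c.target := by rwa [pow_one]
  refine ⟨discSystem c R 1 hR hc1, isBranchedChart_discSystem hR hc1 hcA hx hcx, fun y hy => ?_⟩
  obtain ⟨h1, h2⟩ := mem_U_discSystem hR hc1 hy
  rw [pow_one] at h2
  rw [← c.left_inv h1]
  exact hcAs _ h2

theorem exists_adapted_branched_chart [T2Space C] {z : Set C} (hz : z.Finite) {G : Type*} [Group G]
    [Finite G] (H : Holonomy {x : C // x ∉ z} G) {x : C} (hx : x ∈ z) :
    ∃ (T : UnifSys 2 C) (m : ℕ), IsBranchedChart T x m ∧ T.IsAdapted H ∧ T.U ∩ z ⊆ {x} := by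
  have hA : (z \ {x})ᶜ ∈ 𝓝 x := (hz.sdiff.isClosed.isOpen_compl).mem_nhds fun h => h.2 rfl
  obtain ⟨c, hcA, hxc, hcx, R, hR, hc, hcAs⟩ := exists_centred_coord x hA
  have key : ∀ w ∈ Metric.ball (0 : ℂ) R, c.symm w ∈ z → c.symm w = x := fun w hw hwz => by
    by_contra hne
    exact hcAs w hw ⟨hwz, hne⟩
  obtain ⟨T, m, hT, hTa, hTU⟩ := exists_isAdapted_disc H hcA hxc hcx hx hR hc fun w hw hwz => by
    rw [← c.right_inv (hc hw), key w hw hwz, hcx]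
  refine ⟨T, m, hT, hTa, fun y hy => ?_⟩
  obtain ⟨h1, h2⟩ := hTU y hy.1
  have h3 := key _ h2
  rw [c.left_inv h1] at h3
  exact h3 hy.2

end Discs

section Cover

variable {C : Type*} [TopologicalSpace C] [ChartedSpace ℂ C] {z : Set C} {G : Type*} [Group G]
  {H : Holonomy {x : C // x ∉ z} G}

/-- An unbranched chart outside the marked points, compatible with given charts `D x` at the marked
points `x`. -/
structure IsSmallDisc (D : z → UnifSys 2 C) (T : UnifSys 2 C) : Prop where
  unbranched : ∃ y, IsBranchedChart T y 1
  disjoint : ∀ y ∈ T.U, y ∉ z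
  inj : ∀ x, T.U ⊆ (D x).U → Nonempty (Inj T (D x))

theorem IsSmallDisc.isAdapted {D : z → UnifSys 2 C} {T : UnifSys 2 C} (hT : IsSmallDisc D T) :
    T.IsAdapted H := by
  obtain ⟨y, hy⟩ := hT.unbranched
  have := hy.simplyConnectedSpace
  exact .of_simplyConnected H (Nat.card_eq_one_iff_unique.1 hy.card_eq).1
    fun v => hT.disjoint _ (T.π_mem v)

variable [IsManifold 𝓘(ℂ) ω C]

theorem IsSmallDisc.nonempty_inj {D : z → UnifSys 2 C} {S T : UnifSys 2 C} (hS : IsSmallDisc D S)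
    (hT : IsSmallDisc D T) (h : S.U ⊆ T.U) : Nonempty (Inj S T) := by
  obtain ⟨y, hy⟩ := hS.unbranched
  obtain ⟨y', hy'⟩ := hT.unbranched
  refine exists_inj_of_isRegularAt hy.effective hy'.effective (hy.π_injective rfl)
    (fun v => hy.isRegularAt (.inr rfl)) isOpen_univ (hy'.π_injective rfl).injOn
    (fun v _ => hy'.isRegularAt (.inr rfl)) (by rwa [image_univ])

variable [T2Space C]

/-- Every point outside the marked points is the centre of arbitrarily small compatible discs. -/
theorem exists_isSmallDisc (hz : z.Finite) {D : z → UnifSys 2 C} {m : z → ℕ}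
    (hD : ∀ x, IsBranchedChart (D x) x (m x)) (hDa : ∀ x, (D x).IsAdapted H) {y : C} (hy : y ∉ z)
    {A : Set C} (hA : A ∈ 𝓝 y) :
    ∃ T : UnifSys 2 C, IsBranchedChart T y 1 ∧ IsSmallDisc D T ∧ T.U ⊆ A := by
  have hfin : Finite z := hz
  -- near `y`, the disc `D x` has a section through regular points
  have hN : ∀ x : z, ∃ B ∈ 𝓝 y, y ∈ (D x).U → ∃ N : Set (D x).V, IsOpen N ∧
      InjOn (D x).π N ∧ (∀ v ∈ N, (D x).IsRegularAt v) ∧ B ⊆ (D x).π '' N := by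
    intro x
    by_cases hyx : y ∈ (D x).U
    · obtain ⟨v, hv⟩ := hyx
      obtain ⟨N, hNo, hvN, hinj⟩ := (D x).exists_injOn
        ((hDa x).eq_one_of_smul_eq v (by rwa [hv]))
      have hNo' : IsOpen (N ∩ (D x).π ⁻¹' {x.1}ᶜ) :=
        hNo.inter (isOpen_compl_singleton.preimage (D x).continuous_π)
      have hvN' : v ∈ N ∩ (D x).π ⁻¹' {x.1}ᶜ :=
        ⟨hvN, fun h => hy (by rw [← hv, show (D x).π v = x.1 from h]; exact x.2)⟩
      refine ⟨_, ((D x).isOpenMap_π _ hNo').mem_nhds ⟨v, hvN', hv⟩, fun _ =>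
        ⟨_, hNo', hinj.mono inter_subset_left, fun u hu => (hD x).isRegularAt (.inl hu.2),
          Subset.rfl⟩⟩
    · exact ⟨univ, Filter.univ_mem, fun h => (hyx h).elim⟩
  choose B hB hBN using hN
  obtain ⟨T, hT, hTU⟩ := exists_unbranched_chart y (A := A ∩ zᶜ ∩ ⋂ x, B x)
    (Filter.inter_mem (Filter.inter_mem hA (hz.isClosed.isOpen_compl.mem_nhds hy))
      (Filter.iInter_mem.2 hB))
  refine ⟨T, hT, ⟨⟨y, hT⟩, fun u hu => (hTU hu).1.2, fun x hx => ?_⟩, fun u hu => (hTU hu).1.1⟩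
  obtain ⟨N, hNo, hinj, hNr, hBx⟩ := hBN x (hx hT.mem_U)
  exact exists_inj_of_isRegularAt hT.effective (hD x).effective (hT.π_injective rfl)
    (fun v => hT.isRegularAt (.inr rfl)) hNo hinj hNr
    fun u hu => hBx (mem_iInter.1 (hTU hu).2 x)

/-- A Riemann surface with marked points has a cover adapted to any holonomy of the complement of
the marked points in a finite group. -/
theorem AdaptedCover.exists_isOrbicurve [Finite G] (hz : z.Finite)
    (H : Holonomy {x : C // x ∉ z} G) : ∃ A : AdaptedCover H, IsOrbicurve z A.orb := by
  classical
  choose D m hD hDa hDz using fun x : z => exists_adapted_branched_chart hz H x.2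
  have hDD : ∀ {x x' : z}, x.1 ∈ (D x').U → x = x' := fun {x x'} h =>
    Subtype.ext (hDz x' ⟨h, x.2⟩)
  let P : UnifSys 2 C → Prop := fun T => (∃ x, T = D x) ∨ IsSmallDisc D T
  have hbasis : ∀ y ∉ z, ∀ A ∈ 𝓝 y, ∃ T, P T ∧ y ∈ T.U ∧ T.U ⊆ A := fun y hy A hA => by
    obtain ⟨T, h1, h2, h3⟩ := exists_isSmallDisc hz hD hDa hy hA
    exact ⟨T, .inr h2, h1.mem_U, h3⟩
  have hinj : ∀ S T, P S → P T → S.U ⊆ T.U → Nonempty (Inj S T) := by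
    rintro S T (⟨x, rfl⟩ | hS) (⟨x', rfl⟩ | hT) h
    · obtain rfl := hDD (h (hD x).mem_U)
      exact ⟨Inj.refl _⟩
    · exact (hT.disjoint _ (h (hD x).mem_U) x.2).elim
    · exact hS.inj x' h
    · exact hS.nonempty_inj hT h
  have heff : ∀ T, P T → T.Effective := by
    rintro T (⟨x, rfl⟩ | hT)
    · exact (hD x).effective
    · obtain ⟨y, hy⟩ := hT.unbranched
      exact hy.effective
  have hmarked : ∀ T, P T → ∀ y ∈ T.U, ∀ hy : y ∈ z, T = D ⟨y, hy⟩ := by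
    rintro T (⟨x, rfl⟩ | hT) y hyT hy
    · rw [hDD (x := ⟨y, hy⟩) hyT]
    · exact (hT.disjoint y hyT hy).elim
  choose dom hdom hdomU using fun U : {U : Set C | ∃ T, P T ∧ T.U = U} => U.2
  let A : AdaptedCover H :=
    { cover := {U | ∃ T, P T ∧ T.U = U}
      dom := dom
      dom_U := hdomU
      sUnion_cover := by
        refine eq_univ_of_forall fun y => ?_
        by_cases hy : y ∈ z
        · exact ⟨_, ⟨D ⟨y, hy⟩, .inl ⟨_, rfl⟩, rfl⟩, (hD ⟨y, hy⟩).mem_U⟩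
        · obtain ⟨T, h1, h2, -⟩ := hbasis y hy univ Filter.univ_mem
          exact ⟨_, ⟨T, h1, rfl⟩, h2⟩
      dom_inj := fun U₂ U₁ h => hinj _ _ (hdom U₂) (hdom U₁) (by rwa [hdomU, hdomU])
      dom_inter := by
        intro U₁ U₂ y hy
        by_cases hyz : y ∈ z
        · have h1 := hmarked _ (hdom U₁) y (by rw [hdomU]; exact hy.1) hyz
          have h2 := hmarked _ (hdom U₂) y (by rw [hdomU]; exact hy.2) hyz
          have h3 : (U₁ : Set C) = U₂ := by rw [← hdomU U₁, ← hdomU U₂, h1, h2]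
          exact ⟨U₁, hy.1, fun u hu => ⟨hu, h3 ▸ hu⟩⟩
        · have ho : ∀ U : {U : Set C | ∃ T, P T ∧ T.U = U}, IsOpen (U : Set C) := fun U =>
            hdomU U ▸ (dom U).isOpen_U
          obtain ⟨T, h1, h2, h3⟩ := hbasis y hyz _ (((ho U₁).inter (ho U₂)).mem_nhds hy)
          exact ⟨⟨_, T, h1, rfl⟩, h2, h3⟩
      effective := fun U => heff _ (hdom U)
      adapted := by
        intro U
        rcases hdom U with ⟨x, hx⟩ | hU
        · rw [hx]; exact hDa x
        · exact hU.isAdapted }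
  have hA : ∀ T, P T → ∀ y ∈ T.U, UnifSys.EquivAt y T (A.orb.chart y) := by
    intro T hT y hy
    let U : A.cover := ⟨T.U, T, hT, rfl⟩
    have hU : (A.dom U).U = T.U := hdomU U
    obtain ⟨i⟩ := hinj _ _ (hdom U) hT hU.le
    obtain ⟨R, h1, ⟨j⟩, h2⟩ := A.belongs U y (hU ▸ hy)
    exact ⟨R, h1, ⟨i.comp j⟩, h2⟩
  refine ⟨A, fun x => if hx : x ∈ z then m ⟨x, hx⟩ else 1, fun x => ?_, fun x hx => dif_neg hx,
    fun x => ?_⟩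
  · dsimp only
    split_ifs with hx
    · exact Nat.one_le_iff_ne_zero.2 (hD ⟨x, hx⟩).ne_zero
    · exact le_rfl
  · dsimp only
    split_ifs with hx
    · exact ⟨D ⟨x, hx⟩, hD _, hA _ (.inl ⟨_, rfl⟩) x (hD ⟨x, hx⟩).mem_U⟩
    · obtain ⟨T, h1, h2, -⟩ := exists_isSmallDisc hz hD hDa hx Filter.univ_mem
      exact ⟨T, h1, hA T (.inr h2) x h1.mem_U⟩

end Cover

/-! ### Orbicurves -/

namespace IsOrbicurve

variable {C : Type*} [TopologicalSpace C] [ChartedSpace ℂ C] {z : Set C} {O : OrbStruct 2 C}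
  {n' : ℕ} {X' : Type*} [TopologicalSpace X'] {O' : OrbStruct n' X'} {p : X'}

theorem reduced (h : IsOrbicurve z O) : O.Reduced := by
  obtain ⟨m, -, -, hm⟩ := h
  intro x
  obtain ⟨S, hS, hSO⟩ := hm x
  exact hSO.effective hS.effective

/-- The points outside the marked points have trivial local groups. -/
theorem freeOutside (h : IsOrbicurve z O) {f : C → X'} (ξ : CompatSys O O' f) :
    ξ.FreeOutside z := by
  have hO := h.reduced
  obtain ⟨m, -, hm1, hm⟩ := h
  intro U v hv g hg
  obtain ⟨S, hS, hSO⟩ := hm ((ξ.dom U).π v)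
  obtain ⟨s, hs⟩ := hS.mem_U
  obtain ⟨R, r, i, j, hR, hir, hjr⟩ :=
    (hSO.trans' (hO _) (ξ.dom_belongs U _ ((ξ.dom U).π_mem v)).symm').exists_inj
      hS.effective hs rfl
  obtain ⟨k, -, rfl⟩ := j.exists_hom_eq ((ξ.dom_belongs U).effective hO) (x := r)
    (h := g) (by rw [hjr, hg])
  have := (Nat.card_eq_one_iff_unique.1 (hS.card_eq.trans (hm1 _ hv))).1
  rw [i.hom_injective (Subsingleton.elim (i.hom k) (i.hom 1)), map_one]

/-- The local group at the centre of a branched chart of order `m` has order `m`, and for a framed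
monomorphic system it is adapted to the holonomy: the group homomorphism at the point is read off
from the holonomy. -/
theorem exists_adapted_center {S' : UnifSys n' X'} {H : Holonomy {x : C // x ∉ z} S'.G}
    (hO : O.Reduced) (hS' : S'.Effective) {ξ : CompatSys O O' (fun _ => p)}
    (hm : ξ.Monomorphic) {c : ∀ U, Inj (ξ.cod U) S'} {F : ξ.RegPt z → S'.G}
    (hF : CompatSys.IsFraming c H F) {x : C} {m : ℕ} {S : UnifSys 2 C} (hS : IsBranchedChart S x m)
    (hSO : UnifSys.EquivAt x S (O.chart x)) :
    ∃ (R : UnifSys 2 C) (r : R.V), R.Effective ∧ R.IsAdapted H ∧ R.π r = x ∧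
      (∀ g : R.G, g • r = r) ∧ Nat.card R.G = m := by
  obtain ⟨U, v, hv⟩ := ξ.exists_mem_cover x
  obtain ⟨s, hs, hfix⟩ := hS.exists_center
  have hx : x ∈ (ξ.dom U).U := ⟨v, hv⟩
  have hT := (ξ.dom_belongs U).effective hO
  obtain ⟨Q, q, i, j, hQ, hiq, hjq⟩ :=
    (hSO.trans' (hO _) (ξ.dom_belongs U _ hx).symm').exists_inj hS.effective hs hv
  obtain ⟨R, k, r, hR, hkr, -, hrfix⟩ := hQ.exists_restrict q Filter.univ_mem
  refine ⟨R, r, hR, ?_, ?_, hrfix, ?_⟩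
  · intro g u w hg σ h
    let a := j.comp k
    have ha : ∀ y : R.V, R.π y ∉ z → (ξ.dom U).π (a y) ∉ z := fun y hy => by rwa [a.π_toFun]
    have hu : R.π u ∉ z := by simpa using h 0
    have hw : R.π w ∉ z := by simpa using h 1
    have h' : ∀ t, (ξ.dom U).π (σ.map a.continuous t) ∉ z := fun t => ha _ (h t)
    -- the framing along the path, and along the automorphism given by `g`
    have e1 := hF.path U (σ.map a.continuous) h' (ha u hu) (ha w hw)
    have e2 : ξ.tau hS' c ((ξ.dom U).aut (a.hom g)) * F ⟨U, a u, ha u hu⟩ =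
        F ⟨U, a w, ha w hw⟩ := by
      have hgw : (ξ.dom U).aut (a.hom g) (a u) = a w := by
        rw [← hg, a.equivariant]; rfl
      have key : ∀ (y : (ξ.dom U).V) (hy : (ξ.dom U).π y ∉ z)
          (hyw : (ξ.dom U).aut (a.hom g) (a u) = y),
          ξ.tau hS' c ((ξ.dom U).aut (a.hom g)) * F ⟨U, a u, ha u hu⟩ = F ⟨U, y, hy⟩ := by
        rintro _ hy rfl
        exact hF.hop hS' _ _ _ _
      exact key _ _ hgw
    have e3 : R.hol H σ h = (ξ.dom U).hol H (σ.map a.continuous) h' :=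
      hol_congr σ (σ.map a.continuous) h h' fun t => (a.π_toFun (σ t)).symm
    have e4 : F ⟨U, a u, ha u hu⟩ = F ⟨U, a w, ha w hw⟩ * R.hol H σ h := e1.trans (by rw [e3]; rfl)
    have e5 : R.hol H σ h = 1 ↔ ξ.tau hS' c ((ξ.dom U).aut (a.hom g)) = 1 := by
      rw [← mul_eq_left (a := F ⟨U, a w, ha w hw⟩), ← e4, ← e2, eq_comm, mul_eq_right]
    rw [e5]
    constructor
    · intro h1
      rw [CompatSys.tau_aut_eq_one] at h1
      refine a.hom_injective ((hm U (a r) (a.hom g) ?_ h1).trans (map_one _).symm)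
      rw [← a.equivariant, hrfix]
    · rintro rfl
      rw [map_one]
      have h1 := ξ.tau_comp hS' c ((ξ.dom U).aut 1) ((ξ.dom U).aut 1)
      rw [UnifSys.aut_comp_aut, mul_one] at h1
      exact left_eq_mul.1 h1
  · rw [← k.π_toFun, hkr, ← i.π_toFun, hiq, hs]
  · rw [← hS.card_eq]
    refine Nat.card_congr (Equiv.ofBijective (i.comp k).hom ⟨(i.comp k).hom_injective, fun g => ?_⟩)
    have h1 : (i.comp k) r = s := (congrArg i hkr).trans hiq
    obtain ⟨l, -, hl⟩ := (i.comp k).exists_hom_eq hS.effective (x := r) (h := g)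
      (by rw [h1, hfix])
    exact ⟨l, hl⟩

/-- Two orbicurves over which a constant map has framed monomorphic systems with the same holonomy
are equivalent: the local groups are determined by the holonomy, and their orders determine the
branched charts. -/
theorem equiv_of_isFraming {O₂ : OrbStruct 2 C} (h : IsOrbicurve z O) (h₂ : IsOrbicurve z O₂)
    (hz : z.Finite) {S' : UnifSys n' X'} (hS' : S'.Effective) {H : Holonomy {x : C // x ∉ z} S'.G}
    {ξ : CompatSys O O' (fun _ => p)} (hm : ξ.Monomorphic) {c : ∀ U, Inj (ξ.cod U) S'}
    {F : ξ.RegPt z → S'.G} (hF : CompatSys.IsFraming c H F)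
    {ξ₂ : CompatSys O₂ O' (fun _ => p)} (hm₂ : ξ₂.Monomorphic) {c₂ : ∀ U, Inj (ξ₂.cod U) S'}
    {F₂ : ξ₂.RegPt z → S'.G} (hF₂ : CompatSys.IsFraming c₂ H F₂) : O.Equiv O₂ := by
  have hO := h.reduced
  have hO₂ := h₂.reduced
  obtain ⟨m, -, -, hS⟩ := h
  obtain ⟨m₂, -, -, hT⟩ := h₂
  intro x
  obtain ⟨S, hS, hSO⟩ := hS x
  obtain ⟨T, hT, hTO⟩ := hT x
  obtain ⟨Q, q, hQ, hQa, hQx, hqfix, hQc⟩ := exists_adapted_center hO hS' hm hF hS hSO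
  obtain ⟨R, r, hR, hRa, hRx, hrfix, hRc⟩ := exists_adapted_center hO₂ hS' hm₂ hF₂ hT hTO
  have hmm : m x = m₂ x := by
    rw [← hQc, ← hRc]
    exact le_antisymm (hQa.card_le hz hRa hQ hRa.eq_one_of_smul_eq hqfix ⟨r, hRx.trans hQx.symm⟩)
      (hRa.card_le hz hQa hR hQa.eq_one_of_smul_eq hrfix ⟨q, hQx.trans hRx.symm⟩)
  rw [← hmm] at hT
  exact (hSO.symm'.trans' hS.effective (hS.equivAt hT)).trans' hT.effective hTO

end IsOrbicurve

theorem proposition2p2p10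
    -- a (connected) Riemann surface with finitely many marked points
    {C : Type*} [TopologicalSpace C] [T2Space C] [SecondCountableTopology C] [ConnectedSpace C]
    [ChartedSpace ℂ C] [IsManifold 𝓘(ℂ) ω C] (z : Set C) (hz : z.Finite)
    -- a reduced orbifold
    {n : ℕ} {X : Type*} [TopologicalSpace X] [T2Space X] [SecondCountableTopology X]
    (OX : OrbStruct n X) (hred : OX.Reduced)
    -- a point `p` and a chart `S` of the orbifold centred at it, so that `S.G` is the group of `p`
    (p : X) (S : UnifSys n X) (hS : OX.Belongs S) (x₀ : S.V) (hx₀ : S.π x₀ = p)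
    (hfix : ∀ g : S.G, g • x₀ = x₀)
    -- a base point and a conjugacy class of homomorphisms
    (z₀ : {x : C // x ∉ z}) (Θ : ConjHom (FundamentalGroup {x : C // x ∉ z} z₀) S.G) :
    ∃ O : OrbStruct 2 C, IsOrbicurve z O ∧
      -- over `O` there is exactly one smooth map with underlying map the constant map; it is good,
      (∃ L : SmoothLift O OX (fun _ => p), L.IsGood ∧
        (∀ L₂ : SmoothLift O OX (fun _ => p), L.Equiv L₂) ∧
        -- and its compatible systems of characteristic `Θ` form exactly one isomorphism class
        ∃ ξ : CompatSys O OX (fun _ => p), ξ.IsSystemOf L ∧ ξ.Monomorphic ∧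
          (∀ Θ' : ConjHom (FundamentalGroup {x : C // x ∉ z} z₀) S.G,
            ξ.HasCharacteristic S z z₀ Θ' ↔ Θ' = Θ) ∧
          ∀ ξ₂ : CompatSys O OX (fun _ => p), ξ₂.IsSystemOf L →
            (ξ₂.HasCharacteristic S z z₀ Θ ↔ ξ.Iso ξ₂)) ∧
      -- the orbifold structure is unique
      ∀ O₂ : OrbStruct 2 C, IsOrbicurve z O₂ →
        (∃ ξ₂ : CompatSys O₂ OX (fun _ => p), ξ₂.Monomorphic ∧
          ξ₂.HasCharacteristic S z z₀ Θ) → O.Equiv O₂ := by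
  have hSe := hS.effective hred
  obtain ⟨θ, rfl⟩ := Quotient.exists_rep Θ
  have hpc : PathConnectedSpace {x : C // x ∉ z} :=
    isPathConnected_iff_pathConnectedSpace.1 (isPathConnected_compl_of_finite (E := ℂ)
      (by rw [Complex.rank_real_complex]; exact Cardinal.one_lt_two) hz)
  obtain ⟨H, hH⟩ := Holonomy.exists_of_hom z₀ θ
  obtain ⟨A, hA⟩ := AdaptedCover.exists_isOrbicurve hz H
  have hfree : ∀ ξ' : CompatSys A.orb OX (fun _ => p), ξ'.FreeOutside z := hA.freeOutside
  let ξ := A.compatSys hz hS hx₀ hfix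
  have hm : ξ.Monomorphic := A.monomorphic_compatSys hz hS hx₀ hfix hSe
  have hF := A.isFraming_compatSys hz hS hx₀ hfix hSe
  have hrefl : ξ.Iso ξ := hF.iso hF hz hred hS hx₀ hfix
  refine ⟨A.orb, hA, ⟨SmoothLift.const A.orb hS hSe hx₀,
    ⟨ξ, ξ.isSystemOf_of_const A.reduced hred _⟩,
    fun L₂ => SmoothLift.equiv_of_const A.reduced hred _ L₂,
    ξ, ξ.isSystemOf_of_const A.reduced hred _, hm, fun Θ' => ⟨fun h => ?_, ?_⟩,
    fun ξ₂ _ => ⟨fun h => ?_, fun h => ?_⟩⟩, fun O₂ hO₂ => ?_⟩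
  · exact hF.eq_of_hasCharacteristic A.reduced hred hS hx₀ hfix hfree hH h
  · rintro rfl
    exact hF.hasCharacteristic hSe (hfree ξ) hH hrefl
  · obtain ⟨ξ', h', c, F, hF'⟩ := h.exists_framing A.reduced hSe hfree hH
    exact (hF.iso hF' hz hred hS hx₀ hfix).trans A.reduced hred h'.symm
  · exact hF.hasCharacteristic hSe (hfree ξ) hH h.symm
  · rintro ⟨ξ₂, hm₂, h₂⟩
    obtain ⟨ξ', h', c, F, hF'⟩ :=
      h₂.exists_framing hO₂.reduced hSe hO₂.freeOutside hH
    exact hA.equiv_of_isFraming hO₂ hz hSe hm hF (hm₂.of_iso hO₂.reduced hred h') hF'
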